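/- **Setting.** Write $\langle\xi\rangle=(1+\xi^2)^{1/2}$ and $\|f\|_{H^{s,\ell}}^2=\sum_{\beta\le \ell}\|\langle D_x\rangle^s\partial_y^\beta f\|_{L^2(\mathbb R_x\times(0,\infty)_y)}^2$. For $\theta\in(0,\tfrac12]$ and $\lambda>0$ let $\Phi(t,\xi)=(1-\lambda t)\langle\xi\rangle^{\frac12+2\theta}$ and $f_\Phi=\mathcal F_x^{-1}(e^{\Phi(t,\xi)}\widehat f(\xi))$. *Shear flow.* Let $c>0$ and let $u^s_0$ be a function on $[0,\infty)$ with $\partial_y^k u_0^s\in L^2((0,\infty);e^{y}dy)$ for $k=1,2,3,4$, $u_0^s(0)=\partial_y^2u_0^s(0)=0$, $\lim_{y\to\infty}u_0^s=1$, $\partial_yu_0^s(1)=0$ and $\partial_y^2u_0^s\ge c$ on $[\frac12,2]$. Let $u^s$ be the solution of $\partial_tu^s=\partial_y^2u^s$, $u^s|_{y=0}=0$, $u^s|_{t=0}=u_0^s$, given by the Dirichlet heat kernel of the half line: $$u^s(t,y)=\frac1{2\sqrt{\pi t}}\int_0^\infty\Big(e^{-\frac{(y-z)^2}{4t}}-e^{-\frac{(y+z)^2}{4t}}\Big)u^s_0(z)\,dz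 .$$ For $\delta>0$ we call a time $T>0$ with a function $a$ on $[0,T]$ *admissible* if, for all $t\in[0,T]$, $\partial_y^2u^s(t,y)\ge\frac c2$ for $y\in[\frac12,2]$, $|\partial_yu^s(t,y)|\ge\frac{c\delta}2e^{-y}$ for $y>0$ with $y\notin(1-\delta,1+\delta)$, $\partial_yu^s(t,a(t))=0$ and $|a(t)-1|\le2\delta$. *Cut-offs and weight.* $\phi_1\in C^\infty([0,\infty))$ vanishes on $(1-\delta,1+\delta)$ and equals $1$ on $[0,1-2\delta]\cup[1+2\delta,\infty)$; $\psi_2\in C^\infty(\mathbb R)$ is supported in $[1-3\delta,1+3\delta]$ and equals $1$ on $[1-2\delta,1+2\delta]$. The weight is $\varphi(t,y)=\phi(y-a(t))$, where $\phi\ge0$ is Lipschitz, $\phi(0)=0$, and $\varphi(t,y)=0$ whenever $t\in[0,T]$ and $|y-1|>2\delta$. *Unknowns.* For $u=u(t,x,y)$ put $$w_1=\partial_y\Big(\frac u{\partial_yu^s}\Big),\quad \overline w_1=e^{-y/2}\phi_1w_1,\quad w_2=\partial_yu^s\,\partial_yu-u\,\partial_y^2u^s,\quad \overline w_2=\psi_2w_2,$$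 $$F_2=\partial_t\partial_yu^s\,\partial_yu+[\partial_yu^s,\partial_y^2]\partial_yu-u\,\partial_t\partial_y^2u^s-[\partial_y^2u^s,\partial_y^2]u .$$ By a solution on $[0,T]$ we mean a function $u$ with values $u(t,\cdot,y)\in L^2(\mathbb R_x)$ ($0\le t\le T$, $y>0$), such that $u(t,\cdot,\cdot)$ is, as an $L^2(\mathbb R_x)$-valued function of $y\in(0,\infty)$, of class $C^2$ for $t\in[0,T]$ and of class $C^3$ for $t\in(0,T)$; $(\partial_y^ku)_\Phi$ ($k=0,1,2$) takes values in $H^2(\mathbb R_x)$ and is continuous on $[0,T]\times(0,\infty)$ into $H^2(\mathbb R_x)$, and likewise $(\partial_y^3u)_\Phi$ on $(0,T)\times(0,\infty)$; $u(t,\cdot,y)\to0$ in $L^2(\mathbb R_x)$ as $y\to0^+$ for every $t\in[0,T]$; and, on $(0,T)\times(0,\infty)$, in $L^2(\mathbb R_x)$, $$\partial_t\overline w_2+u^s\partial_x\overline w_2-\partial_y^2\overline w_2=[\psi_2,\partial_y^2]w_2+\psi_2F_2 ,$$ where $\partial_t\overline w_2$ and $\partial_x\overline w_2$ exist in $L^2(\mathbb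 R_x)$. (No growth condition as $y\to\infty$ is imposed; norms on the right-hand side below may be infinite.) **Proposition.** Let $u_0^s,c,\theta$ be as above and let $\theta_1>0$. There is $\delta_0>0$ such that the following holds for every $\delta\in(0,\delta_0]$ for which $|\partial_yu_0^s(y)|\ge c\delta e^{-y}$ on $[0,1-\delta]\cup[1+\delta,\infty)$. 1. There is an admissible pair $(T,a)$ with $T>0$. 2. For every admissible $(T,a)$, all $\phi_1,\psi_2,\phi$ as above and every $\delta_2>0$ there is a constant $C>0$ such that, for every $\lambda>0$, every solution $u$ on $[0,T]$ and every $t\in[0,T]$, the norms $\|(w_2)_\Phi\varphi^{\frac{1+\theta_1}2}\|_{H^{\frac12,0}}$, $\|(w_2)_\Phi\varphi^{\frac{1+\theta_1}2}\|_{H^{\frac34+\theta,0}}$ and $\|\partial_y(w_2)_\Phi\varphi^{\frac{1+\theta_1}2}\|_{H^{\frac12,0}}$ are finite at time $t$, the square of the first is differentiable at $t$ as a function on $[0,T]$ (one-sidedly at the end points), and $$\begin{aligned}&\frac d{dt}\big\|(w_2)_\Phi\varphi^{\frac{1+\theta_1}2}\big\|_{H^{\frac12,0}}^2+(\lambda-C)\big\|(w_2)_\Phi\varphi^{\frac{1+\theta_1}2}\big\|_{H^{\frac34+\theta,0}}^2+\big\|\partial_y(w_2)_\Phi\varphi^{\frac{1+\theta_1}2}\big\|_{H^{\frac12,0}}^2\\&\quad\le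 C\Big(\|u_\Phi\|_{H^{\frac14,1}}^2+\|(\overline w_1)_\Phi\|_{H^{\frac12,0}}^2+\|(\overline w_2)_\Phi\|_{H^{\frac58,0}}^2+\big\|(w_2)_\Phi\varphi^{\frac{1+\theta_1}2}\big\|_{H^{\frac12,0}}^2\Big)+\delta_2\big\|\partial_y(\overline w_2)_\Phi\big\|_{H^{\frac38,0}}^2 .\end{aligned}$$ -/

import Mathlib

open MeasureTheory Set Filter Topology FourierTransform
open scoped ContDiff ENNReal NNReal

noncomputable section

namespace LinPrandtl

/-! ### Functions of the tangential variable

A function `f(t, x, y)` is viewed as a map `(t, y) ↦ f t y` with values in `L²(ℝ_x)`. -/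

/-- `L²(ℝ_x; ℂ)`. -/
abbrev L2x : Type := Lp ℂ 2 (volume : Measure ℝ)

/-- The Japanese bracket `⟨D_x⟩ = (1 + |D_x|²)^(1/2)` as a Fourier symbol. With Mathlib's
normalisation `e^{-2π i x ξ}` of the Fourier transform, `D_x` has the symbol `2 π ξ`. -/
def jap (ξ : ℝ) : ℝ := Real.sqrt (1 + (2 * Real.pi * ξ) ^ 2)

/-- The symbol `⟨ξ⟩^s e^{Φ(t,ξ)}`, where `Φ(t,ξ) = (1 - lam t) ⟨ξ⟩^{1/2 + 2θ}`. -/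
def gevSymbol (θ lam s t ξ : ℝ) : ℝ :=
  jap ξ ^ s * Real.exp ((1 - lam * t) * jap ξ ^ (1 / 2 + 2 * θ))

/-- The Fourier transform of `⟨D_x⟩^s f_Φ`. -/
def gevHat (θ lam s t : ℝ) (f : L2x) : ℝ → ℂ :=
  fun ξ => (gevSymbol θ lam s t ξ : ℂ) * (𝓕 f : L2x) ξ

/-- `f_Φ ∈ H^s(ℝ_x)`, for `s ≥ 0`. -/
def InGev (θ lam s t : ℝ) (f : L2x) : Prop := MemLp (gevHat θ lam s t f) 2 volume

open Classical in
/-- The function `⟨D_x⟩^s f_Φ` (and `0` unless `f_Φ ∈ H^s`). -/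
def gev (θ lam s t : ℝ) (f : L2x) : L2x :=
  if h : InGev θ lam s t f then 𝓕⁻ (h.toLp (gevHat θ lam s t f)) else 0

/-- `‖⟨D_x⟩^s f_Φ‖_{L²(ℝ_x)}`, with the value `∞` unless `f_Φ ∈ H^s` (Plancherel). -/
def gevENorm (θ lam s t : ℝ) (f : L2x) : ℝ≥0∞ := eLpNorm (gevHat θ lam s t f) 2 volume

/-- `‖f_Φ‖²_{H^{s,0}}` at time `t`, for a function `y ↦ f y` on the half line `y > 0`. -/
def normSq (θ lam s t : ℝ) (f : ℝ → L2x) : ℝ≥0∞ :=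
  ∫⁻ y in Ioi (0 : ℝ), gevENorm θ lam s t (f y) ^ 2

/-- `g = ∂_x f`. -/
def HasXDeriv (f g : L2x) : Prop :=
  ∀ᵐ ξ : ℝ, (𝓕 g : L2x) ξ = (2 * Real.pi * Complex.I * ξ : ℂ) * (𝓕 f : L2x) ξ

/-! ### Derivatives in `t` and `y` -/

section Derivatives

variable {E : Type*} [NormedAddCommGroup E] [NormedSpace ℝ E]

/-- `∂_y f`. -/
def dy (f : ℝ → ℝ → E) : ℝ → ℝ → E := fun t y => deriv (f t) y

/-- `∂_t f`. -/
def dt (f : ℝ → ℝ → E) : ℝ → ℝ → E := fun t y => deriv (fun τ => f τ y) t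

/-- The product `f g` of a scalar function `f` and a function `g`. -/
def prodF (f : ℝ → ℝ → ℝ) (g : ℝ → ℝ → E) : ℝ → ℝ → E := fun t y => f t y • g t y

/-- The commutator `[f, ∂_y²] g = f ∂_y² g - ∂_y² (f g)`. -/
def commDyy (f : ℝ → ℝ → ℝ) (g : ℝ → ℝ → E) : ℝ → ℝ → E :=
  fun t y => prodF f (dy (dy g)) t y - dy (dy (prodF f g)) t y

end Derivatives

/-! ### The shear flow -/

/-- The solution of `∂_t u - ∂_y² u = 0` on `y > 0` with `u = 0` at `y = 0` and `u = us0` at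
`t = 0`. -/
def shearFlow (us0 : ℝ → ℝ) (t y : ℝ) : ℝ :=
  if t ≤ 0 then us0 y else
    1 / (2 * Real.sqrt (Real.pi * t)) *
      ∫ z in Ioi (0 : ℝ),
        (Real.exp (-(y - z) ^ 2 / (4 * t)) - Real.exp (-(y + z) ^ 2 / (4 * t))) * us0 z

/-- The `k`-th derivative of the initial shear profile on `[0, ∞)`. -/
def dk (k : ℕ) (us0 : ℝ → ℝ) : ℝ → ℝ := iteratedDerivWithin k us0 (Ici 0)

/-- Assumptions on the initial shear profile that do not involve `δ`. The fields `contDiff`,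
`memLp` and `fourth` say that `∂_y us0 ∈ H³` with the weight `e^{y/2}`. -/
structure IsShearData (us0 : ℝ → ℝ) (c : ℝ) : Prop where
  contDiff : ContDiffOn ℝ 3 us0 (Ici 0)
  memLp : ∀ k : ℕ, 1 ≤ k → k ≤ 3 →
    MemLp (fun y => Real.exp (y / 2) * dk k us0 y) 2 (volume.restrict (Ioi 0))
  fourth : ∃ g : ℝ → ℝ, MemLp (fun y => Real.exp (y / 2) * g y) 2 (volume.restrict (Ioi 0)) ∧
    ∀ y, 0 ≤ y → dk 3 us0 y = dk 3 us0 0 + ∫ z in (0 : ℝ)..y, g z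
  zero : us0 0 = 0
  second_zero : dk 2 us0 0 = 0
  limit : Tendsto us0 atTop (𝓝 1)
  critical : dk 1 us0 1 = 0
  convex : ∀ y ∈ Icc (1 / 2 : ℝ) 2, c ≤ dk 2 us0 y

/-- `|∂_y us0| ≥ c δ e^{-y}` on `[0, 1-δ] ∪ [1+δ, ∞)`. -/
def MonotoneAway (us0 : ℝ → ℝ) (c δ : ℝ) : Prop :=
  ∀ y, 0 ≤ y → (y ≤ 1 - δ ∨ 1 + δ ≤ y) → c * δ * Real.exp (-y) ≤ |dk 1 us0 y|

/-- On `[0, T]` the shear flow `us` keeps half of its initial convexity and monotonicity, and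
`a t` is its critical point, at distance at most `2 δ` from `1`. -/
structure Admissible (us : ℝ → ℝ → ℝ) (c δ T : ℝ) (a : ℝ → ℝ) : Prop where
  convex : ∀ t ∈ Icc 0 T, ∀ y ∈ Icc (1 / 2 : ℝ) 2, c / 2 ≤ dy (dy us) t y
  monotone : ∀ t ∈ Icc 0 T, ∀ y, 0 < y → (y ≤ 1 - δ ∨ 1 + δ ≤ y) →
    c * δ / 2 * Real.exp (-y) ≤ |dy us t y|
  critical : ∀ t ∈ Icc 0 T, dy us t (a t) = 0
  near_one : ∀ t ∈ Icc 0 T, |a t - 1| ≤ 2 * δ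

/-! ### Cut-off functions and the weight -/

/-- `φ₁` is smooth, supported in `[0, 1-δ] ∪ [1+δ, ∞)`, and `φ₁ = 1` on
`[0, 1-2δ] ∪ [1+2δ, ∞)`. -/
structure IsOuterCutoff (δ : ℝ) (φ₁ : ℝ → ℝ) : Prop where
  smooth : ContDiffOn ℝ ∞ φ₁ (Ici 0)
  support : ∀ y, 1 - δ < y → y < 1 + δ → φ₁ y = 0
  eq_one : ∀ y, 0 ≤ y → (y ≤ 1 - 2 * δ ∨ 1 + 2 * δ ≤ y) → φ₁ y = 1

/-- `ψ₂` is smooth, supported in `[1-3δ, 1+3δ]`, and `ψ₂ = 1` on `[1-2δ, 1+2δ]`. -/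
structure IsInnerCutoff (δ : ℝ) (ψ₂ : ℝ → ℝ) : Prop where
  smooth : ContDiff ℝ ∞ ψ₂
  support : ∀ y, y ∉ Icc (1 - 3 * δ) (1 + 3 * δ) → ψ₂ y = 0
  eq_one : ∀ y ∈ Icc (1 - 2 * δ) (1 + 2 * δ), ψ₂ y = 1

/-- The profile `ϕ` of the weight `φ(t, y) = ϕ (y - a t)`: it is nonnegative and Lipschitz, it
vanishes at `0` (so that the weight vanishes at the critical point), and for all `t ∈ [0, T]` the
weight vanishes where `|y - 1| > 2 δ`. -/
structure IsWeight (δ T : ℝ) (a ϕ : ℝ → ℝ) : Prop where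
  nonneg : ∀ z, 0 ≤ ϕ z
  lipschitz : ∃ K : ℝ≥0, LipschitzWith K ϕ
  zero : ϕ 0 = 0
  support : ∀ t ∈ Icc 0 T, ∀ y, 2 * δ < |y - 1| → ϕ (y - a t) = 0

/-! ### The good unknowns -/

/-- `w₁ = ∂_y (u / ∂_y us)`. -/
def w1 (us : ℝ → ℝ → ℝ) (u : ℝ → ℝ → L2x) : ℝ → ℝ → L2x :=
  dy (prodF (fun t y => (dy us t y)⁻¹) u)

/-- `w̄₁ = e^{-y/2} φ₁ w₁`. -/
def w1bar (us : ℝ → ℝ → ℝ) (φ₁ : ℝ → ℝ) (u : ℝ → ℝ → L2x) : ℝ → ℝ → L2x :=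
  prodF (fun _ y => Real.exp (-y / 2) * φ₁ y) (w1 us u)

/-- `w₂ = ∂_y us ∂_y u - u ∂_y² us`. -/
def w2 (us : ℝ → ℝ → ℝ) (u : ℝ → ℝ → L2x) : ℝ → ℝ → L2x :=
  fun t y => prodF (dy us) (dy u) t y - prodF (dy (dy us)) u t y

/-- `w̄₂ = ψ₂ w₂`. -/
def w2bar (us : ℝ → ℝ → ℝ) (ψ₂ : ℝ → ℝ) (u : ℝ → ℝ → L2x) : ℝ → ℝ → L2x :=
  prodF (fun _ y => ψ₂ y) (w2 us u)

/-- `F₂ = ∂_t∂_y us ∂_y u + [∂_y us, ∂_y²] ∂_y u - u ∂_t∂_y² us - [∂_y² us, ∂_y²] u`. -/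
def F2 (us : ℝ → ℝ → ℝ) (u : ℝ → ℝ → L2x) : ℝ → ℝ → L2x :=
  fun t y => prodF (dt (dy us)) (dy u) t y + commDyy (dy us) (dy u) t y
    - prodF (dt (dy (dy us))) u t y - commDyy (dy (dy us)) u t y

/-- `u` is a classical solution on `[0, T]`: `∂_y^k u_Φ`, `k ≤ 2`, are continuous on
`[0, T] × (0, ∞)` with values in `H²(ℝ_x)`, and so is `∂_y³ u_Φ` on `(0, T) × (0, ∞)`; moreover
`u = 0` at `y = 0`, and `w̄₂` solves
`∂_t w̄₂ + us ∂_x w̄₂ - ∂_y² w̄₂ = [ψ₂, ∂_y²] w₂ + ψ₂ F₂` on `(0, T) × (0, ∞)`. -/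
structure IsSolution (us : ℝ → ℝ → ℝ) (ψ₂ : ℝ → ℝ) (θ lam T : ℝ) (u : ℝ → ℝ → L2x) : Prop where
  contDiff_two : ∀ t ∈ Icc 0 T, ContDiffOn ℝ 2 (u t) (Ioi 0)
  contDiff_three : ∀ t ∈ Ioo 0 T, ContDiffOn ℝ 3 (u t) (Ioi 0)
  inGev_two : ∀ k : ℕ, k ≤ 2 → ∀ t ∈ Icc 0 T, ∀ y, 0 < y → InGev θ lam 2 t (dy^[k] u t y)
  continuous_two : ∀ k : ℕ, k ≤ 2 →
    ContinuousOn (fun p : ℝ × ℝ => gev θ lam 2 p.1 (dy^[k] u p.1 p.2)) (Icc 0 T ×ˢ Ioi 0)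
  inGev_three : ∀ t ∈ Ioo 0 T, ∀ y, 0 < y → InGev θ lam 2 t (dy^[3] u t y)
  continuous_three :
    ContinuousOn (fun p : ℝ × ℝ => gev θ lam 2 p.1 (dy^[3] u p.1 p.2)) (Ioo 0 T ×ˢ Ioi 0)
  boundary : ∀ t ∈ Icc 0 T, Tendsto (u t) (𝓝[>] 0) (𝓝 0)
  equation : ∀ t ∈ Ioo 0 T, ∀ y, 0 < y →
    ∃ q : L2x, HasXDeriv (w2bar us ψ₂ u t y) q ∧
      HasDerivAt (fun τ => w2bar us ψ₂ u τ y)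
        (-(us t y • q) + dy (dy (w2bar us ψ₂ u)) t y
          + commDyy (fun _ y => ψ₂ y) (w2 us u) t y + ψ₂ y • F2 us u t y) t

/-- The weight `φ(t, y)^{(1+θ₁)/2}`. -/
def weight (θ₁ : ℝ) (a ϕ : ℝ → ℝ) : ℝ → ℝ → ℝ := fun t y => ϕ (y - a t) ^ ((1 + θ₁) / 2)

end LinPrandtl

end

/-! Write `S k` for `∂_y^k us` and `U k` for the Fourier transform of `⟨D_x⟩² (∂_y^k u)_Φ`. An `H^s`
norm of `f_Φ` is the `L²` norm of `⟨ξ⟩^{-(2-s)}` times the lift of `f`, that is of `japOp (2 - s)`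
applied to it. The estimate thus concerns Hilbert-space-valued functions of `(t, y)` near the
critical point, with `W = S 1 • U 1 - S 2 • U 0` in the role of `w₂`.

Energy identity. In the moving frame `z = y - a t` the squared weight `P = ϕ^{1+θ₁}` does not depend
on time, at the price of a drift `a' ∂_y` with `a' = -S 3 / S 2` at the critical point. The decrease
of `Φ` in time gives `-2 lam` times the weighted `H^{3/4+θ}` norm, transport is skew-adjoint and
drops out, and diffusion gives `-2 ∫ P ‖∂_y w₂‖²` and a term with the bounded function `P'`. Since
`us` solves the heat equation, `F₂` collapses to `2 (S 3) ∂_y u - 2 (S 2) ∂_y² u`.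

The difficulty is `∂_y² u`, which the right-hand side does not control. From `∂_y w₂ = (S 1) ∂_y² u
- (S 3) u` one gets `∂_y² u = (∂_y w₂ + (S 3) u) / S 1`, singular at the critical point. The weight
`P` vanishes there to first order, so `P / S 1` is bounded, which settles `∂_y w₂`. For `u / S 1`,
let `b` be an end point of `[1-2δ, 1+2δ]` and split `u = (S 1 / S 1(b)) u(b) + h`. In the first part
the singularity cancels, and a trace inequality bounds `u(b)`. For `h`, the identity `∂_y (u / S 1)
= w₂ / (S 1)²` and a Hardy inequality bound `h` in `L²` by the unweighted `w₂`
(`integral_remainder_left`). Each product of two `H^{1/2}` quantities is redistributed as `3/4 +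
1/4` or `5/8 + 3/8`: the weighted `H^{3/4}` norm goes into the dissipation, and `∂_y w₂` in
`H^{3/8}` receives the small factor (`errorTerm_le`, `IsSpatialSetup.integral_errorTerm_le`).

The equation holds in `L²` only, whereas the energy needs derivatives of Gevrey lifts. An injective
operator damping high frequencies makes all symbols bounded; derivatives are computed after damping
and recovered by integration (`hasDerivAt_of_injective`). After integration by parts the rate is
continuous on `[0, T]`, which yields one-sided derivatives at the end points.

Admissible times come from the odd extension of the profile, whose heat flow is a Gaussian average:
uniform continuity handles bounded `y`, comparison with exponentials handles large `y`. -/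

noncomputable section

namespace LinPrandtl

section

/-! ### Gaussian averages -/

/-- The standard Gaussian measure on the line. -/
abbrev stdGauss : Measure ℝ := ProbabilityTheory.gaussianReal 0 1

/-- The average `∫ f (y + s z) κ z dγ(z)` with respect to the standard Gaussian measure `γ`. -/
def gaussMean (κ f : ℝ → ℝ) (s y : ℝ) : ℝ := ∫ z, f (y + s * z) * κ z ∂stdGauss

lemma integrable_id_stdGauss : Integrable (fun z : ℝ => z) stdGauss :=
  (ProbabilityTheory.memLp_id_gaussianReal (μ := 0) (v := 1) 1).integrable (by norm_num)

lemma integrable_bdd_mul_stdGauss {κ f : ℝ → ℝ} (hκ : Integrable κ stdGauss) (hf : Continuous f)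
    {M : ℝ} (hM : ∀ x, |f x| ≤ M) (s y : ℝ) :
    Integrable (fun z => f (y + s * z) * κ z) stdGauss :=
  hκ.bdd_mul (c := M) (by fun_prop) (ae_of_all _ fun z => by simpa using hM _)

lemma continuous_gaussMean {κ f : ℝ → ℝ} (hκ : Integrable κ stdGauss) (hf : Continuous f)
    {M : ℝ} (hM : ∀ x, |f x| ≤ M) :
    Continuous (fun p : ℝ × ℝ => gaussMean κ f p.1 p.2) := by
  refine continuous_of_dominated (bound := fun z => M * ‖κ z‖)
    (fun p => (integrable_bdd_mul_stdGauss hκ hf hM _ _).1) (fun p => ae_of_all _ fun z => ?_)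
    (hκ.norm.const_mul M) (ae_of_all _ fun z => by fun_prop)
  rw [norm_mul]
  exact mul_le_mul_of_nonneg_right (by simpa using hM _) (norm_nonneg _)

lemma hasDerivAt_gaussMean_right {κ f f' : ℝ → ℝ} (hκ : Integrable κ stdGauss)
    (hd : ∀ x, HasDerivAt f (f' x) x) (hf' : Continuous f')
    {M M' : ℝ} (hM : ∀ x, |f x| ≤ M) (hM' : ∀ x, |f' x| ≤ M') (s y : ℝ) :
    HasDerivAt (fun y => gaussMean κ f s y) (gaussMean κ f' s y) y := by
  have hf : Continuous f := continuous_iff_continuousAt.2 fun x => (hd x).continuousAt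
  refine (hasDerivAt_integral_of_dominated_loc_of_deriv_le (s := univ)
    (F := fun y z => f (y + s * z) * κ z) (F' := fun y z => f' (y + s * z) * κ z)
    (bound := fun z => M' * ‖κ z‖) univ_mem
    (Eventually.of_forall fun x => (integrable_bdd_mul_stdGauss hκ hf hM _ _).1)
    (integrable_bdd_mul_stdGauss hκ hf hM _ _)
    (integrable_bdd_mul_stdGauss hκ hf' hM' _ _).1
    (ae_of_all _ fun z x _ => ?_) (hκ.norm.const_mul M') (ae_of_all _ fun z x _ => ?_)).2
  · rw [norm_mul]
    exact mul_le_mul_of_nonneg_right (by simpa using hM' _) (norm_nonneg _)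
  · exact ((hd _).comp_add_const x (s * z)).mul_const (κ z)

/-- The `s`-derivative brings down a factor `z`, hence the weight `id`. Gaussian integration by
parts later trades this factor for `s` times one more derivative, which is the heat equation after
`s = √(2t)`. -/
lemma hasDerivAt_gaussMean_one_left {f f' : ℝ → ℝ}
    (hd : ∀ x, HasDerivAt f (f' x) x) (hf' : Continuous f')
    {M M' : ℝ} (hM : ∀ x, |f x| ≤ M) (hM' : ∀ x, |f' x| ≤ M') (s y : ℝ) :
    HasDerivAt (fun s => gaussMean 1 f s y) (gaussMean id f' s y) s := by
  have hf : Continuous f := continuous_iff_continuousAt.2 fun x => (hd x).continuousAt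
  have h1 : Integrable (1 : ℝ → ℝ) stdGauss := integrable_const 1
  refine (hasDerivAt_integral_of_dominated_loc_of_deriv_le (s := univ)
    (F := fun s z => f (y + s * z) * (1 : ℝ → ℝ) z) (F' := fun s z => f' (y + s * z) * id z)
    (bound := fun z => M' * ‖z‖) univ_mem
    (Eventually.of_forall fun x => (integrable_bdd_mul_stdGauss h1 hf hM _ _).1)
    (integrable_bdd_mul_stdGauss h1 hf hM _ _)
    (integrable_bdd_mul_stdGauss integrable_id_stdGauss hf' hM' _ _).1
    (ae_of_all _ fun z x _ => ?_) (integrable_id_stdGauss.norm.const_mul M')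
    (ae_of_all _ fun z x _ => ?_)).2
  · rw [norm_mul]
    exact mul_le_mul_of_nonneg_right (by simpa using hM' _) (norm_nonneg _)
  · have h : HasDerivAt (fun s : ℝ => y + s * z) z x := by
      simpa using ((hasDerivAt_id x).mul_const z).const_add y
    simpa [Function.comp_def] using (hd (y + x * z)).comp x h

/-- Gaussian integration by parts. -/
lemma gaussMean_id_eq {f f' : ℝ → ℝ}
    (hd : ∀ x, HasDerivAt f (f' x) x) (hf' : Continuous f')
    {M M' : ℝ} (hM : ∀ x, |f x| ≤ M) (hM' : ∀ x, |f' x| ≤ M') (s y : ℝ) :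
    gaussMean id f s y = s * gaussMean 1 f' s y := by
  have hf : Continuous f := continuous_iff_continuousAt.2 fun x => (hd x).continuousAt
  set g := ProbabilityTheory.gaussianPDFReal 0 1 with hg
  have hgd : ∀ x, HasDerivAt g (-x * g x) x := by
    intro x
    have h1 : HasDerivAt (fun x : ℝ => -(x - 0) ^ 2 / (2 * ((1 : ℝ≥0) : ℝ))) (-x) x := by
      have := (((hasDerivAt_id x).sub_const 0).pow 2).neg.div_const (2 * ((1 : ℝ≥0) : ℝ))
      refine this.congr_deriv ?_
      simp; ring
    have h2 := h1.exp.const_mul ((√(2 * Real.pi * ((1 : ℝ≥0) : ℝ)))⁻¹)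
    refine (h2.congr_deriv ?_)
    simp only [hg, ProbabilityTheory.gaussianPDFReal]
    ring
  have hint : ∀ κ : ℝ → ℝ, Integrable κ stdGauss → Integrable (fun x => g x * κ x) := by
    intro κ hκ
    rw [stdGauss, ProbabilityTheory.gaussianReal_of_var_ne_zero _ one_ne_zero] at hκ
    rw [integrable_withDensity_iff_integrable_smul₀'
      (by fun_prop) (ae_of_all _ fun x => ProbabilityTheory.gaussianPDF_lt_top)] at hκ
    simpa [ProbabilityTheory.toReal_gaussianPDF] using hκ
  have hdy : ∀ x, HasDerivAt (fun x => f (y + s * x)) (s * f' (y + s * x)) x := by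
    intro x
    have h : HasDerivAt (fun x : ℝ => y + s * x) s x := by
      simpa using ((hasDerivAt_id x).const_mul s).const_add y
    simpa [mul_comm, Function.comp_def] using (hd (y + s * x)).comp x h
  have hI := integral_mul_deriv_eq_deriv_mul_of_integrable (u := fun x => f (y + s * x))
    (u' := fun x => s * f' (y + s * x)) (v := g) (v' := fun x => -x * g x)
    (fun x _ => hdy x) (fun x _ => hgd x) ?_ ?_ ?_
  · rw [gaussMean, gaussMean, ProbabilityTheory.integral_gaussianReal_eq_integral_smul one_ne_zero,
      ProbabilityTheory.integral_gaussianReal_eq_integral_smul one_ne_zero, ← integral_const_mul]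
    have e1 : ∀ x, g x • (f (y + s * x) * id x) = -(f (y + s * x) * (-x * g x)) := fun x => by
      simp; ring
    have e2 : ∀ x, s * (g x • (f' (y + s * x) * (1 : ℝ → ℝ) x)) = s * f' (y + s * x) * g x :=
      fun x => by simp; ring
    simp_rw [← hg, e1, e2, integral_neg, hI, neg_neg]
  · have := (hint _ (integrable_bdd_mul_stdGauss integrable_id_stdGauss hf hM s y)).neg
    refine this.congr (ae_of_all _ fun x => ?_)
    simp; ring
  · have := (hint _ (integrable_bdd_mul_stdGauss (integrable_const (1:ℝ)) hf' hM' s y)).const_mul s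
    refine this.congr (ae_of_all _ fun x => ?_)
    simp; ring
  · have := (hint _ (integrable_bdd_mul_stdGauss (integrable_const (1:ℝ)) hf hM s y))
    refine this.congr (ae_of_all _ fun x => ?_)
    simp; ring

/-! ### The heat flow of a profile on the line -/

/-- A bounded `C³` function `d 0` on the line with bounded derivatives `d 1`, `d 2`, `d 3`. -/
structure IsC3Tower (d : ℕ → ℝ → ℝ) : Prop where
  deriv : ∀ k, k ≤ 2 → ∀ x, HasDerivAt (d k) (d (k + 1) x) x
  cont : ∀ k, k ≤ 3 → Continuous (d k)
  bdd : ∀ k, k ≤ 3 → ∃ M, ∀ x, |d k x| ≤ M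

/-- `∂_y^k` of the heat flow of `d 0`, for `k ≤ 4` (`k = 4` only for positive time). -/
def heat (d : ℕ → ℝ → ℝ) (k : ℕ) (t y : ℝ) : ℝ :=
  if k ≤ 3 then gaussMean 1 (d k) (√(2 * t)) y else (√(2 * t))⁻¹ * gaussMean id (d 3) (√(2 * t)) y

variable {d : ℕ → ℝ → ℝ}

/-- Continuity holds on the whole plane, in particular down to `t = 0`, because `√(2t)` is
continuous and equals `0` for `t ≤ 0`, where the average returns the profile itself. -/
lemma IsC3Tower.continuous_heat (hd : IsC3Tower d) {k : ℕ} (hk : k ≤ 3) :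
    Continuous (fun p : ℝ × ℝ => heat d k p.1 p.2) := by
  obtain ⟨M, hM⟩ := hd.bdd k hk
  simp only [heat, hk, if_true]
  exact (continuous_gaussMean (integrable_const 1) (hd.cont k hk) hM).comp
    (f := fun p : ℝ × ℝ => (√(2 * p.1), p.2)) (by fun_prop)

lemma IsC3Tower.continuousOn_heat_four (hd : IsC3Tower d) :
    ContinuousOn (fun p : ℝ × ℝ => heat d 4 p.1 p.2) (Ioi 0 ×ˢ univ) := by
  obtain ⟨M, hM⟩ := hd.bdd 3 le_rfl
  simp only [heat, show ¬ (4 ≤ 3) by norm_num, if_false]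
  refine ContinuousOn.mul (ContinuousOn.inv₀ (by fun_prop) ?_) ?_
  · rintro ⟨t, y⟩ ⟨ht, -⟩
    have : (0 : ℝ) < t := ht
    positivity
  · exact ((continuous_gaussMean integrable_id_stdGauss (hd.cont 3 le_rfl) hM).comp
      (f := fun p : ℝ × ℝ => (√(2 * p.1), p.2)) (by fun_prop)).continuousOn

lemma IsC3Tower.hasDerivAt_heat (hd : IsC3Tower d) {k : ℕ} (hk : k ≤ 2) (t y : ℝ) :
    HasDerivAt (heat d k t) (heat d (k + 1) t y) y := by
  obtain ⟨M, hM⟩ := hd.bdd k (by omega)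
  obtain ⟨M', hM'⟩ := hd.bdd (k + 1) (by omega)
  have := hasDerivAt_gaussMean_right (κ := 1) (integrable_const 1) (hd.deriv k hk)
    (hd.cont (k + 1) (by omega)) hM hM' (√(2 * t)) y
  have e : heat d k t = fun y => gaussMean 1 (d k) (√(2 * t)) y := by
    funext y; simp only [heat, show k ≤ 3 by omega, if_true]
  rw [e]
  simpa only [heat, show k + 1 ≤ 3 by omega, if_true] using this

/-- The profile has no fourth derivative to average. For positive time, integration by parts writes
`heat d 3` as an average of `d 2` against `z / √(2t)`, and differentiating that only needs `d 3`. -/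
lemma IsC3Tower.hasDerivAt_heat_three (hd : IsC3Tower d) {t : ℝ} (ht : 0 < t) (y : ℝ) :
    HasDerivAt (heat d 3 t) (heat d 4 t y) y := by
  obtain ⟨M, hM⟩ := hd.bdd 2 (by omega)
  obtain ⟨M', hM'⟩ := hd.bdd 3 (by omega)
  have hs : √(2 * t) ≠ 0 := by positivity
  have := (hasDerivAt_gaussMean_right (κ := id) integrable_id_stdGauss (hd.deriv 2 le_rfl)
    (hd.cont 3 (by omega)) hM hM' (√(2 * t)) y).const_mul (√(2 * t))⁻¹
  have e : heat d 3 t = fun y => (√(2 * t))⁻¹ * gaussMean id (d 2) (√(2 * t)) y := by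
    funext y
    rw [gaussMean_id_eq (hd.deriv 2 le_rfl) (hd.cont 3 (by omega)) hM hM']
    rw [inv_mul_cancel_left₀ hs]
    simp [heat]
  rw [e]
  simpa [heat] using this

lemma IsC3Tower.hasDerivAt_heat_time (hd : IsC3Tower d) {k : ℕ} (hk : k ≤ 2) {t : ℝ} (ht : 0 < t)
    (y : ℝ) : HasDerivAt (fun τ => heat d k τ y) (heat d (k + 2) t y) t := by
  obtain ⟨M, hM⟩ := hd.bdd k (by omega)
  obtain ⟨M', hM'⟩ := hd.bdd (k + 1) (by omega)
  have hs : √(2 * t) ≠ 0 := by positivity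
  have h1 := hasDerivAt_gaussMean_one_left (hd.deriv k hk)
    (hd.cont (k + 1) (by omega)) hM hM' (√(2 * t)) y
  have h2 : HasDerivAt (fun τ : ℝ => √(2 * τ)) (√(2 * t))⁻¹ t := by
    have := ((hasDerivAt_id t).const_mul 2).sqrt (by simpa using ht.ne')
    refine this.congr_deriv ?_
    simp only [id]
    field_simp
  have h3 := h1.comp t h2
  have e : (fun τ => heat d k τ y) = (fun s => gaussMean 1 (d k) s y) ∘ fun τ => √(2 * τ) := by
    funext τ; simp [heat, show k ≤ 3 by omega]
  rw [e]
  refine h3.congr_deriv ?_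
  -- For `k < 2` the factor `z` is integrated by parts onto the profile; for `k = 2` it is kept, and
  -- the result is `heat d 4` by definition.
  rcases Nat.lt_or_ge k 2 with h | h
  · obtain ⟨M'', hM''⟩ := hd.bdd (k + 2) (by omega)
    rw [gaussMean_id_eq (hd.deriv (k + 1) (by omega)) (hd.cont (k + 2) (by omega)) hM' hM'']
    simp only [heat, show k + 2 ≤ 3 by omega, if_true]
    field_simp
  · obtain rfl : k = 2 := by omega
    simp [heat, mul_comm]

end

section

/-! ### The extension of the shear profile to the line -/

/-- Cauchy–Schwarz against `e^{-y/2}`, which is square integrable on the half line. -/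
lemma integrableOn_of_memLp_exp {h : ℝ → ℝ}
    (hh : MemLp (fun y => Real.exp (y / 2) * h y) 2 (volume.restrict (Ioi 0))) :
    IntegrableOn h (Ioi 0) := by
  have hE : MemLp (fun y : ℝ => Real.exp (-(y / 2))) 2 (volume.restrict (Ioi 0)) := by
    rw [memLp_two_iff_integrable_sq (by fun_prop)]
    refine (integrableOn_exp_neg_Ioi 0).congr (ae_of_all _ fun y => ?_)
    simp only [← Real.exp_nsmul, nsmul_eq_mul]
    congr 1
    push_cast; ring
  refine (hE.integrable_mul hh).congr (ae_of_all _ fun y => ?_)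
  simp only [Pi.mul_apply]
  rw [← mul_assoc, ← Real.exp_add, neg_add_cancel, Real.exp_zero, one_mul]

lemma abs_le_of_eq_add_integral {f h : ℝ → ℝ} (hh : IntegrableOn h (Ioi 0))
    (hf : ∀ y, 0 ≤ y → f y = f 0 + ∫ z in (0 : ℝ)..y, h z) :
    ∃ M, ∀ y, 0 ≤ y → |f y| ≤ M := by
  refine ⟨|f 0| + ∫ z in Ioi 0, ‖h z‖, fun y hy => ?_⟩
  rw [hf y hy]
  refine (abs_add_le _ _).trans (add_le_add_right ?_ _)
  rw [intervalIntegral.integral_of_le hy, ← Real.norm_eq_abs]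
  refine (norm_integral_le_integral_norm _).trans ?_
  exact setIntegral_mono_set hh.norm (ae_of_all _ fun z => norm_nonneg _)
    Ioc_subset_Ioi_self.eventuallyLE

/-- The derivatives of the odd extension of the shear profile. -/
def shearExt (us0 : ℝ → ℝ) (k : ℕ) (z : ℝ) : ℝ :=
  if Even k then dk k us0 (max z 0) - dk k us0 (max (-z) 0) else dk k us0 |z|

variable {us0 : ℝ → ℝ} {c : ℝ}

lemma IsShearData.hasDerivWithinAt_dk (h : IsShearData us0 c) {k : ℕ} (hk : k ≤ 2) {y : ℝ}
    (hy : 0 ≤ y) : HasDerivWithinAt (dk k us0) (dk (k + 1) us0 y) (Ici 0) y := by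
  have hu : UniqueDiffOn ℝ (Ici (0 : ℝ)) := uniqueDiffOn_Ici 0
  have := (h.contDiff.differentiableOn_iteratedDerivWithin (m := k)
    (by norm_cast; omega) hu y hy).hasDerivWithinAt
  simpa [dk, iteratedDerivWithin_succ] using this

lemma IsShearData.continuousOn_dk (h : IsShearData us0 c) {k : ℕ} (hk : k ≤ 3) :
    ContinuousOn (dk k us0) (Ici 0) :=
  h.contDiff.continuousOn_iteratedDerivWithin (by norm_cast) (uniqueDiffOn_Ici 0)

lemma IsShearData.dk_zero_even (h : IsShearData us0 c) {k : ℕ} (hk : k ≤ 3) (he : Even k) :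
    dk k us0 0 = 0 := by
  interval_cases k
  · simpa [dk] using h.zero
  · simp at he
  · exact h.second_zero
  · exact absurd he (by decide)

lemma IsShearData.bdd_dk (h : IsShearData us0 c) {k : ℕ} (hk : k ≤ 3) :
    ∃ M, ∀ y, 0 ≤ y → |dk k us0 y| ≤ M := by
  rcases Nat.lt_or_ge k 3 with hk' | hk'
  · refine abs_le_of_eq_add_integral
      (integrableOn_of_memLp_exp (h.memLp (k + 1) (by omega) (by omega))) fun y hy => ?_
    rw [intervalIntegral.integral_eq_sub_of_hasDeriv_right_of_le hy
      ((h.continuousOn_dk hk).mono Icc_subset_Ici_self)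
      (fun x hx => (h.hasDerivWithinAt_dk (by omega) hx.1.le).mono
        (fun z hz => hx.1.le.trans (le_of_lt hz)))]
    · ring
    · exact ((h.continuousOn_dk (by omega)).mono
        (by rw [uIcc_of_le hy]; exact Icc_subset_Ici_self)).intervalIntegrable
  · obtain rfl : k = 3 := by omega
    obtain ⟨g, hg, hg'⟩ := h.fourth
    exact abs_le_of_eq_add_integral (integrableOn_of_memLp_exp hg) hg'

lemma IsShearData.shearExt_of_nonneg (h : IsShearData us0 c) {k : ℕ} (hk : k ≤ 3) {z : ℝ}
    (hz : 0 ≤ z) : shearExt us0 k z = dk k us0 z := by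
  unfold shearExt
  split_ifs with he
  · simp [hz, h.dk_zero_even hk he]
  · rw [abs_of_nonneg hz]

lemma IsShearData.shearExt_neg (h : IsShearData us0 c) {k : ℕ} (hk : k ≤ 3) {z : ℝ}
    (hz : 0 ≤ z) : shearExt us0 k (-z) = (if Even k then -dk k us0 z else dk k us0 z) := by
  unfold shearExt
  split_ifs with he
  · simp [hz, h.dk_zero_even hk he]
  · rw [abs_neg, abs_of_nonneg hz]

/-- The vanishing of the profile and of its second derivative at `0` makes the odd extension `C³`:
derivatives of even order extend oddly, those of odd order evenly. -/
lemma IsShearData.isC3Tower (h : IsShearData us0 c) : IsC3Tower (shearExt us0) := by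
  have hcont : ∀ k, k ≤ 3 → Continuous (shearExt us0 k) := by
    intro k hk
    have hc := h.continuousOn_dk hk
    unfold shearExt
    by_cases he : Even k
    · simp only [he, if_true]
      exact (hc.comp_continuous (by fun_prop) fun z => mem_Ici.2 (le_max_right _ _)).sub
        (hc.comp_continuous (by fun_prop) fun z => mem_Ici.2 (le_max_right _ _))
    · simp only [he, if_false]
      exact hc.comp_continuous (by fun_prop) fun z => mem_Ici.2 (abs_nonneg _)
  refine ⟨fun k hk => ?_, hcont, fun k hk => ?_⟩
  -- The two half lines are glued by continuity of the candidate derivative, so no difference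
  -- quotient at `0` is needed.
  · refine hasDerivAt_of_hasDerivAt_of_ne' (x := 0) (fun y hy => ?_)
      (hcont k (by omega)).continuousAt (hcont (k + 1) (by omega)).continuousAt
    rcases lt_or_gt_of_ne hy with hy | hy
    · have hd : HasDerivAt (dk k us0) (dk (k + 1) us0 (-y)) (-y) :=
        (h.hasDerivWithinAt_dk hk (by linarith)).hasDerivAt (Ici_mem_nhds (by linarith))
      have hd' : HasDerivAt (fun z => dk k us0 (-z)) (-dk (k + 1) us0 (-y)) y := by
        simpa [Function.comp_def] using hd.comp y (hasDerivAt_neg y)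
      have e1 := h.shearExt_neg (k := k + 1) (by omega) (z := -y) (by linarith)
      rw [neg_neg] at e1
      rw [e1]
      by_cases he : Even k
      · rw [if_neg (by simpa [Nat.even_add_one] using he)]
        refine (hd'.neg.congr_of_eventuallyEq ?_).congr_deriv (neg_neg _)
        filter_upwards [Iio_mem_nhds hy] with z hz
        have := h.shearExt_neg (k := k) (by omega) (z := -z) (by simpa using (le_of_lt hz))
        rw [neg_neg, if_pos he] at this
        simpa using this
      · rw [if_pos (by simpa [Nat.even_add_one] using he)]
        refine hd'.congr_of_eventuallyEq ?_
        filter_upwards [Iio_mem_nhds hy] with z hz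
        have := h.shearExt_neg (k := k) (by omega) (z := -z) (by simpa using (le_of_lt hz))
        rwa [neg_neg, if_neg he] at this
    · rw [h.shearExt_of_nonneg (by omega) hy.le]
      refine ((h.hasDerivWithinAt_dk hk hy.le).hasDerivAt (Ici_mem_nhds hy)).congr_of_eventuallyEq ?_
      filter_upwards [Ioi_mem_nhds hy] with z hz
      exact h.shearExt_of_nonneg (by omega) (le_of_lt hz)
  · obtain ⟨M, hM⟩ := h.bdd_dk hk
    refine ⟨M + M, fun x => ?_⟩
    unfold shearExt
    split_ifs
    · exact (abs_sub _ _).trans (add_le_add (hM _ (le_max_right _ _)) (hM _ (le_max_right _ _)))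
    · have := hM |x| (abs_nonneg x)
      linarith [abs_nonneg (dk k us0 |x|)]

/-- The derivative `∂_y^k us` of the shear flow on `y > 0`. -/
def shearHeat (us0 : ℝ → ℝ) : ℕ → ℝ → ℝ → ℝ := heat (shearExt us0)

lemma IsShearData.shearHeat_zero_time (h : IsShearData us0 c) {k : ℕ} (hk : k ≤ 3) {y : ℝ}
    (hy : 0 ≤ y) : shearHeat us0 k 0 y = dk k us0 y := by
  simp [shearHeat, heat, hk, gaussMean, h.shearExt_of_nonneg hk hy]

/-- Reflection principle: the Dirichlet kernel on the half line is the kernel of the line applied to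
the odd extension. The substitution `w = √(2t) z` turns the latter into the Gaussian average. -/
lemma IsShearData.shearFlow_eq (h : IsShearData us0 c) {t y : ℝ} (ht : 0 ≤ t) (hy : 0 ≤ y) :
    shearFlow us0 t y = shearHeat us0 0 t y := by
  rcases ht.eq_or_lt with rfl | ht
  · rw [h.shearHeat_zero_time (by omega) hy]
    simp [shearFlow, dk]
  set s := √(2 * t) with hs
  have hs0 : 0 < s := by positivity
  have hs2 : s ^ 2 = 2 * t := Real.sq_sqrt (by positivity)
  set f := shearExt us0 0 with hf
  have hfc : Continuous f := h.isC3Tower.cont 0 (by omega)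
  obtain ⟨M, hM⟩ := h.isC3Tower.bdd 0 (by omega)
  set E : ℝ → ℝ := fun z => Real.exp (-z ^ 2 / (4 * t)) with hE
  have hEi : Integrable E := by
    have := integrable_exp_neg_mul_sq (b := 1 / (4 * t)) (by positivity)
    refine this.congr (ae_of_all _ fun z => ?_)
    simp only [hE]; congr 1; ring
  have hint : Integrable (fun z => E (y - z) * f z) :=
    (hEi.comp_sub_left y).mul_bdd (c := M) hfc.aestronglyMeasurable (ae_of_all _ hM)
  have key : shearHeat us0 0 t y = 1 / (2 * √(Real.pi * t)) * ∫ z, E (y - z) * f z := by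
    simp only [shearHeat, heat, Nat.zero_le, if_true, gaussMean, Pi.one_apply, mul_one, ← hs, ← hf]
    rw [ProbabilityTheory.integral_gaussianReal_eq_integral_smul one_ne_zero]
    have e : ∀ z, ProbabilityTheory.gaussianPDFReal 0 1 z • f (y + s * z) =
        (fun w => (√(2 * Real.pi))⁻¹ * (E (-w) * f (y + w))) (s * z) := by
      intro z
      simp only [ProbabilityTheory.gaussianPDFReal, hE, smul_eq_mul, NNReal.coe_one, mul_one,
        sub_zero]
      rw [mul_assoc]
      congr 3
      have : (-(s * z)) ^ 2 = 2 * t * z ^ 2 := by rw [← hs2]; ring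
      rw [this]
      field_simp
      ring
    rw [integral_congr_ae (ae_of_all _ e),
      Measure.integral_comp_mul_left (fun w => (√(2 * Real.pi))⁻¹ * (E (-w) * f (y + w))) s,
      integral_const_mul]
    have e2 : ∫ w, E (-w) * f (y + w) = ∫ z, E (y - z) * f z := by
      rw [← integral_add_left_eq_self (fun z => E (y - z) * f z) y]
      simp
    rw [e2, smul_eq_mul, ← mul_assoc]
    congr 1
    rw [abs_of_pos (by positivity), ← mul_inv, one_div, hs, ← Real.sqrt_mul (by positivity)]
    congr 1
    rw [show 2 * t * (2 * Real.pi) = 2 ^ 2 * (Real.pi * t) by ring, Real.sqrt_mul (by positivity),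
      Real.sqrt_sq (by norm_num)]
  rw [key, shearFlow, if_neg (not_le.2 ht)]
  congr 1
  rw [← intervalIntegral.integral_Iic_add_Ioi (b := 0) hint.integrableOn hint.integrableOn,
    ← neg_zero, ← integral_comp_neg_Ioi, neg_zero, ← integral_add]
  · refine setIntegral_congr_fun measurableSet_Ioi fun z hz => ?_
    have hz : 0 ≤ z := le_of_lt hz
    have e1 : f z = us0 z := by rw [hf, h.shearExt_of_nonneg (by omega) hz]; simp [dk]
    have e2 : f (-z) = -us0 z := by rw [hf, h.shearExt_neg (by omega) hz]; simp [dk]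
    simp only [e1, e2, hE, sub_neg_eq_add]
    ring
  · exact hint.comp_neg.integrableOn
  · exact hint.integrableOn

lemma IsShearData.hasDerivAt_shearHeat (h : IsShearData us0 c) {k : ℕ} (hk : k ≤ 2) (t y : ℝ) :
    HasDerivAt (shearHeat us0 k t) (shearHeat us0 (k + 1) t y) y :=
  h.isC3Tower.hasDerivAt_heat hk t y

lemma IsShearData.dy_shearFlow (h : IsShearData us0 c) {t y : ℝ} (ht : 0 ≤ t) (hy : 0 < y) :
    dy (shearFlow us0) t y = shearHeat us0 1 t y := by
  refine ((h.hasDerivAt_shearHeat (k := 0) (by omega) t y).congr_of_eventuallyEq ?_).deriv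
  filter_upwards [Ioi_mem_nhds hy] with z hz
  exact h.shearFlow_eq ht (le_of_lt hz)

lemma IsShearData.dy_dy_shearFlow (h : IsShearData us0 c) {t y : ℝ} (ht : 0 ≤ t) (hy : 0 < y) :
    dy (dy (shearFlow us0)) t y = shearHeat us0 2 t y := by
  refine ((h.hasDerivAt_shearHeat (k := 1) (by omega) t y).congr_of_eventuallyEq ?_).deriv
  filter_upwards [Ioi_mem_nhds hy] with z hz
  exact h.dy_shearFlow ht hz

lemma IsShearData.dt_dy_shearFlow (h : IsShearData us0 c) {t y : ℝ} (ht : 0 < t) (hy : 0 < y) :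
    dt (dy (shearFlow us0)) t y = shearHeat us0 3 t y := by
  refine ((h.isC3Tower.hasDerivAt_heat_time (k := 1) (by omega) ht y).congr_of_eventuallyEq
    ?_).deriv
  filter_upwards [Ioi_mem_nhds ht] with τ hτ
  exact h.dy_shearFlow (le_of_lt hτ) hy

lemma IsShearData.dt_dy_dy_shearFlow (h : IsShearData us0 c) {t y : ℝ} (ht : 0 < t) (hy : 0 < y) :
    dt (dy (dy (shearFlow us0))) t y = shearHeat us0 4 t y := by
  refine ((h.isC3Tower.hasDerivAt_heat_time (k := 2) (by omega) ht y).congr_of_eventuallyEq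
    ?_).deriv
  filter_upwards [Ioi_mem_nhds ht] with τ hτ
  exact h.dy_dy_shearFlow (le_of_lt hτ) hy

end

section

variable {us0 : ℝ → ℝ} {c : ℝ}

/-! ### Existence of admissible times -/

lemma IsShearData.continuous_shearHeat (h : IsShearData us0 c) {k : ℕ} (hk : k ≤ 3) :
    Continuous (fun p : ℝ × ℝ => shearHeat us0 k p.1 p.2) := h.isC3Tower.continuous_heat hk

lemma IsShearData.exists_uniform_time (h : IsShearData us0 c) {k : ℕ} (hk : k ≤ 3) {ε : ℝ}
    (hε : 0 < ε) : ∃ T, 0 < T ∧ ∀ t ∈ Icc 0 T, ∀ y ∈ Icc (0 : ℝ) 3,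
      |shearHeat us0 k t y - dk k us0 y| < ε := by
  have hK : IsCompact (Icc (0 : ℝ) 1 ×ˢ Icc (0 : ℝ) 3) := isCompact_Icc.prod isCompact_Icc
  have hu := hK.uniformContinuousOn_of_continuous (h.continuous_shearHeat hk).continuousOn
  obtain ⟨r, hr, hr'⟩ := Metric.uniformContinuousOn_iff.1 hu ε hε
  refine ⟨min 1 (r / 2), by positivity, fun t ht y hy => ?_⟩
  have h1 : t ≤ 1 := ht.2.trans (min_le_left _ _)
  have h2 : t ≤ r / 2 := ht.2.trans (min_le_right _ _)
  have := hr' (t, y) ⟨⟨ht.1, h1⟩, hy⟩ (0, y) ⟨⟨le_rfl, zero_le_one⟩, hy⟩ (by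
    simp only [Prod.dist_eq, dist_self, Real.dist_eq, sub_zero, abs_of_nonneg ht.1]
    exact max_lt (by linarith) hr)
  rwa [h.shearHeat_zero_time hk hy.1, Real.dist_eq] at this

lemma mul_sub_le_sub_of_le_deriv {f f' : ℝ → ℝ} {m α β x y : ℝ}
    (hf : ∀ z ∈ Icc α β, HasDerivAt f (f' z) z) (hm : ∀ z ∈ Icc α β, m ≤ f' z)
    (hx : x ∈ Icc α β) (hy : y ∈ Icc α β) (hxy : x ≤ y) : m * (y - x) ≤ f y - f x :=
  (convex_Icc α β).mul_sub_le_image_sub_of_le_deriv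
    (fun z hz => (hf z hz).continuousAt.continuousWithinAt)
    (fun z hz => (hf z (interior_subset hz)).differentiableAt.differentiableWithinAt)
    (fun z hz => by rw [(hf z (interior_subset hz)).deriv]; exact hm z (interior_subset hz))
    x hx y hy hxy

lemma integral_exp_add_mul_stdGauss (α β s : ℝ) :
    ∫ z, Real.exp (α + β * (s * z)) ∂stdGauss = Real.exp (α + β ^ 2 * (s ^ 2 / 2)) := by
  have := congrFun (ProbabilityTheory.mgf_fun_id_gaussianReal (μ := 0) (v := 1)) (β * s)
  simp only [ProbabilityTheory.mgf] at this
  simp_rw [Real.exp_add, integral_const_mul, ← mul_assoc, this]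
  congr 2
  push_cast; ring

lemma integrable_exp_add_mul_stdGauss (α β s : ℝ) :
    Integrable (fun z => Real.exp (α + β * (s * z))) stdGauss := by
  simp_rw [Real.exp_add, ← mul_assoc]
  exact (ProbabilityTheory.integrable_exp_mul_gaussianReal (β * s)).const_mul _

/-- Convexity integrated from the critical point `1` fixes the signs at `1 ± δ`. To the right of `1
+ δ` the lower bound on the absolute value excludes zeros, so the sign persists by the intermediate
value theorem. -/
lemma IsShearData.dk_one_pos (h : IsShearData us0 c) (hc : 0 < c) {δ : ℝ} (hδ : 0 < δ)
    (hδ1 : δ ≤ 1 / 4) (hm : MonotoneAway us0 c δ) :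
    dk 1 us0 (1 - δ) ≤ -(c * δ) ∧ c * δ ≤ dk 1 us0 (1 + δ) ∧
      ∀ y, 1 + δ ≤ y → c * δ * Real.exp (-y) ≤ dk 1 us0 y := by
  have hconv : ∀ x ∈ Icc (1 / 2 : ℝ) 2, ∀ y ∈ Icc (1 / 2 : ℝ) 2, x ≤ y →
      c * (y - x) ≤ dk 1 us0 y - dk 1 us0 x := fun x hx y hy hxy =>
    mul_sub_le_sub_of_le_deriv (fun z hz => (h.hasDerivWithinAt_dk (k := 1) (by omega)
      (by linarith [hz.1])).hasDerivAt (Ici_mem_nhds (by linarith [hz.1]))) h.convex hx hy hxy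
  have h1 : dk 1 us0 (1 - δ) ≤ -(c * δ) := by
    have := hconv (1 - δ) ⟨by linarith, by linarith⟩ 1 ⟨by norm_num, by norm_num⟩ (by linarith)
    rw [h.critical] at this
    linarith
  have h2 : c * δ ≤ dk 1 us0 (1 + δ) := by
    have := hconv 1 ⟨by norm_num, by norm_num⟩ (1 + δ) ⟨by linarith, by linarith⟩ (by linarith)
    rw [h.critical] at this
    linarith
  refine ⟨h1, h2, fun y hy => ?_⟩
  have hcd : 0 < c * δ := mul_pos hc hδ
  have hpos : 0 < dk 1 us0 y := by
    by_contra hneg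
    obtain ⟨z, hz, hz0⟩ := intermediate_value_Icc' hy
      ((h.continuousOn_dk (k := 1) (by omega)).mono
        (fun z hz => mem_Ici.2 (by linarith [hz.1]))) ⟨not_lt.1 hneg, hcd.le.trans h2⟩
    have := hm z (by linarith [hz.1]) (Or.inr hz.1)
    rw [hz0, abs_zero] at this
    exact absurd this (not_le.2 (by positivity))
  have := hm y (by linarith) (Or.inr hy)
  rwa [abs_of_pos hpos] at this

/-- The extended derivative lies above `cδ e^{-z} - M' e^{-A(z-2)}` on the whole line: the second
exponential dominates for `z < 2`. The heat flow preserves this order and multiplies `e^{βz}` by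
`e^{β² t}`. A large `A` makes the subtracted term negligible for `y ≥ 3`. -/
lemma IsShearData.exists_far_lower_bound (h : IsShearData us0 c) (hc : 0 < c) {δ : ℝ} (hδ : 0 < δ)
    (hδ1 : δ ≤ 1 / 4) (hm : MonotoneAway us0 c δ) :
    ∃ T, 0 < T ∧ ∀ t ∈ Icc 0 T, ∀ y, 3 ≤ y →
      c * δ / 2 * Real.exp (-y) ≤ shearHeat us0 1 t y := by
  obtain ⟨M, hM⟩ := h.isC3Tower.bdd 1 (by omega)
  have hcd : 0 < c * δ := mul_pos hc hδ
  have hM0 : 0 ≤ M := (abs_nonneg _).trans (hM 0)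
  set M' := M + c * δ with hM'
  have hM'0 : 0 < M' := by positivity
  set x := 4 * M' / (c * δ) with hx
  have hx0 : 0 < x := by positivity
  set A := 3 + x with hA
  have hA1 : 1 ≤ A := by linarith
  have hMA : M' * Real.exp (3 - A) ≤ c * δ / 4 := by
    have h1 : Real.exp (3 - A) ≤ 1 / x := by
      rw [show 3 - A = -x by rw [hA]; ring, Real.exp_neg, one_div]
      exact inv_anti₀ hx0 (by linarith [Real.add_one_le_exp x])
    calc M' * Real.exp (3 - A) ≤ M' * (1 / x) := by gcongr
      _ = c * δ / 4 := by rw [hx]; field_simp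
  have hlow : ∀ z, c * δ * Real.exp (-z) - M' * Real.exp (-A * (z - 2)) ≤ shearExt us0 1 z := by
    intro z
    rcases le_or_gt 2 z with hz | hz
    · rw [h.shearExt_of_nonneg (by omega) (by linarith)]
      have := (h.dk_one_pos hc hδ hδ1 hm).2.2 z (by linarith)
      have : 0 ≤ M' * Real.exp (-A * (z - 2)) := by positivity
      linarith
    · have h1 : 1 ≤ Real.exp (-A * (z - 2)) := Real.one_le_exp (by nlinarith)
      have h2 : Real.exp (-z) ≤ Real.exp (-A * (z - 2)) := Real.exp_le_exp.2 (by nlinarith)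
      have h3 := neg_le_of_abs_le (hM z)
      have h4 : M * 1 ≤ M * Real.exp (-A * (z - 2)) := by gcongr
      have h5 : c * δ * Real.exp (-z) ≤ c * δ * Real.exp (-A * (z - 2)) := by gcongr
      rw [hM', add_mul]
      linarith
  -- This time keeps the growth factor `e^{A² t}` below `e^{1/2} ≤ 2`.
  refine ⟨1 / (2 * A ^ 2), by positivity, fun t ht y hy => ?_⟩
  set s := √(2 * t) with hs
  have hs2 : s ^ 2 / 2 = t := by rw [hs, Real.sq_sqrt (by linarith [ht.1])]; ring
  have e1 : ∀ z, c * δ * Real.exp (-(y + s * z)) - M' * Real.exp (-A * ((y + s * z) - 2)) =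
      c * δ * Real.exp (-y + (-1) * (s * z)) - M' * Real.exp (-A * (y - 2) + (-A) * (s * z)) := by
    intro z; congr 3 <;> ring
  have hint : c * δ * Real.exp (-y + t) - M' * Real.exp (-A * (y - 2) + A ^ 2 * t) ≤
      shearHeat us0 1 t y := by
    have hi1 := (integrable_exp_add_mul_stdGauss (-y) (-1) s).const_mul (c * δ)
    have hi2 := (integrable_exp_add_mul_stdGauss (-A * (y - 2)) (-A) s).const_mul M'
    have : ∫ z, (c * δ * Real.exp (-y + (-1) * (s * z)) -
          M' * Real.exp (-A * (y - 2) + (-A) * (s * z))) ∂stdGauss ≤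
        ∫ z, shearExt us0 1 (y + s * z) * (1 : ℝ → ℝ) z ∂stdGauss := by
      refine integral_mono (hi1.sub hi2) (integrable_bdd_mul_stdGauss (integrable_const 1)
        (h.isC3Tower.cont 1 (by omega)) hM s y) fun z => ?_
      have := hlow (y + s * z)
      rw [e1] at this
      simpa using this
    rw [integral_sub hi1 hi2, integral_const_mul, integral_const_mul,
      integral_exp_add_mul_stdGauss, integral_exp_add_mul_stdGauss, hs2] at this
    simpa only [neg_sq, one_pow, one_mul, shearHeat, heat, gaussMean, show (1 : ℕ) ≤ 3 by norm_num, if_true, ← hs] using this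
  have hA2 : A ^ 2 * t ≤ 1 / 2 := by
    have := mul_le_mul_of_nonneg_left ht.2 (sq_nonneg A)
    rwa [show A ^ 2 * (1 / (2 * A ^ 2)) = 1 / 2 by field_simp] at this
  have h2 : Real.exp (1 / 2) ≤ 2 := by
    have h3 : Real.exp (1 / 2) ^ 2 = Real.exp 1 := by
      rw [← Real.exp_nat_mul]; norm_num
    have := Real.exp_one_lt_three
    nlinarith [Real.exp_pos (1 / 2)]
  have h4 : Real.exp (-A * (y - 2) + A ^ 2 * t) ≤
      Real.exp (-y) * Real.exp (3 - A) * 2 := by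
    calc _ ≤ Real.exp (-y + (3 - A) + 1 / 2) := Real.exp_le_exp.2 (by nlinarith)
      _ = Real.exp (-y) * Real.exp (3 - A) * Real.exp (1 / 2) := by
        rw [Real.exp_add, Real.exp_add]
      _ ≤ _ := by gcongr
  have h5 : M' * Real.exp (-A * (y - 2) + A ^ 2 * t) ≤ c * δ / 2 * Real.exp (-y) := by
    calc _ ≤ M' * (Real.exp (-y) * Real.exp (3 - A) * 2) := by gcongr
      _ = (M' * Real.exp (3 - A)) * (2 * Real.exp (-y)) := by ring
      _ ≤ c * δ / 4 * (2 * Real.exp (-y)) := by gcongr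
      _ = _ := by ring
  have h6 : c * δ * Real.exp (-y) ≤ c * δ * Real.exp (-y + t) := by
    gcongr; linarith [ht.1]
  linarith

theorem IsShearData.exists_admissible (h : IsShearData us0 c) (hc : 0 < c) {δ : ℝ} (hδ : 0 < δ)
    (hδ1 : δ ≤ 1 / 4) (hm : MonotoneAway us0 c δ) :
    ∃ T : ℝ, 0 < T ∧ ∃ a : ℝ → ℝ, Admissible (shearFlow us0) c δ T a := by
  have hcd : 0 < c * δ := mul_pos hc hδ
  obtain ⟨T₁, hT₁, h1⟩ := h.exists_far_lower_bound hc hδ hδ1 hm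
  obtain ⟨T₂, hT₂, h2⟩ := h.exists_uniform_time (k := 2) (by omega) (half_pos hc)
  -- This tolerance is at most half of `cδ e^{-y}` for `y ≤ 3`, and smaller than `cδ`, so that the
  -- signs at `1 ± δ` survive and produce a zero between them.
  obtain ⟨T₃, hT₃, h3⟩ := h.exists_uniform_time (k := 1) (by omega)
    (ε := c * δ / 2 * Real.exp (-3)) (by positivity)
  set T := min T₁ (min T₂ T₃)
  have hTle : ∀ t ∈ Icc 0 T, t ∈ Icc 0 T₁ ∧ t ∈ Icc 0 T₂ ∧ t ∈ Icc 0 T₃ := fun t ht =>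
    ⟨⟨ht.1, ht.2.trans (min_le_left _ _)⟩,
      ⟨ht.1, ht.2.trans ((min_le_right _ _).trans (min_le_left _ _))⟩,
      ⟨ht.1, ht.2.trans ((min_le_right _ _).trans (min_le_right _ _))⟩⟩
  have he3 : c * δ / 2 * Real.exp (-3) < c * δ := by
    have : Real.exp (-3) ≤ 1 := Real.exp_le_one_iff.2 (by norm_num)
    nlinarith
  have hcrit : ∀ t ∈ Icc 0 T, ∃ a, |a - 1| ≤ δ ∧ shearHeat us0 1 t a = 0 := by
    intro t ht
    have h3' := h3 t (hTle t ht).2.2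
    have hp := h.dk_one_pos hc hδ hδ1 hm
    have hl := abs_lt.1 (h3' (1 - δ) ⟨by linarith, by linarith⟩)
    have hr := abs_lt.1 (h3' (1 + δ) ⟨by linarith, by linarith⟩)
    obtain ⟨a, ha, ha0⟩ := intermediate_value_Icc (show 1 - δ ≤ 1 + δ by linarith)
      (f := shearHeat us0 1 t) (fun z _ =>
        (h.hasDerivAt_shearHeat (k := 1) (by omega) t z).continuousAt.continuousWithinAt)
      (show (0 : ℝ) ∈ Icc _ _ from ⟨by linarith [hp.1], by linarith [hp.2.1]⟩)
    exact ⟨a, abs_le.2 ⟨by linarith [ha.1], by linarith [ha.2]⟩, ha0⟩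
  choose! a ha using hcrit
  refine ⟨T, by positivity, a, fun t ht y hy => ?_, fun t ht y hy hy' => ?_, fun t ht => ?_,
    fun t ht => (ha t ht).1.trans (by linarith)⟩
  · rw [h.dy_dy_shearFlow ht.1 (by linarith [hy.1])]
    have := abs_lt.1 (h2 t (hTle t ht).2.1 y ⟨by linarith [hy.1], by linarith [hy.2]⟩)
    linarith [h.convex y hy]
  · rw [h.dy_shearFlow ht.1 hy]
    rcases le_or_gt 3 y with h3y | h3y
    · exact (h1 t (hTle t ht).1 y h3y).trans (le_abs_self _)
    · have e1 := h3 t (hTle t ht).2.2 y ⟨hy.le, h3y.le⟩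
      have e2 := hm y hy.le hy'
      have e3 := abs_sub_abs_le_abs_sub (dk 1 us0 y) (shearHeat us0 1 t y)
      rw [abs_sub_comm] at e3
      have e4 : c * δ / 2 * Real.exp (-3) ≤ c * δ / 2 * Real.exp (-y) := by gcongr
      linarith
  · have := abs_le.1 (ha t ht).1
    rw [h.dy_shearFlow ht.1 (by linarith)]
    exact (ha t ht).2

end

section

variable {us0 : ℝ → ℝ} {c : ℝ}

/-! ### The critical point -/

lemma hasStrictFDerivAt_of_partials {E : Type*} [NormedAddCommGroup E] [NormedSpace ℝ E]
    {f f₁ f₂ : ℝ → ℝ → E} {t y : ℝ}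
    (d₁ : ∀ᶠ p : ℝ × ℝ in 𝓝 (t, y), HasDerivAt (fun τ => f τ p.2) (f₁ p.1 p.2) p.1)
    (d₂ : ∀ᶠ p : ℝ × ℝ in 𝓝 (t, y), HasDerivAt (f p.1) (f₂ p.1 p.2) p.2)
    (c₁ : ContinuousAt (fun p : ℝ × ℝ => f₁ p.1 p.2) (t, y))
    (c₂ : ContinuousAt (fun p : ℝ × ℝ => f₂ p.1 p.2) (t, y)) :
    HasStrictFDerivAt (fun p : ℝ × ℝ => f p.1 p.2)
      ((ContinuousLinearMap.toSpanSingleton ℝ (f₁ t y)).coprod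
        (ContinuousLinearMap.toSpanSingleton ℝ (f₂ t y))) (t, y) :=
  hasStrictFDerivAt_uncurry_coprod (f := f) (u := (t, y))
    (f₁ := fun t y => ContinuousLinearMap.toSpanSingleton ℝ (f₁ t y))
    (f₂ := fun t y => ContinuousLinearMap.toSpanSingleton ℝ (f₂ t y))
    (d₁.mono fun _ hp => hp.hasFDerivAt) (d₂.mono fun _ hp => hp.hasFDerivAt)
    ((ContinuousLinearMap.toSpanSingletonLIE ℝ E).continuous.continuousAt.comp c₁)
    ((ContinuousLinearMap.toSpanSingletonLIE ℝ E).continuous.continuousAt.comp c₂)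

lemma IsShearData.hasStrictFDerivAt_shearHeat_one (h : IsShearData us0 c) {t : ℝ} (ht : 0 < t)
    (y : ℝ) : HasStrictFDerivAt (fun p : ℝ × ℝ => shearHeat us0 1 p.1 p.2)
      ((ContinuousLinearMap.toSpanSingleton ℝ (shearHeat us0 3 t y)).coprod
        (ContinuousLinearMap.toSpanSingleton ℝ (shearHeat us0 2 t y))) (t, y) := by
  refine hasStrictFDerivAt_of_partials ?_ (Eventually.of_forall fun p =>
      h.hasDerivAt_shearHeat (k := 1) (by omega) p.1 p.2)
    (h.continuous_shearHeat le_rfl).continuousAt (h.continuous_shearHeat (by omega)).continuousAt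
  filter_upwards [continuous_fst.continuousAt.preimage_mem_nhds (Ioi_mem_nhds ht)] with p hp
  exact h.isC3Tower.hasDerivAt_heat_time (k := 1) (by omega) hp p.2

section Critical

variable {δ T : ℝ} {a : ℝ → ℝ}

/-- Admissibility only places `a t` within `2δ` of `1`, but `∂_y us` has no zero outside `(1-δ,
1+δ)`. The gain leaves a distance `δ` between `a t` and the end points `1 ± 2δ`. -/
lemma Admissible.abs_sub_one_lt (hc : 0 < c) (hδ : 0 < δ) (hδ1 : δ ≤ 1 / 8)
    {us : ℝ → ℝ → ℝ} (ha : Admissible us c δ T a) {t : ℝ} (ht : t ∈ Icc 0 T) :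
    |a t - 1| < δ := by
  by_contra hcon
  have h1 := abs_le.1 (ha.near_one t ht)
  have h2 := ha.monotone t ht (a t) (by linarith) (by
    by_contra hn
    push Not at hn
    exact hcon (abs_lt.2 ⟨by linarith, by linarith⟩))
  rw [ha.critical t ht, abs_zero] at h2
  exact absurd h2 (not_le.2 (by positivity))

lemma IsShearData.le_shearHeat_two (h : IsShearData us0 c)
    (ha : Admissible (shearFlow us0) c δ T a) {t : ℝ} (ht : t ∈ Icc 0 T) {y : ℝ}
    (hy : y ∈ Icc (1 / 2 : ℝ) 2) : c / 2 ≤ shearHeat us0 2 t y := by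
  have := ha.convex t ht y hy
  rwa [h.dy_dy_shearFlow ht.1 (by linarith [hy.1])] at this

lemma IsShearData.mul_abs_sub_le (h : IsShearData us0 c)
    (ha : Admissible (shearFlow us0) c δ T a) {t : ℝ} (ht : t ∈ Icc 0 T) {x y : ℝ}
    (hx : x ∈ Icc (1 / 2 : ℝ) 2) (hy : y ∈ Icc (1 / 2 : ℝ) 2) :
    c / 2 * |y - x| ≤ |shearHeat us0 1 t y - shearHeat us0 1 t x| := by
  have key := fun (x y : ℝ) (hx : x ∈ Icc (1 / 2 : ℝ) 2) (hy : y ∈ Icc (1 / 2 : ℝ) 2) hxy =>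
    mul_sub_le_sub_of_le_deriv (fun z _ => h.hasDerivAt_shearHeat (k := 1) (by omega) t z)
      (fun z hz => h.le_shearHeat_two ha ht hz) hx hy hxy
  rcases le_total x y with hxy | hxy
  · rw [abs_of_nonneg (sub_nonneg.2 hxy)]
    exact (key x y hx hy hxy).trans (le_abs_self _)
  · rw [abs_sub_comm, abs_of_nonneg (sub_nonneg.2 hxy), abs_sub_comm]
    exact (key y x hy hx hxy).trans (le_abs_self _)

lemma IsShearData.critical_mem (hc : 0 < c) (hδ : 0 < δ) (hδ1 : δ ≤ 1 / 8)
    (ha : Admissible (shearFlow us0) c δ T a) {t : ℝ} (ht : t ∈ Icc 0 T) :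
    a t ∈ Icc (1 / 2 : ℝ) 2 := by
  have := abs_lt.1 (ha.abs_sub_one_lt hc hδ hδ1 ht)
  exact ⟨by linarith, by linarith⟩

lemma IsShearData.shearHeat_one_critical (h : IsShearData us0 c) (hc : 0 < c) (hδ : 0 < δ)
    (hδ1 : δ ≤ 1 / 8) (ha : Admissible (shearFlow us0) c δ T a) {t : ℝ} (ht : t ∈ Icc 0 T) :
    shearHeat us0 1 t (a t) = 0 := by
  rw [← h.dy_shearFlow ht.1 (by linarith [(critical_mem hc hδ hδ1 ha ht).1])]
  exact ha.critical t ht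

/-- Uniform convexity at time `t`, between `a t` and `a t₀`, compares the displacement with the
value of `∂_y us t` at the old critical point. -/
lemma IsShearData.abs_critical_sub_le (h : IsShearData us0 c) (hc : 0 < c) (hδ : 0 < δ)
    (hδ1 : δ ≤ 1 / 8) (ha : Admissible (shearFlow us0) c δ T a) {t t₀ : ℝ} (ht : t ∈ Icc 0 T)
    (ht₀ : t₀ ∈ Icc 0 T) :
    |a t - a t₀| ≤ 2 / c * |shearHeat us0 1 t (a t₀) - shearHeat us0 1 t₀ (a t₀)| := by
  have h1 := h.mul_abs_sub_le ha ht (critical_mem hc hδ hδ1 ha ht)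
    (critical_mem hc hδ hδ1 ha ht₀)
  rw [h.shearHeat_one_critical hc hδ hδ1 ha ht, sub_zero] at h1
  rw [h.shearHeat_one_critical hc hδ hδ1 ha ht₀, sub_zero, abs_sub_comm, div_mul_eq_mul_div,
    le_div_iff₀ hc]
  linarith

lemma IsShearData.continuousOn_critical (h : IsShearData us0 c) (hc : 0 < c) (hδ : 0 < δ)
    (hδ1 : δ ≤ 1 / 8) (ha : Admissible (shearFlow us0) c δ T a) :
    ContinuousOn a (Icc 0 T) := by
  intro t₀ ht₀
  have hcont : Continuous fun t => shearHeat us0 1 t (a t₀) :=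
    (h.continuous_shearHeat (k := 1) (by omega)).comp (f := fun t : ℝ => (t, a t₀)) (by fun_prop)
  have hlim : Tendsto (fun t => 2 / c *
      |shearHeat us0 1 t (a t₀) - shearHeat us0 1 t₀ (a t₀)|) (𝓝[Icc 0 T] t₀) (𝓝 0) := by
    have : Continuous fun t => 2 / c *
      |shearHeat us0 1 t (a t₀) - shearHeat us0 1 t₀ (a t₀)| := by fun_prop
    have := (this.tendsto t₀).mono_left (nhdsWithin_le_nhds (s := Icc 0 T))
    simpa using this
  refine tendsto_iff_dist_tendsto_zero.2 (squeeze_zero' (Eventually.of_forall fun _ => dist_nonneg)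
    ?_ hlim)
  filter_upwards [self_mem_nhdsWithin] with t ht
  rw [Real.dist_eq]
  exact h.abs_critical_sub_le hc hδ hδ1 ha ht ht₀

/-- The speed of the critical point. -/
def criticalSpeed (us0 a : ℝ → ℝ) (t : ℝ) : ℝ :=
  -shearHeat us0 3 t (a t) / shearHeat us0 2 t (a t)

lemma IsShearData.continuousOn_criticalSpeed (h : IsShearData us0 c) (hc : 0 < c) (hδ : 0 < δ)
    (hδ1 : δ ≤ 1 / 8) (ha : Admissible (shearFlow us0) c δ T a) :
    ContinuousOn (criticalSpeed us0 a) (Icc 0 T) := by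
  have hca := h.continuousOn_critical hc hδ hδ1 ha
  have hk : ∀ k, k ≤ 3 → ContinuousOn (fun t => shearHeat us0 k t (a t)) (Icc 0 T) := fun k hk =>
    (h.continuous_shearHeat hk).comp_continuousOn (continuousOn_id.prodMk hca)
  refine (hk 3 le_rfl).neg.div (hk 2 (by omega)) fun t ht => ?_
  have := h.le_shearHeat_two ha ht (critical_mem hc hδ hδ1 ha ht)
  linarith

/-- Implicit differentiation along the given curve. Both values of `∂_y us` vanish, so its
linearisation at `(t, a t)` is a little-o of the full increment, hence of `τ - t` by the
Lipschitz-type bound; dividing by `S 2 ≠ 0` gives the speed. -/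
lemma IsShearData.hasDerivAt_critical (h : IsShearData us0 c) (hc : 0 < c) (hδ : 0 < δ)
    (hδ1 : δ ≤ 1 / 8) (ha : Admissible (shearFlow us0) c δ T a) {t : ℝ} (ht : t ∈ Ioo 0 T) :
    HasDerivAt a (criticalSpeed us0 a t) t := by
  have htI : t ∈ Icc 0 T := Ioo_subset_Icc_self ht
  have hcrit := h.shearHeat_one_critical hc hδ hδ1 ha htI
  have hS2 : shearHeat us0 2 t (a t) ≠ 0 := by
    have := h.le_shearHeat_two ha htI (critical_mem hc hδ hδ1 ha htI)
    linarith
  have hcont : ContinuousAt a t :=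
    (h.continuousOn_critical hc hδ hδ1 ha).continuousAt (Icc_mem_nhds ht.1 ht.2)
  have hbig : (fun τ => a τ - a t) =O[𝓝 t] fun τ => τ - t := by
    refine Asymptotics.IsBigO.trans ?_ ((h.isC3Tower.hasDerivAt_heat_time (k := 1) (by omega)
      ht.1 (a t)).differentiableAt.isBigO_sub)
    refine Asymptotics.IsBigO.of_bound (2 / c) ?_
    filter_upwards [Icc_mem_nhds ht.1 ht.2] with τ hτ
    exact h.abs_critical_sub_le hc hδ hδ1 ha hτ htI
  have hlin := (h.hasStrictFDerivAt_shearHeat_one ht.1 (a t)).hasFDerivAt.isLittleO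
  have hcomp := hlin.comp_tendsto (k := fun τ => (τ, a τ)) (l' := 𝓝 t)
    (by rw [nhds_prod_eq]; exact tendsto_id.prodMk hcont)
  have hbig2 : (fun τ => ((τ, a τ) : ℝ × ℝ) - (t, a t)) =O[𝓝 t] fun τ => τ - t :=
    (Asymptotics.isBigO_refl _ _).prod_left hbig
  have hlit := (hcomp.trans_isBigO hbig2).const_mul_left (-(shearHeat us0 2 t (a t))⁻¹)
  rw [hasDerivAt_iff_isLittleO]
  refine hlit.congr' ?_ EventuallyEq.rfl
  filter_upwards [Icc_mem_nhds ht.1 ht.2] with τ hτ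
  simp only [Function.comp_apply, h.shearHeat_one_critical hc hδ hδ1 ha hτ, hcrit,
    ContinuousLinearMap.coprod_apply, ContinuousLinearMap.toSpanSingleton_apply, smul_eq_mul,
    criticalSpeed, Prod.mk_sub_mk]
  field_simp
  ring

end Critical

end

section

/-! ### Multiplication operators on `L²` -/

/-- Bounded continuous symbols. -/
def IsSymbol (m : ℝ → ℝ) : Prop := Continuous m ∧ ∃ C, ∀ ξ, |m ξ| ≤ C

lemma IsSymbol.mul {m n : ℝ → ℝ} (hm : IsSymbol m) (hn : IsSymbol n) :
    IsSymbol (fun ξ => m ξ * n ξ) := by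
  obtain ⟨C, hC⟩ := hm.2
  obtain ⟨D, hD⟩ := hn.2
  refine ⟨hm.1.mul hn.1, C * D, fun ξ => ?_⟩
  rw [abs_mul]
  exact mul_le_mul (hC ξ) (hD ξ) (abs_nonneg _) ((abs_nonneg _).trans (hC ξ))

lemma IsSymbol.memLp {m : ℝ → ℝ} (hm : IsSymbol m) (f : L2x) :
    MemLp (fun ξ => (m ξ : ℂ) * f ξ) 2 volume := by
  obtain ⟨C, hC⟩ := hm.2
  refine (Lp.memLp f).of_le_mul (c := C)
    ((Complex.continuous_ofReal.comp hm.1).aestronglyMeasurable.mul (Lp.aestronglyMeasurable f))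
    (ae_of_all _ fun ξ => ?_)
  rw [norm_mul, Complex.norm_real]
  exact mul_le_mul_of_nonneg_right (hC ξ) (norm_nonneg _)

open Classical in
/-- Multiplication by the symbol `m` on `L²` (and `0` unless `m` is bounded and continuous). -/
def mulFun (m : ℝ → ℝ) (f : L2x) : L2x :=
  if hm : IsSymbol m then (hm.memLp f).toLp _ else 0

lemma coeFn_mulFun {m : ℝ → ℝ} (hm : IsSymbol m) (f : L2x) :
    mulFun m f =ᵐ[volume] fun ξ => (m ξ : ℂ) * f ξ := by
  rw [mulFun, dif_pos hm]
  exact MemLp.coeFn_toLp _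

lemma norm_mulFun_le {m : ℝ → ℝ} {C : ℝ} (hC : 0 ≤ C) (hmC : ∀ ξ, |m ξ| ≤ C) (f : L2x) :
    ‖mulFun m f‖ ≤ C * ‖f‖ := by
  by_cases hm : IsSymbol m
  · refine Lp.norm_le_mul_norm_of_ae_le_mul ?_
    filter_upwards [coeFn_mulFun hm f] with ξ hξ
    rw [hξ, norm_mul, Complex.norm_real]
    exact mul_le_mul_of_nonneg_right (hmC ξ) (norm_nonneg _)
  · rw [mulFun, dif_neg hm, norm_zero]
    positivity

/-- Multiplication by a symbol as a continuous linear operator on `L²`. -/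
def mulOp (m : ℝ → ℝ) : L2x →L[ℝ] L2x := by
  classical
  exact if hm : IsSymbol m then
    LinearMap.mkContinuous
      { toFun := mulFun m
        map_add' := fun f g => by
          refine Lp.ext ?_
          filter_upwards [coeFn_mulFun hm (f + g), coeFn_mulFun hm f, coeFn_mulFun hm g,
            Lp.coeFn_add f g, Lp.coeFn_add (mulFun m f) (mulFun m g)] with ξ h1 h2 h3 h4 h5
          rw [h1, h5, h4]
          simp only [Pi.add_apply, h2, h3]
          ring
        map_smul' := fun r f => by
          refine Lp.ext ?_
          filter_upwards [coeFn_mulFun hm (r • f), coeFn_mulFun hm f,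
            Lp.coeFn_smul r f, Lp.coeFn_smul r (mulFun m f)] with ξ h1 h2 h3 h4
          simp only [RingHom.id_apply]
          rw [h1, h4, h3]
          simp only [Pi.smul_apply, h2, Complex.real_smul]
          ring }
      (Classical.choose hm.2) (fun f => norm_mulFun_le
        ((abs_nonneg _).trans (Classical.choose_spec hm.2 0)) (Classical.choose_spec hm.2) f)
  else 0

lemma mulOp_apply {m : ℝ → ℝ} (f : L2x) : mulOp m f = mulFun m f := by
  by_cases hm : IsSymbol m
  · rw [mulOp, dif_pos hm]; rfl
  · rw [mulOp, dif_neg hm, mulFun, dif_neg hm]; rfl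

lemma coeFn_mulOp {m : ℝ → ℝ} (hm : IsSymbol m) (f : L2x) :
    mulOp m f =ᵐ[volume] fun ξ => (m ξ : ℂ) * f ξ := by
  rw [mulOp_apply]; exact coeFn_mulFun hm f

lemma norm_mulOp_le {m : ℝ → ℝ} {C : ℝ} (hC : 0 ≤ C) (hmC : ∀ ξ, |m ξ| ≤ C) : ‖mulOp m‖ ≤ C :=
  ContinuousLinearMap.opNorm_le_bound _ hC fun f => by
    rw [mulOp_apply]; exact norm_mulFun_le hC hmC f

lemma mulOp_mulOp {m n : ℝ → ℝ} (hm : IsSymbol m) (hn : IsSymbol n) (f : L2x) :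
    mulOp m (mulOp n f) = mulOp (fun ξ => m ξ * n ξ) f := by
  refine Lp.ext ?_
  filter_upwards [coeFn_mulOp hm (mulOp n f), coeFn_mulOp hn f, coeFn_mulOp (hm.mul hn) f]
    with ξ h1 h2 h3
  rw [h1, h2, h3]
  push_cast; ring

lemma inner_mulOp_left {m : ℝ → ℝ} (f g : L2x) :
    inner ℝ (mulOp m f) g = inner ℝ f (mulOp m g) := by
  by_cases hm : IsSymbol m
  · rw [L2.inner_def, L2.inner_def]
    refine integral_congr_ae ?_
    filter_upwards [coeFn_mulOp hm f, coeFn_mulOp hm g] with ξ h1 h2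
    rw [h1, h2]
    simp only [Complex.inner, map_mul, Complex.conj_ofReal]
    congr 1; ring
  · simp [mulOp, dif_neg hm]

/-- A real symbol times `i` is skew-adjoint for the real inner product. This removes the transport
term from the energy identity. -/
lemma inner_I_smul_mulOp {m : ℝ → ℝ} (f : L2x) :
    inner ℝ f (Complex.I • mulOp m f) = 0 := by
  by_cases hm : IsSymbol m
  · rw [L2.inner_def]
    refine integral_eq_zero_of_ae ?_
    filter_upwards [coeFn_mulOp hm f, Lp.coeFn_smul Complex.I (mulOp m f)] with ξ h1 h2
    rw [h2, Pi.smul_apply, h1]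
    simp only [Complex.inner, smul_eq_mul, Pi.zero_apply]
    have : Complex.I * (↑(m ξ) * f ξ) * (starRingEnd ℂ) (f ξ) =
        Complex.I * ((m ξ * Complex.normSq (f ξ) : ℝ) : ℂ) := by
      rw [Complex.ofReal_mul, Complex.normSq_eq_conj_mul_self]; ring
    rw [this, Complex.I_mul_re, Complex.ofReal_im, neg_zero]
  · simp [mulOp, dif_neg hm]

lemma mulOp_I_smul {m : ℝ → ℝ} (f : L2x) :
    mulOp m (Complex.I • f) = Complex.I • mulOp m f := by
  by_cases hm : IsSymbol m
  · refine Lp.ext ?_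
    filter_upwards [coeFn_mulOp hm (Complex.I • f), coeFn_mulOp hm f, Lp.coeFn_smul Complex.I f,
      Lp.coeFn_smul Complex.I (mulOp m f)] with ξ h1 h2 h3 h4
    rw [h1, h3, h4]
    simp only [Pi.smul_apply, h2, smul_eq_mul]
    ring
  · simp [mulOp, dif_neg hm]

lemma mulOp_injective {m : ℝ → ℝ} (hm : IsSymbol m) (h0 : ∀ ξ, m ξ ≠ 0) :
    Function.Injective (mulOp m) := by
  intro f g hfg
  refine Lp.ext ?_
  have h := coeFn_mulOp hm g
  rw [← hfg] at h
  filter_upwards [coeFn_mulOp hm f, h] with ξ h1 h2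
  rw [h1] at h2
  exact mul_left_cancel₀ (by exact_mod_cast h0 ξ) h2

/-! ### The Japanese bracket -/

lemma one_le_jap (ξ : ℝ) : 1 ≤ jap ξ := by
  rw [jap, Real.one_le_sqrt]
  nlinarith [sq_nonneg (2 * Real.pi * ξ)]

lemma jap_pos (ξ : ℝ) : 0 < jap ξ := zero_lt_one.trans_le (one_le_jap ξ)

lemma continuous_jap : Continuous jap := by unfold jap; fun_prop

lemma continuous_jap_rpow (r : ℝ) : Continuous (fun ξ => jap ξ ^ r) :=
  continuous_jap.rpow_const fun ξ => Or.inl (jap_pos ξ).ne'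

lemma abs_le_jap (ξ : ℝ) : |2 * Real.pi * ξ| ≤ jap ξ := by
  rw [jap]
  exact Real.abs_le_sqrt (by linarith)

lemma jap_rpow_neg_le_one {r : ℝ} (hr : 0 ≤ r) (ξ : ℝ) : jap ξ ^ (-r) ≤ 1 :=
  Real.rpow_le_one_of_one_le_of_nonpos (one_le_jap ξ) (by linarith)

lemma isSymbol_jap {r : ℝ} (hr : 0 ≤ r) : IsSymbol (fun ξ => jap ξ ^ (-r)) :=
  ⟨continuous_jap_rpow _, 1, fun ξ => by
    rw [abs_of_pos (Real.rpow_pos_of_pos (jap_pos ξ) _)]; exact jap_rpow_neg_le_one hr ξ⟩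

/-- The operator `⟨D⟩^{-r}` on the Fourier side. -/
def japOp (r : ℝ) : L2x →L[ℝ] L2x := mulOp (fun ξ => jap ξ ^ (-r))

lemma japOp_japOp {r s : ℝ} (hr : 0 ≤ r) (hs : 0 ≤ s) (f : L2x) :
    japOp r (japOp s f) = japOp (r + s) f := by
  rw [japOp, japOp, mulOp_mulOp (isSymbol_jap hr) (isSymbol_jap hs), japOp]
  congr 2
  funext ξ
  rw [← Real.rpow_add (jap_pos ξ)]
  congr 1; ring

lemma norm_japOp_le {r : ℝ} (hr : 0 ≤ r) : ‖japOp r‖ ≤ 1 :=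
  norm_mulOp_le zero_le_one fun ξ => by
    rw [abs_of_pos (Real.rpow_pos_of_pos (jap_pos ξ) _)]; exact jap_rpow_neg_le_one hr ξ

lemma norm_japOp_anti {r s : ℝ} (hr : 0 ≤ r) (hrs : r ≤ s) (f : L2x) :
    ‖japOp s f‖ ≤ ‖japOp r f‖ := by
  rw [show s = (s - r) + r by ring, ← japOp_japOp (by linarith) hr]
  exact ((japOp (s - r)).le_of_opNorm_le (norm_japOp_le (by linarith)) _).trans_eq (one_mul _)

/-- The operators are self-adjoint and multiply by adding exponents, so only the sum of the two
orders matters. Every redistribution of derivatives between the factors of a product rests on this.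
-/
lemma inner_japOp {a b a' b' : ℝ} (ha : 0 ≤ a) (hb : 0 ≤ b) (ha' : 0 ≤ a') (hb' : 0 ≤ b')
    (h : a + b = a' + b') (f g : L2x) :
    inner ℝ (japOp a f) (japOp b g) = inner ℝ (japOp a' f) (japOp b' g) := by
  have key : ∀ r s, 0 ≤ r → 0 ≤ s → inner ℝ (japOp r f) (japOp s g) = inner ℝ f (japOp (r + s) g) :=
    fun r s hr hs => by
      rw [← japOp_japOp hr hs]; exact inner_mulOp_left f _
  rw [key a b ha hb, key a' b' ha' hb', h]

lemma abs_inner_japOp_le {a b a' b' : ℝ} (ha : 0 ≤ a) (hb : 0 ≤ b) (ha' : 0 ≤ a') (hb' : 0 ≤ b')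
    (h : a + b = a' + b') (f g : L2x) :
    |inner ℝ (japOp a f) (japOp b g)| ≤ ‖japOp a' f‖ * ‖japOp b' g‖ := by
  rw [inner_japOp ha hb ha' hb' h]
  exact abs_real_inner_le_norm _ _

lemma isSymbol_transport : IsSymbol (fun ξ => 2 * Real.pi * ξ * jap ξ ^ (-(3 / 2 : ℝ))) := by
  refine ⟨(by fun_prop : Continuous fun ξ : ℝ => 2 * Real.pi * ξ).mul (continuous_jap_rpow _), 1,
    fun ξ => ?_⟩
  rw [abs_mul, abs_of_pos (Real.rpow_pos_of_pos (jap_pos ξ) _)]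
  calc _ ≤ jap ξ ^ (1 : ℝ) * jap ξ ^ (-(3 / 2 : ℝ)) := by
        rw [Real.rpow_one]
        exact mul_le_mul_of_nonneg_right (abs_le_jap ξ) (Real.rpow_pos_of_pos (jap_pos ξ) _).le
    _ = jap ξ ^ (-(1 / 2 : ℝ)) := by rw [← Real.rpow_add (jap_pos ξ)]; norm_num
    _ ≤ 1 := jap_rpow_neg_le_one (by norm_num) ξ

/-- The operator `⟨D⟩^{-3/2} ∂_x` on the Fourier side. -/
def transportOp (f : L2x) : L2x :=
  Complex.I • mulOp (fun ξ => 2 * Real.pi * ξ * jap ξ ^ (-(3 / 2 : ℝ))) f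

lemma continuous_transportOp : Continuous transportOp :=
  (mulOp fun ξ => 2 * Real.pi * ξ * jap ξ ^ (-(3 / 2 : ℝ))).continuous.const_smul Complex.I

lemma inner_japOp_transportOp (f : L2x) : inner ℝ (japOp (3 / 2) f) (transportOp f) = 0 := by
  rw [japOp, inner_mulOp_left, transportOp, mulOp_I_smul,
    mulOp_mulOp (isSymbol_jap (by norm_num)) isSymbol_transport]
  exact inner_I_smul_mulOp f

/-! ### Lifting derivatives through an injective operator -/

/-- The fundamental theorem of calculus holds after applying `R`. Since `g` is continuous, its
integral exists in `E` and commutes with `R`, so injectivity removes `R` from the integrated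
identity, which is then differentiated. -/
lemma hasDerivAt_of_injective {E F : Type*} [NormedAddCommGroup E] [NormedSpace ℝ E]
    [CompleteSpace E] [NormedAddCommGroup F] [NormedSpace ℝ F] [CompleteSpace F]
    (R : E →L[ℝ] F) (hR : Function.Injective R) {α β : ℝ} {f g : ℝ → E}
    (hg : ContinuousOn g (Ioo α β))
    (hd : ∀ x ∈ Ioo α β, HasDerivAt (fun z => R (f z)) (R (g x)) x) {x : ℝ} (hx : x ∈ Ioo α β) :
    HasDerivAt f (g x) x := by
  have hsub : ∀ y ∈ Ioo α β, uIcc x y ⊆ Ioo α β := fun y hy =>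
    (convex_Ioo α β).ordConnected.uIcc_subset hx hy
  have hint : ∀ y ∈ Ioo α β, IntervalIntegrable g volume x y := fun y hy =>
    (hg.mono (hsub y hy)).intervalIntegrable
  have heq : ∀ y ∈ Ioo α β, f y = f x + ∫ z in x..y, g z := by
    intro y hy
    refine hR ?_
    have h1 := intervalIntegral.integral_eq_sub_of_hasDerivAt (fun z hz => hd z (hsub y hy hz))
      (((R.continuous.comp_continuousOn hg).mono (hsub y hy)).intervalIntegrable)
    rw [map_add, ← ContinuousLinearMap.intervalIntegral_comp_comm R (hint y hy), h1]
    abel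
  have h2 : HasDerivAt (fun y => f x + ∫ z in x..y, g z) (g x) x :=
    (intervalIntegral.integral_hasDerivAt_right (IntervalIntegrable.refl)
      (hg.stronglyMeasurableAtFilter isOpen_Ioo x hx)
      (hg.continuousAt (isOpen_Ioo.mem_nhds hx))).const_add _
  refine h2.congr_of_eventuallyEq ?_
  filter_upwards [isOpen_Ioo.mem_nhds hx] with y hy
  exact heq y hy

end

section

/-! ### Gevrey lifts -/

lemma mulOp_add {m n : ℝ → ℝ} (hm : IsSymbol m) (hn : IsSymbol n)
    (hmn : IsSymbol fun ξ => m ξ + n ξ) : mulOp (fun ξ => m ξ + n ξ) = mulOp m + mulOp n := by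
  ext1 f
  refine Lp.ext ?_
  filter_upwards [coeFn_mulOp hm f, coeFn_mulOp hn f, coeFn_mulOp hmn f,
    Lp.coeFn_add (mulOp m f) (mulOp n f)] with ξ h1 h2 h3 h4
  rw [h3, add_apply, h4, Pi.add_apply, h1, h2]
  push_cast; ring

lemma mulOp_const_mul {m : ℝ → ℝ} (r : ℝ) (hm : IsSymbol m)
    (hrm : IsSymbol fun ξ => r * m ξ) : mulOp (fun ξ => r * m ξ) = r • mulOp m := by
  ext1 f
  refine Lp.ext ?_
  filter_upwards [coeFn_mulOp hm f, coeFn_mulOp hrm f, Lp.coeFn_smul r (mulOp m f)]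
    with ξ h1 h2 h3
  rw [h2, smul_apply, h3, Pi.smul_apply, h1, Complex.real_smul]
  push_cast; ring

/-- The Fourier transform on `L²` as a real-linear operator. -/
def fourierOp : L2x →L[ℝ] L2x :=
  ((Lp.fourierTransformₗᵢ ℝ ℂ).toContinuousLinearEquiv : L2x →L[ℂ] L2x).restrictScalars ℝ

lemma fourierOp_apply (f : L2x) : fourierOp f = 𝓕 f := rfl

/-- `F` is the Fourier transform of `⟨D_x⟩² f_Φ` at time `t`. -/
def IsLift (θ lam t : ℝ) (f F : L2x) : Prop := (F : ℝ → ℂ) =ᵐ[volume] gevHat θ lam 2 t f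

variable {θ lam t : ℝ} {f g F G : L2x}

lemma isLift_fourier_gev (h : InGev θ lam 2 t f) : IsLift θ lam t f (𝓕 (gev θ lam 2 t f)) := by
  rw [gev, dif_pos h, FourierInvPair.fourier_fourierInv_eq]
  exact MemLp.coeFn_toLp h

lemma IsLift.add (hf : IsLift θ lam t f F) (hg : IsLift θ lam t g G) :
    IsLift θ lam t (f + g) (F + G) := by
  have h1 : (𝓕 (f + g) : L2x) = 𝓕 f + 𝓕 g := map_add fourierOp f g
  unfold IsLift gevHat at *
  rw [h1]
  filter_upwards [hf, hg, Lp.coeFn_add F G, Lp.coeFn_add (𝓕 f) (𝓕 g)] with ξ h1 h2 h3 h4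
  rw [h3, h4, Pi.add_apply, Pi.add_apply, h1, h2]
  ring

lemma IsLift.smul (r : ℝ) (hf : IsLift θ lam t f F) : IsLift θ lam t (r • f) (r • F) := by
  have h1 : (𝓕 (r • f) : L2x) = r • 𝓕 f := map_smul fourierOp r f
  unfold IsLift gevHat at *
  rw [h1]
  filter_upwards [hf, Lp.coeFn_smul r F, Lp.coeFn_smul r (𝓕 f)] with ξ h1 h2 h3
  rw [h2, h3, Pi.smul_apply, Pi.smul_apply, h1, Complex.real_smul, Complex.real_smul]
  ring

lemma IsLift.sub (hf : IsLift θ lam t f F) (hg : IsLift θ lam t g G) :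
    IsLift θ lam t (f - g) (F - G) := by
  have := hf.add (hg.smul (-1))
  simpa [sub_eq_add_neg] using this

lemma gevSymbol_eq_rpow_mul (s ξ : ℝ) :
    gevSymbol θ lam s t ξ = jap ξ ^ (-(2 - s)) * gevSymbol θ lam 2 t ξ := by
  rw [gevSymbol, gevSymbol, ← mul_assoc, ← Real.rpow_add (jap_pos ξ)]
  congr 2; ring

lemma IsLift.coeFn_japOp (hf : IsLift θ lam t f F) {s : ℝ} (hs : s ≤ 2) :
    japOp (2 - s) F =ᵐ[volume] gevHat θ lam s t f := by
  filter_upwards [hf, coeFn_mulOp (isSymbol_jap (r := 2 - s) (by linarith)) F] with ξ h1 h2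
  rw [japOp, h2, h1, gevHat, gevHat, gevSymbol_eq_rpow_mul s]
  push_cast; ring

lemma IsLift.gevENorm_eq (hf : IsLift θ lam t f F) {s : ℝ} (hs : s ≤ 2) :
    gevENorm θ lam s t f = ‖japOp (2 - s) F‖ₑ := by
  rw [gevENorm, ← eLpNorm_congr_ae (hf.coeFn_japOp hs), Lp.enorm_def]

/-! ### Differentiating lifts -/

lemma jap_rpow_le_exp (hθ : 0 ≤ θ) {r : ℝ} (hr : r ≤ 4) (ξ : ℝ) :
    jap ξ ^ r ≤ 40320 * Real.exp (jap ξ ^ (1 / 2 + 2 * θ)) := by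
  have h1 := one_le_jap ξ
  calc jap ξ ^ r ≤ jap ξ ^ (4 : ℝ) := Real.rpow_le_rpow_of_exponent_le h1 hr
    -- The constant `40320 = 8!` comes from `x^8 / 8! ≤ e^x` at `x = ⟨ξ⟩^{1/2}`.
    _ = (jap ξ ^ (1 / 2 : ℝ)) ^ 8 := by
      rw [← Real.rpow_natCast, ← Real.rpow_mul (jap_pos ξ).le]; norm_num
    _ ≤ 40320 * Real.exp (jap ξ ^ (1 / 2 : ℝ)) := by
      have := Real.pow_div_factorial_le_exp (jap ξ ^ (1 / 2 : ℝ))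
        (Real.rpow_pos_of_pos (jap_pos ξ) _).le 8
      rw [div_le_iff₀ (by positivity)] at this
      norm_num [Nat.factorial] at this ⊢
      linarith
    _ ≤ _ := by
      gcongr
      linarith

/-- The symbol `exp (-2 ⟨ξ⟩^{1/2 + 2θ})`. -/
def dampSymbol (θ ξ : ℝ) : ℝ := Real.exp (-2 * jap ξ ^ (1 / 2 + 2 * θ))

lemma isSymbol_dampSymbol : IsSymbol (dampSymbol θ) := by
  refine ⟨Real.continuous_exp.comp ((continuous_jap_rpow _).const_mul _), 1, fun ξ => ?_⟩
  rw [dampSymbol, abs_of_pos (Real.exp_pos _), Real.exp_le_one_iff]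
  have := Real.rpow_pos_of_pos (jap_pos ξ) (1 / 2 + 2 * θ)
  linarith

lemma isSymbol_rpow_mul_exp (hθ : 0 ≤ θ) {r b : ℝ} (hr : r ≤ 4) (hb : 1 ≤ b) :
    IsSymbol (fun ξ => jap ξ ^ r * Real.exp (-b * jap ξ ^ (1 / 2 + 2 * θ))) := by
  refine ⟨(continuous_jap_rpow _).mul
    (Real.continuous_exp.comp ((continuous_jap_rpow _).const_mul _)), 40320, fun ξ => ?_⟩
  have hN := Real.rpow_pos_of_pos (jap_pos ξ) (1 / 2 + 2 * θ)
  have hN' := Real.rpow_pos_of_pos (jap_pos ξ) r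
  rw [abs_of_pos (by positivity)]
  calc _ ≤ 40320 * Real.exp (jap ξ ^ (1 / 2 + 2 * θ)) *
        Real.exp (-1 * jap ξ ^ (1 / 2 + 2 * θ)) := by
        refine mul_le_mul (jap_rpow_le_exp hθ hr ξ) (Real.exp_le_exp.2 ?_) (Real.exp_pos _).le
          (by positivity)
        exact mul_le_mul_of_nonneg_right (by linarith) hN.le
    _ = 40320 := by rw [mul_assoc, ← Real.exp_add]; simp

/-- The factor `2` in the damping turns the exponent `1 - lam t` into `-(1 + lam t)`, at most `-1`
when `lam t ≥ 0`. The product then absorbs the powers of `⟨ξ⟩` that occur. -/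
lemma dampSymbol_mul_gevSymbol (s ξ : ℝ) : dampSymbol θ ξ * gevSymbol θ lam s t ξ =
    jap ξ ^ s * Real.exp (-(1 + lam * t) * jap ξ ^ (1 / 2 + 2 * θ)) := by
  rw [dampSymbol, gevSymbol, mul_left_comm, ← Real.exp_add]
  congr 2; ring

lemma IsLift.mulOp_damp (hθ : 0 ≤ θ) (ht : 0 ≤ lam * t) (hf : IsLift θ lam t f F) :
    mulOp (dampSymbol θ) F =
      mulOp (fun ξ => jap ξ ^ (2 : ℝ) * Real.exp (-(1 + lam * t) * jap ξ ^ (1 / 2 + 2 * θ)))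
        (𝓕 f) := by
  refine Lp.ext ?_
  filter_upwards [hf, coeFn_mulOp isSymbol_dampSymbol F,
    coeFn_mulOp (isSymbol_rpow_mul_exp hθ (r := 2) (b := 1 + lam * t) (by norm_num)
      (by linarith)) (𝓕 f)] with ξ h1 h2 h3
  rw [h2, h3, h1, gevHat, ← dampSymbol_mul_gevSymbol]
  push_cast; ring

lemma hasDerivAt_lift {α β : ℝ} (hθ : 0 ≤ θ) (ht : 0 ≤ lam * t) {f g F G : ℝ → L2x}
    (hf : ∀ y ∈ Ioo α β, HasDerivAt f (g y) y) (hF : ∀ y ∈ Ioo α β, IsLift θ lam t (f y) (F y))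
    (hG : ∀ y ∈ Ioo α β, IsLift θ lam t (g y) (G y)) (hGc : ContinuousOn G (Ioo α β))
    {y : ℝ} (hy : y ∈ Ioo α β) : HasDerivAt F (G y) y := by
  refine hasDerivAt_of_injective (mulOp (dampSymbol θ))
    (mulOp_injective isSymbol_dampSymbol fun ξ => (Real.exp_pos _).ne') hGc (fun x hx => ?_) hy
  rw [(hG x hx).mulOp_damp hθ ht]
  have h1 : HasDerivAt (fun z => (𝓕 (f z) : L2x)) (𝓕 (g x)) x :=
    fourierOp.hasFDerivAt.comp_hasDerivAt x (hf x hx)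
  refine ((mulOp fun ξ => jap ξ ^ (2 : ℝ) * Real.exp (-(1 + lam * t) *
    jap ξ ^ (1 / 2 + 2 * θ))).hasFDerivAt.comp_hasDerivAt x h1).congr_of_eventuallyEq ?_
  filter_upwards [isOpen_Ioo.mem_nhds hx] with z hz
  exact (hF z hz).mulOp_damp hθ ht

/-- The symbol `⟨ξ⟩^{1/2} exp (-(1 + lam t) ⟨ξ⟩^{1/2 + 2θ})`. -/
def timeSymbol (θ lam t ξ : ℝ) : ℝ :=
  jap ξ ^ (1 / 2 : ℝ) * Real.exp (-(1 + lam * t) * jap ξ ^ (1 / 2 + 2 * θ))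

/-- The time derivative of `timeSymbol`. -/
def timeSymbolDeriv (θ lam t ξ : ℝ) : ℝ :=
  -lam * (jap ξ ^ (1 + 2 * θ) * Real.exp (-(1 + lam * t) * jap ξ ^ (1 / 2 + 2 * θ)))

lemma isSymbol_timeSymbol (hθ : 0 ≤ θ) (ht : 0 ≤ lam * t) : IsSymbol (timeSymbol θ lam t) :=
  isSymbol_rpow_mul_exp hθ (by norm_num) (by linarith)

lemma IsSymbol.const_mul {m : ℝ → ℝ} (hm : IsSymbol m) (r : ℝ) : IsSymbol (fun ξ => r * m ξ) :=
  IsSymbol.mul (m := fun _ => r) ⟨continuous_const, |r|, fun _ => le_rfl⟩ hm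

lemma IsSymbol.add {m n : ℝ → ℝ} (hm : IsSymbol m) (hn : IsSymbol n) :
    IsSymbol (fun ξ => m ξ + n ξ) := by
  obtain ⟨C, hC⟩ := hm.2
  obtain ⟨D, hD⟩ := hn.2
  exact ⟨hm.1.add hn.1, C + D, fun ξ => (abs_add_le _ _).trans (add_le_add (hC ξ) (hD ξ))⟩

lemma isSymbol_timeSymbolDeriv (hθ : 0 ≤ θ) (hθ' : θ ≤ 1 / 2) (ht : 0 ≤ lam * t) :
    IsSymbol (timeSymbolDeriv θ lam t) :=
  (isSymbol_rpow_mul_exp hθ (by linarith) (by linarith)).const_mul _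

lemma abs_exp_sub_one_sub_le (x : ℝ) : |Real.exp x - 1 - x| ≤ x ^ 2 * Real.exp |x| := by
  have := Complex.norm_exp_sub_sum_le_norm_mul_exp (x : ℂ) 2
  simp only [Finset.sum_range_succ, Finset.sum_range_zero, pow_zero, pow_one, Nat.factorial] at this
  have e : Complex.exp x - (0 + 1 / ((1 : ℕ) : ℂ) + (x : ℂ) / ((1 : ℕ) : ℂ)) =
      ((Real.exp x - 1 - x : ℝ) : ℂ) := by push_cast; ring
  norm_num at this e
  rw [e] at this
  rw [← Complex.ofReal_exp, ← Complex.ofReal_one, ← Complex.ofReal_sub, ← Complex.ofReal_sub,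
    Complex.norm_real] at this
  simpa using this

/-- Second-order Taylor expansion of the exponential, uniform in `ξ`. For `|τ - t| ≤ t` the
remainder costs at most `e^{lam t N}`, which leaves `e^{-N}` to absorb `⟨ξ⟩^{3/2+4θ}`, a power at
most `4`. -/
lemma abs_timeSymbol_sub_le (hθ : 0 ≤ θ) (hθ' : θ ≤ 1 / 2) {τ : ℝ} (hlam : 0 ≤ lam)
    (hτ : |τ - t| ≤ t) (ξ : ℝ) :
    |timeSymbol θ lam τ ξ + -1 * (timeSymbol θ lam t ξ + (τ - t) * timeSymbolDeriv θ lam t ξ)| ≤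
      40320 * lam ^ 2 * (τ - t) ^ 2 := by
  set N := jap ξ ^ (1 / 2 + 2 * θ) with hN
  have hN0 : 0 < N := Real.rpow_pos_of_pos (jap_pos ξ) _
  have hj : 0 < jap ξ ^ (1 / 2 : ℝ) := Real.rpow_pos_of_pos (jap_pos ξ) _
  have e1 : jap ξ ^ (1 + 2 * θ) = jap ξ ^ (1 / 2 : ℝ) * N := by
    rw [hN, ← Real.rpow_add (jap_pos ξ)]; congr 1; ring
  set x := -(lam * (τ - t) * N) with hx
  have e2 : Real.exp (-(1 + lam * τ) * N) = Real.exp (-(1 + lam * t) * N) * Real.exp x := by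
    rw [← Real.exp_add]; congr 1; rw [hx]; ring
  have e3 : timeSymbol θ lam τ ξ +
      -1 * (timeSymbol θ lam t ξ + (τ - t) * timeSymbolDeriv θ lam t ξ) =
      jap ξ ^ (1 / 2 : ℝ) * Real.exp (-(1 + lam * t) * N) * (Real.exp x - 1 - x) := by
    simp only [timeSymbol, timeSymbolDeriv, ← hN, e1, e2, hx]
    ring
  rw [e3, abs_mul, abs_of_pos (by positivity)]
  have hxa : |x| ≤ lam * t * N := by
    rw [hx, abs_neg, abs_mul, abs_mul, abs_of_nonneg hlam, abs_of_pos hN0]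
    gcongr
  calc _ ≤ jap ξ ^ (1 / 2 : ℝ) * Real.exp (-(1 + lam * t) * N) *
        (x ^ 2 * Real.exp (lam * t * N)) := by
        gcongr
        exact (abs_exp_sub_one_sub_le x).trans (by gcongr)
    _ = lam ^ 2 * (τ - t) ^ 2 * ((jap ξ ^ (1 / 2 : ℝ) * N ^ 2) *
        (Real.exp (-(1 + lam * t) * N) * Real.exp (lam * t * N))) := by rw [hx]; ring
    _ ≤ lam ^ 2 * (τ - t) ^ 2 * ((40320 * Real.exp N) * Real.exp (-N)) := by
        have e4 : jap ξ ^ (1 / 2 : ℝ) * N ^ 2 = jap ξ ^ (3 / 2 + 4 * θ) := by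
          rw [hN, ← Real.rpow_natCast, ← Real.rpow_mul (jap_pos ξ).le,
            ← Real.rpow_add (jap_pos ξ)]
          congr 1; push_cast; ring
        rw [← Real.exp_add, show -(1 + lam * t) * N + lam * t * N = -N by ring, e4]
        gcongr
        exact jap_rpow_le_exp hθ (by linarith) ξ
    _ = 40320 * lam ^ 2 * (τ - t) ^ 2 := by
        rw [mul_assoc 40320, ← Real.exp_add]; simp; ring

lemma hasDerivAt_mulOp_timeSymbol (hθ : 0 ≤ θ) (hθ' : θ ≤ 1 / 2) (hlam : 0 ≤ lam) (ht : 0 < t) :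
    HasDerivAt (fun τ => mulOp (timeSymbol θ lam τ)) (mulOp (timeSymbolDeriv θ lam t)) t := by
  rw [hasDerivAt_iff_isLittleO]
  have hO : (fun τ => mulOp (timeSymbol θ lam τ) - mulOp (timeSymbol θ lam t) -
      (τ - t) • mulOp (timeSymbolDeriv θ lam t)) =O[𝓝 t] fun τ => (τ - t) ^ 2 := by
    refine Asymptotics.IsBigO.of_bound (40320 * lam ^ 2) ?_
    filter_upwards [Metric.closedBall_mem_nhds t ht] with τ hτ
    have hτ' : |τ - t| ≤ t := by simpa [Real.dist_eq] using hτ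
    have hτ0 : 0 ≤ τ := by linarith [neg_le_of_abs_le hτ']
    have s1 := isSymbol_timeSymbol (t := τ) hθ (mul_nonneg hlam hτ0)
    have s2 := isSymbol_timeSymbol hθ (mul_nonneg hlam ht.le)
    have s3 := isSymbol_timeSymbolDeriv hθ hθ' (mul_nonneg hlam ht.le)
    have s4 := s3.const_mul (τ - t)
    have s5 := s2.add s4
    have s6 := s5.const_mul (-1)
    have s7 := s1.add s6
    have e : mulOp (timeSymbol θ lam τ) - mulOp (timeSymbol θ lam t) -
        (τ - t) • mulOp (timeSymbolDeriv θ lam t) = mulOp (fun ξ => timeSymbol θ lam τ ξ +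
          -1 * (timeSymbol θ lam t ξ + (τ - t) * timeSymbolDeriv θ lam t ξ)) := by
      rw [mulOp_add s1 s6 s7, mulOp_const_mul _ s5 s6, mulOp_add s2 s4 s5, mulOp_const_mul _ s3 s4]
      module
    rw [e, norm_pow, Real.norm_eq_abs, sq_abs]
    exact norm_mulOp_le (by positivity) (abs_timeSymbol_sub_le hθ hθ' hlam hτ')
  refine hO.trans_isLittleO ?_
  have h0 : Tendsto (fun τ => τ - t) (𝓝 t) (𝓝 0) := by
    have : Continuous fun τ : ℝ => τ - t := by fun_prop
    simpa using this.tendsto t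
  exact (Asymptotics.isLittleO_pow_id (𝕜 := ℝ) one_lt_two).comp_tendsto h0

/-- The term with `lam` in `D` is the time derivative of the symbol: `∂_t (⟨ξ⟩^{1/2} e^Φ) = -lam
⟨ξ⟩^{1+2θ} e^Φ`, expressed through the lift, which carries `⟨ξ⟩² e^Φ`. The product rule is applied
to damped operators, whose time derivative exists in operator norm. -/
lemma hasDerivAt_lift_time {T : ℝ} (hθ : 0 ≤ θ) (hθ' : θ ≤ 1 / 2) (hlam : 0 ≤ lam)
    {f d F D : ℝ → L2x} (hf : ∀ t ∈ Ioo 0 T, HasDerivAt f (d t) t)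
    (hF : ∀ t ∈ Ioo 0 T, IsLift θ lam t (f t) (F t))
    (hD : ∀ t ∈ Ioo 0 T, ∀ᵐ ξ, D t ξ = (gevSymbol θ lam (1 / 2) t ξ : ℂ) * (𝓕 (d t) : L2x) ξ -
      (lam * jap ξ ^ (-(1 - 2 * θ)) : ℝ) * F t ξ)
    (hDc : ContinuousOn D (Ioo 0 T)) (ht : t ∈ Ioo 0 T) :
    HasDerivAt (fun τ => japOp (3 / 2) (F τ)) (D t) t := by
  have hdamp : ∀ τ ∈ Ioo 0 T, mulOp (dampSymbol θ) (japOp (3 / 2) (F τ)) =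
      mulOp (timeSymbol θ lam τ) (fourierOp (f τ)) := by
    intro τ hτ
    refine Lp.ext ?_
    have hj := (hF τ hτ).coeFn_japOp (s := 1 / 2) (by norm_num)
    rw [show (2 : ℝ) - 1 / 2 = 3 / 2 by norm_num] at hj
    filter_upwards [hj, coeFn_mulOp isSymbol_dampSymbol (japOp (3 / 2) (F τ)),
      coeFn_mulOp (isSymbol_timeSymbol (t := τ) hθ (mul_nonneg hlam hτ.1.le)) (fourierOp (f τ))]
      with ξ h1 h2 h3
    rw [h2, h3, h1, gevHat, fourierOp_apply, timeSymbol, ← dampSymbol_mul_gevSymbol]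
    push_cast; ring
  refine hasDerivAt_of_injective (f := fun τ => japOp (3 / 2) (F τ)) (mulOp (dampSymbol θ))
    (mulOp_injective isSymbol_dampSymbol fun ξ => (Real.exp_pos _).ne') hDc (fun x hx => ?_) ht
  have h1 : HasDerivAt (fun τ => fourierOp (f τ)) (fourierOp (d x)) x :=
    fourierOp.hasFDerivAt.comp_hasDerivAt x (hf x hx)
  have h2 := (hasDerivAt_mulOp_timeSymbol hθ hθ' hlam hx.1).clm_apply h1
  refine (h2.congr_of_eventuallyEq ?_).congr_deriv ?_
  · filter_upwards [isOpen_Ioo.mem_nhds hx] with τ hτ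
    exact hdamp τ hτ
  · refine Lp.ext ?_
    have hlx := mul_nonneg hlam hx.1.le
    filter_upwards [hD x hx, hF x hx, coeFn_mulOp isSymbol_dampSymbol (D x),
      coeFn_mulOp (isSymbol_timeSymbol hθ hlx) (fourierOp (d x)),
      coeFn_mulOp (isSymbol_timeSymbolDeriv hθ hθ' hlx) (fourierOp (f x)),
      Lp.coeFn_add (mulOp (timeSymbolDeriv θ lam x) (fourierOp (f x)))
        (mulOp (timeSymbol θ lam x) (fourierOp (d x)))] with ξ h1 h2 h3 h4 h5 h6
    rw [h6, Pi.add_apply, h4, h5, h3, h1, h2, gevHat, fourierOp_apply, fourierOp_apply]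
    have e1 : dampSymbol θ ξ * gevSymbol θ lam (1 / 2) x ξ = timeSymbol θ lam x ξ :=
      dampSymbol_mul_gevSymbol _ _
    have e2 : dampSymbol θ ξ * (-(lam * jap ξ ^ (-(1 - 2 * θ))) * gevSymbol θ lam 2 x ξ) =
        timeSymbolDeriv θ lam x ξ := by
      rw [mul_left_comm, dampSymbol_mul_gevSymbol, timeSymbolDeriv, neg_mul, neg_mul]
      rw [mul_assoc, ← mul_assoc (jap ξ ^ _), ← Real.rpow_add (jap_pos ξ)]
      ring_nf
    rw [← e1, ← e2]
    push_cast; ring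

end

section

/-! ### One-dimensional inequalities -/

section Hardy

variable {E : Type*} [NormedAddCommGroup E] [InnerProductSpace ℝ E]

/-- A Hardy inequality on an interval that stays away from the singular point `a`. -/
lemma hardy_left {a b x : ℝ} (hbx : b ≤ x) (hxa : x ≤ a) {k k' : ℝ → E}
    (hk : ∀ y ∈ Icc b x, HasDerivAt k (k' y) y) (hk' : ContinuousOn k' (Icc b x)) (hb : k b = 0) :
    ∫ y in b..x, (a - y) ^ 2 * ‖k y‖ ^ 2 ≤ ∫ y in b..x, (a - y) ^ 4 * ‖k' y‖ ^ 2 := by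
  have hkc : ContinuousOn k (Icc b x) := fun y hy => (hk y hy).continuousAt.continuousWithinAt
  -- Integrating the derivative of `(a - y)³ ‖k‖²` leaves a nonnegative boundary term at `x` and
  -- none at `b`; Young's inequality on the cross term then uses up one of the three copies of `(a -
  -- y)² ‖k‖²`.
  have hder : ∀ y ∈ Icc b x, HasDerivAt (fun y => (a - y) ^ 3 * ‖k y‖ ^ 2)
      (-3 * (a - y) ^ 2 * ‖k y‖ ^ 2 + (a - y) ^ 3 * (2 * inner ℝ (k y) (k' y))) y := by
    intro y hy
    have h1 : HasDerivAt (fun y : ℝ => (a - y) ^ 3) (-3 * (a - y) ^ 2) y := by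
      have := ((hasDerivAt_id y).const_sub a).pow 3
      refine this.congr_deriv ?_
      simp
    exact h1.mul (hk y hy).norm_sq
  have hu : uIcc b x = Icc b x := uIcc_of_le hbx
  have hi1 : IntervalIntegrable (fun y => (a - y) ^ 2 * ‖k y‖ ^ 2) volume b x :=
    ContinuousOn.intervalIntegrable (by rw [hu]; fun_prop)
  have hi2 : IntervalIntegrable (fun y => (a - y) ^ 4 * ‖k' y‖ ^ 2) volume b x :=
    ContinuousOn.intervalIntegrable (by rw [hu]; fun_prop)
  have hi3 : IntervalIntegrable (fun y => -3 * (a - y) ^ 2 * ‖k y‖ ^ 2 +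
      (a - y) ^ 3 * (2 * inner ℝ (k y) (k' y))) volume b x := by
    refine ContinuousOn.intervalIntegrable ?_
    rw [hu]
    have := hkc.inner (𝕜 := ℝ) hk'
    fun_prop
  have hftc := intervalIntegral.integral_eq_sub_of_hasDerivAt (fun y hy => hder y (hu ▸ hy)) hi3
  have hle : ∫ y in b..x, (-3 * (a - y) ^ 2 * ‖k y‖ ^ 2 +
      (a - y) ^ 3 * (2 * inner ℝ (k y) (k' y))) ≤
      ∫ y in b..x, ((a - y) ^ 4 * ‖k' y‖ ^ 2 - 2 * ((a - y) ^ 2 * ‖k y‖ ^ 2)) := by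
    refine intervalIntegral.integral_mono_on hbx hi3 (hi2.sub (hi1.const_mul 2)) fun y hy => ?_
    have hs : 0 ≤ a - y := by linarith [hy.2]
    have h1 := real_inner_le_norm (k y) (k' y)
    have h2 : (a - y) ^ 3 * (2 * inner ℝ (k y) (k' y)) ≤
        (a - y) ^ 3 * (2 * (‖k y‖ * ‖k' y‖)) := by gcongr
    nlinarith [sq_nonneg ((a - y) * ‖k y‖ - (a - y) ^ 2 * ‖k' y‖)]
  rw [hftc, hb, intervalIntegral.integral_sub hi2 (hi1.const_mul 2),
    intervalIntegral.integral_const_mul] at hle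
  have h0 : 0 ≤ (a - x) ^ 3 * ‖k x‖ ^ 2 :=
    mul_nonneg (pow_nonneg (by linarith) 3) (sq_nonneg _)
  have h1 : 0 ≤ ∫ y in b..x, (a - y) ^ 2 * ‖k y‖ ^ 2 :=
    intervalIntegral.integral_nonneg hbx fun y _ => by positivity
  simp only [norm_zero] at hle
  linarith

/-- If `s` has a simple zero at `a` and `w = s f' - s' f`, then `f` is, up to a multiple of `s`,
controlled by `w` in `L²`. -/
lemma integral_remainder_left {a b c M : ℝ} (hba : b < a) (hc : 0 < c) {s s' : ℝ → ℝ}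
    {f f' : ℝ → E} (hs : ∀ y ∈ Icc b a, HasDerivAt s (s' y) y)
    (hf : ∀ y ∈ Icc b a, HasDerivAt f (f' y) y)
    (hs' : ContinuousOn s' (Icc b a)) (hf' : ContinuousOn f' (Icc b a))
    (hlow : ∀ y ∈ Icc b a, c * |y - a| ≤ |s y|) (hupp : ∀ y ∈ Icc b a, |s y| ≤ M * |y - a|) :
    ∫ y in b..a, ‖f y - (s y / s b) • f b‖ ^ 2 ≤
      M ^ 2 / c ^ 4 * ∫ y in b..a, ‖s y • f' y - s' y • f y‖ ^ 2 := by
  have hsc : ContinuousOn s (Icc b a) := fun y hy => (hs y hy).continuousAt.continuousWithinAt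
  have hfc : ContinuousOn f (Icc b a) := fun y hy => (hf y hy).continuousAt.continuousWithinAt
  have hu : uIcc b a = Icc b a := uIcc_of_le hba.le
  set w := fun y => s y • f' y - s' y • f y with hw
  have hwc : ContinuousOn w (Icc b a) := (hsc.smul hf').sub (hs'.smul hfc)
  set h := fun y => f y - (s y / s b) • f b with hh
  have hhc : ContinuousOn h (Icc b a) := hfc.sub ((hsc.div_const _).smul continuousOn_const)
  have hs0 : ∀ y ∈ Ico b a, s y ≠ 0 := by
    intro y hy h0
    have := hlow y ⟨hy.1, hy.2.le⟩
    rw [h0, abs_zero] at this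
    exact absurd this (not_le.2 (mul_pos hc (abs_pos.2 (by linarith [hy.2]))))
  have hwi : IntervalIntegrable (fun y => ‖w y‖ ^ 2) volume b a :=
    ContinuousOn.intervalIntegrable (by rw [hu]; fun_prop)
  have hhi : IntegrableOn (fun y => ‖h y‖ ^ 2) (uIcc b a) := by
    rw [hu]; exact ContinuousOn.integrableOn_Icc (by fun_prop)
  -- Short of the singular point the remainder is `s k` with `k = f / s - f(b) / s(b)`, so `k(b) =
  -- 0` and `k' = w / s²`. The Hardy weights `(a-y)²` and `(a-y)⁴` match `s²` and `s⁴`, and the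
  -- bound does not depend on `x`.
  have hpart : ∀ x ∈ Ico b a, ∫ y in b..x, ‖h y‖ ^ 2 ≤
      M ^ 2 / c ^ 4 * ∫ y in b..a, ‖w y‖ ^ 2 := by
    intro x hx
    have hsub : Icc b x ⊆ Icc b a := Icc_subset_Icc_right hx.2.le
    have hsub' : Icc b x ⊆ Ico b a := fun y hy => ⟨hy.1, hy.2.trans_lt hx.2⟩
    set k := fun y => (s y)⁻¹ • f y - (s b)⁻¹ • f b with hk
    set k' := fun y => ((s y) ^ 2)⁻¹ • w y with hk'
    have hkd : ∀ y ∈ Icc b x, HasDerivAt k (k' y) y := by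
      intro y hy
      have h0 := hs0 y (hsub' hy)
      have := (((hs y (hsub hy)).inv h0).smul (hf y (hsub hy))).sub_const ((s b)⁻¹ • f b)
      refine this.congr_deriv ?_
      simp only [hk', hw, smul_sub, smul_smul]
      rw [sub_eq_add_neg, ← neg_smul]
      simp only [Pi.inv_apply]
      congr 2 <;> field_simp
    have hk'c : ContinuousOn k' (Icc b x) :=
      (((hsc.mono hsub).pow 2).inv₀ fun y hy => pow_ne_zero 2 (hs0 y (hsub' hy))).smul
        (hwc.mono hsub)
    have hkc : ContinuousOn k (Icc b x) := fun y hy => (hkd y hy).continuousAt.continuousWithinAt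
    have hardy := hardy_left hx.1 hx.2.le hkd hk'c (sub_self _)
    have hux : uIcc b x = Icc b x := uIcc_of_le hx.1
    have e1 : ∫ y in b..x, ‖h y‖ ^ 2 ≤ ∫ y in b..x, M ^ 2 * ((a - y) ^ 2 * ‖k y‖ ^ 2) := by
      refine intervalIntegral.integral_mono_on hx.1
        (ContinuousOn.intervalIntegrable (by rw [hux]; exact (hhc.mono hsub).norm.pow 2))
        (ContinuousOn.intervalIntegrable (by rw [hux]; fun_prop)) fun y hy => ?_
      have h0 := hs0 y (hsub' hy)
      have : h y = s y • k y := by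
        simp only [hh, hk, smul_sub, smul_smul, mul_inv_cancel₀ h0, one_smul, div_eq_mul_inv]
      rw [this, norm_smul, mul_pow, Real.norm_eq_abs, ← mul_assoc]
      gcongr
      calc |s y| ^ 2 ≤ (M * |y - a|) ^ 2 := by gcongr; exact hupp y (hsub hy)
        _ = M ^ 2 * (a - y) ^ 2 := by rw [mul_pow, sq_abs]; ring
    have e2 : ∫ y in b..x, (a - y) ^ 4 * ‖k' y‖ ^ 2 ≤ ∫ y in b..x, (c ^ 4)⁻¹ * ‖w y‖ ^ 2 := by
      refine intervalIntegral.integral_mono_on hx.1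
        (ContinuousOn.intervalIntegrable (by rw [hux]; fun_prop))
        (ContinuousOn.intervalIntegrable (by
          rw [hux]; exact continuousOn_const.mul ((hwc.mono hsub).norm.pow 2))) fun y hy => ?_
      have h0 := hs0 y (hsub' hy)
      rw [hk', norm_smul, mul_pow, ← mul_assoc]
      gcongr
      rw [norm_inv, norm_pow, Real.norm_eq_abs, inv_pow, ← pow_mul, ← div_eq_mul_inv,
        div_le_iff₀ (by positivity), ← div_eq_inv_mul, le_div_iff₀ (by positivity)]
      have h4 := pow_le_pow_left₀ (by positivity) (hlow y (hsub hy)) 4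
      rw [mul_pow, show |y - a| ^ 4 = (a - y) ^ 4 by
        rw [show 4 = 2 * 2 by rfl, pow_mul, sq_abs, pow_mul, sub_sq_comm]] at h4
      rw [show (2 : ℕ) * 2 = 4 from rfl]
      linarith
    have e3 : ∫ y in b..x, ‖w y‖ ^ 2 ≤ ∫ y in b..a, ‖w y‖ ^ 2 :=
      intervalIntegral.integral_mono_interval le_rfl hx.1 hx.2.le
        (ae_of_all _ fun y => sq_nonneg _) hwi
    rw [intervalIntegral.integral_const_mul] at e1 e2
    calc _ ≤ _ := e1
      _ ≤ M ^ 2 * ((c ^ 4)⁻¹ * ∫ y in b..a, ‖w y‖ ^ 2) := by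
        gcongr
        exact hardy.trans (e2.trans (by gcongr))
      _ = _ := by ring
  have hcont : ContinuousOn (fun x => ∫ y in b..x, ‖h y‖ ^ 2) (Icc b a) := by
    have := intervalIntegral.continuousOn_primitive_interval hhi
    rwa [hu] at this
  have htend : Tendsto (fun x => ∫ y in b..x, ‖h y‖ ^ 2) (𝓝[Ico b a] a)
      (𝓝 (∫ y in b..a, ‖h y‖ ^ 2)) :=
    (hcont a (right_mem_Icc.2 hba.le)).mono_left (nhdsWithin_mono _ Ico_subset_Icc_self)
  have : (𝓝[Ico b a] a).NeBot := right_nhdsWithin_Ico_neBot hba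
  exact le_of_tendsto htend (by filter_upwards [self_mem_nhdsWithin] with x hx using hpart x hx)

lemma integral_remainder_right {a b c M : ℝ} (hab : a < b) (hc : 0 < c) {s s' : ℝ → ℝ}
    {f f' : ℝ → E} (hs : ∀ y ∈ Icc a b, HasDerivAt s (s' y) y)
    (hf : ∀ y ∈ Icc a b, HasDerivAt f (f' y) y)
    (hs' : ContinuousOn s' (Icc a b)) (hf' : ContinuousOn f' (Icc a b))
    (hlow : ∀ y ∈ Icc a b, c * |y - a| ≤ |s y|) (hupp : ∀ y ∈ Icc a b, |s y| ≤ M * |y - a|) :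
    ∫ y in a..b, ‖f y - (s y / s b) • f b‖ ^ 2 ≤
      M ^ 2 / c ^ 4 * ∫ y in a..b, ‖s y • f' y - s' y • f y‖ ^ 2 := by
  have hmem : ∀ {y}, y ∈ Icc (-b) (-a) → -y ∈ Icc a b := fun hy =>
    ⟨by linarith [hy.2], by linarith [hy.1]⟩
  have habs : ∀ y, |-y - a| = |y - -a| := fun y => by rw [← abs_neg]; congr 1; ring
  have hneg : MapsTo (fun y : ℝ => -y) (Icc (-b) (-a)) (Icc a b) := fun y hy => hmem hy
  have key := integral_remainder_left (a := -a) (b := -b) (c := c) (M := M) (by linarith) hc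
    (s := fun y => s (-y)) (s' := fun y => -s' (-y)) (f := fun y => f (-y))
    (f' := fun y => -f' (-y))
    (fun y hy => by simpa [Function.comp_def] using (hs _ (hmem hy)).comp y (hasDerivAt_neg y))
    (fun y hy => by simpa [Function.comp_def] using (hf _ (hmem hy)).scomp y (hasDerivAt_neg y))
    (hs'.comp continuousOn_neg hneg).neg (hf'.comp continuousOn_neg hneg).neg
    (fun y hy => by rw [← habs]; exact hlow _ (hmem hy))
    (fun y hy => by rw [← habs]; exact hupp _ (hmem hy))
  have e1 := intervalIntegral.integral_comp_neg (a := -b) (b := -a)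
    (fun y => ‖f y - (s y / s b) • f b‖ ^ 2)
  have e2 := intervalIntegral.integral_comp_neg (a := -b) (b := -a)
    (fun y => ‖s y • f' y - s' y • f y‖ ^ 2)
  have e3 : ∀ y, ‖s (-y) • -f' (-y) - -s' (-y) • f (-y)‖ = ‖s (-y) • f' (-y) - s' (-y) • f (-y)‖ :=
    fun y => by rw [← norm_neg]; congr 1; module
  simp only [neg_neg, e3] at key e1 e2
  rwa [e1, e2] at key

/-- The trace inequality on an interval. -/
lemma norm_sq_le_integral {lo hi b : ℝ} (hlh : lo < hi) (hb : b ∈ Icc lo hi) {f f' : ℝ → E}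
    (hf : ∀ y ∈ Icc lo hi, HasDerivAt f (f' y) y) (hf' : ContinuousOn f' (Icc lo hi)) :
    ‖f b‖ ^ 2 ≤ ((hi - lo)⁻¹ + 1) *
      ((∫ y in lo..hi, ‖f y‖ ^ 2) + ∫ y in lo..hi, ‖f' y‖ ^ 2) := by
  have hfc : ContinuousOn f (Icc lo hi) := fun y hy => (hf y hy).continuousAt.continuousWithinAt
  have hu : uIcc lo hi = Icc lo hi := uIcc_of_le hlh.le
  have hi1 : IntervalIntegrable (fun y => ‖f y‖ ^ 2) volume lo hi :=
    ContinuousOn.intervalIntegrable (by rw [hu]; fun_prop)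
  have hi2 : IntervalIntegrable (fun y => ‖f' y‖ ^ 2) volume lo hi :=
    ContinuousOn.intervalIntegrable (by rw [hu]; fun_prop)
  set I := (∫ y in lo..hi, ‖f y‖ ^ 2) + ∫ y in lo..hi, ‖f' y‖ ^ 2 with hI
  have hinner : ContinuousOn (fun y => 2 * inner ℝ (f y) (f' y)) (Icc lo hi) :=
    continuousOn_const.mul (hfc.inner hf')
  -- The oscillation of `‖f‖²` is at most `I`; averaging this inequality over `x` gives the trace
  -- bound.
  have hpt : ∀ x ∈ Icc lo hi, ‖f b‖ ^ 2 - I ≤ ‖f x‖ ^ 2 := by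
    intro x hx
    have hsub : uIcc x b ⊆ Icc lo hi := ordConnected_Icc.uIcc_subset hx hb
    have h1 := intervalIntegral.integral_eq_sub_of_hasDerivAt (a := x) (b := b)
      (fun y hy => (hf y (hsub hy)).norm_sq) (hinner.mono hsub).intervalIntegrable
    have h2 : |∫ y in x..b, 2 * inner ℝ (f y) (f' y)| ≤ I := by
      rw [hI, ← intervalIntegral.integral_add hi1 hi2, intervalIntegral.integral_of_le hlh.le,
        ← Real.norm_eq_abs]
      refine intervalIntegral.norm_integral_le_integral_norm_uIoc.trans ?_
      refine (setIntegral_mono_on (g := fun y => ‖f y‖ ^ 2 + ‖f' y‖ ^ 2) ?_ ?_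
        measurableSet_uIoc fun y hy => ?_).trans
        (setIntegral_mono_set ?_ (ae_of_all _ fun y => by positivity) ?_)
      · exact ((hinner.mono hsub).intervalIntegrable.norm).def'
      · exact (ContinuousOn.intervalIntegrable
          (ContinuousOn.mono (s := Icc lo hi) (by fun_prop) hsub)).def'
      · rw [Real.norm_eq_abs, abs_mul, abs_two]
        nlinarith [abs_real_inner_le_norm (f y) (f' y), sq_nonneg (‖f y‖ - ‖f' y‖)]
      · exact (intervalIntegrable_iff_integrableOn_Ioc_of_le hlh.le).1 (hi1.add hi2)
      · refine LE.le.eventuallyLE ?_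
        exact fun y hy => ⟨(le_min hx.1 hb.1).trans_lt hy.1, hy.2.trans (max_le hx.2 hb.2)⟩
    linarith [le_abs_self (∫ y in x..b, 2 * inner ℝ (f y) (f' y))]
  have hmono := intervalIntegral.integral_mono_on hlh.le
    (intervalIntegrable_const) hi1 hpt
  rw [intervalIntegral.integral_const, smul_eq_mul] at hmono
  have h0 : 0 < hi - lo := by linarith
  have h2 : 0 ≤ ∫ y in lo..hi, ‖f' y‖ ^ 2 :=
    intervalIntegral.integral_nonneg hlh.le fun y _ => by positivity
  have h3 : ‖f b‖ ^ 2 - I ≤ (hi - lo)⁻¹ * I := by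
    rw [← div_eq_inv_mul, le_div_iff₀ h0]
    linarith
  linarith

end Hardy

end

section

/-! ### The spatial estimate -/

/-- The integrand of the error terms in the energy identity for the weighted unknown. -/
def errorTerm (P P' α s1 s2 s3 : ℝ) (u0 u1 u2 : L2x) : ℝ :=
  P * (2 * inner ℝ (japOp (3 / 2) (s1 • u1 - s2 • u0))
        (japOp (3 / 2) ((2 * s3) • u1 - (2 * s2) • u2))
      + 2 * α * inner ℝ (japOp (3 / 2) (s1 • u1 - s2 • u0)) (japOp (3 / 2) (s1 • u2 - s3 • u0)))
    - 2 * P' * inner ℝ (japOp (3 / 2) (s1 • u1 - s2 • u0)) (japOp (3 / 2) (s1 • u2 - s3 • u0))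

lemma mul_four_add_le (p x y : ℝ) :
    p * (4 * x + 4 * y) ≤ p ^ 2 + 8 * x ^ 2 + 8 * y ^ 2 := by
  nlinarith [sq_nonneg (p - 2 * (x + y)), sq_nonneg (x - y)]

/-- Here `r` stands for `1 / s1`. It occurs only in the combination `P * r`, which stays bounded at
the critical point. -/
lemma weighted_products_le {P P' α r s2 s3 M L p n K x A H z1 z2 z3 z4 : ℝ} (hM : 0 ≤ M)
    (hP : 0 ≤ P) (hPM : P ≤ M) (hPs : |P * r| ≤ L) (hP' : |P'| ≤ M) (hα : |α| ≤ M)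
    (h2 : |s2| ≤ M) (h3 : |s3| ≤ M) (i1 : |z1| ≤ p * x) (i2 : |z2| ≤ n * K)
    (i3 : |z3| ≤ p * A) (i4 : |z4| ≤ n * H) :
    4 * (P * s3 * z1) + 4 * -(s2 * (P * r) * z2) + 4 * -(P * (s2 * s3) * z3)
        + 4 * -(s2 * (P * r) * s3 * z4) + 2 * ((P * α - P') * z2) ≤
      P * (p * (4 * (M * x) + 4 * (M ^ 2 * A))) + (4 * M * L + 2 * M ^ 2 + 2 * M) * (n * K)
        + 4 * M ^ 2 * L * (n * H) := by
  have hL : 0 ≤ L := (abs_nonneg _).trans hPs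
  have t1 : P * s3 * z1 ≤ P * M * (p * x) := by
    refine (le_abs_self _).trans ?_
    rw [abs_mul, abs_mul, abs_of_nonneg hP]
    gcongr
  have t2 : -(s2 * (P * r) * z2) ≤ M * L * (n * K) := by
    refine (neg_le_abs _).trans ?_
    rw [abs_mul, abs_mul]
    gcongr
  have t3 : -(P * (s2 * s3) * z3) ≤ P * (M * M) * (p * A) := by
    refine (neg_le_abs _).trans ?_
    rw [abs_mul, abs_mul, abs_mul, abs_of_nonneg hP]
    gcongr
  have t4 : -(s2 * (P * r) * s3 * z4) ≤ M * L * M * (n * H) := by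
    refine (neg_le_abs _).trans ?_
    rw [abs_mul, abs_mul, abs_mul]
    gcongr
  have t5 : (P * α - P') * z2 ≤ (M * M + M) * (n * K) := by
    refine (le_abs_self _).trans ?_
    rw [abs_mul]
    have : |P * α - P'| ≤ M * M + M := by
      refine (abs_sub _ _).trans (add_le_add ?_ hP')
      rw [abs_mul, abs_of_nonneg hP]
      gcongr
    gcongr
  have h4 : (0 : ℝ) ≤ 4 := by norm_num
  refine (add_le_add (add_le_add (add_le_add (add_le_add (mul_le_mul_of_nonneg_left t1 h4)
    (mul_le_mul_of_nonneg_left t2 h4)) (mul_le_mul_of_nonneg_left t3 h4))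
    (mul_le_mul_of_nonneg_left t4 h4)) (mul_le_mul_of_nonneg_left t5 zero_le_two)).trans_eq ?_
  ring

/-- Young's inequality: coefficient exactly one on the weighted `p ^ 2`, to be absorbed by the
dissipation, and the small `ε` on `K ^ 2`, the norm of `∂_y w₂`. -/
lemma weighted_products_le_sq {P M L G ε p n K x A H : ℝ} (hε : 0 < ε) (hL : 0 ≤ L)
    (hP : 0 ≤ P) (hPM : P ≤ M) :
    P * (p * (4 * (M * x) + 4 * (M ^ 2 * A))) + G * (n * K) + 4 * M ^ 2 * L * (n * H) ≤
      P * p ^ 2 + 8 * M ^ 3 * x ^ 2 + 8 * M ^ 5 * A ^ 2 + ε * K ^ 2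
        + (G ^ 2 / (4 * ε) + 4 * M ^ 2 * L) * n ^ 2 + 4 * M ^ 2 * L * H ^ 2 := by
  have q1 : P * (p * (4 * (M * x) + 4 * (M ^ 2 * A))) ≤
      P * p ^ 2 + 8 * M ^ 3 * x ^ 2 + 8 * M ^ 5 * A ^ 2 := by
    calc _ ≤ P * (p ^ 2 + 8 * (M * x) ^ 2 + 8 * (M ^ 2 * A) ^ 2) := by
          gcongr; exact mul_four_add_le _ _ _
      _ = P * p ^ 2 + P * (8 * (M * x) ^ 2 + 8 * (M ^ 2 * A) ^ 2) := by ring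
      _ ≤ P * p ^ 2 + M * (8 * (M * x) ^ 2 + 8 * (M ^ 2 * A) ^ 2) := by gcongr
      _ = _ := by ring
  have q2 : G * (n * K) ≤ ε * K ^ 2 + G ^ 2 / (4 * ε) * n ^ 2 := by
    have : ε * K ^ 2 + G ^ 2 / (4 * ε) * n ^ 2 - G * (n * K) =
        ε * (K - G / (2 * ε) * n) ^ 2 := by
      field_simp; ring
    linarith [mul_nonneg hε.le (sq_nonneg (K - G / (2 * ε) * n))]
  have q3 : 4 * M ^ 2 * L * (n * H) ≤ 4 * M ^ 2 * L * (n ^ 2 + H ^ 2) := by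
    gcongr
    nlinarith [sq_nonneg (n - H)]
  refine (add_le_add (add_le_add q1 q2) q3).trans_eq ?_
  ring

lemma errorTerm_le {P P' α s1 s2 s3 sb M L ε : ℝ} {u0 u1 u2 ub : L2x} (hε : 0 < ε) (hM : 0 ≤ M)
    (hL : 0 ≤ L) (hP : 0 ≤ P) (hPM : P ≤ M) (hPL : P ≤ L * |s1|) (hP' : |P'| ≤ M) (hα : |α| ≤ M)
    (h2 : |s2| ≤ M) (h3 : |s3| ≤ M) (h1 : s1 ≠ 0) :
    errorTerm P P' α s1 s2 s3 u0 u1 u2 ≤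
      P * ‖japOp (5 / 4) (s1 • u1 - s2 • u0)‖ ^ 2 + 8 * M ^ 3 * ‖japOp (7 / 4) u1‖ ^ 2
      + 8 * M ^ 5 * (sb⁻¹ ^ 2 * ‖japOp (7 / 4) ub‖ ^ 2)
      + ε * ‖japOp (13 / 8) (s1 • u2 - s3 • u0)‖ ^ 2
      + ((4 * M * L + 2 * M ^ 2 + 2 * M) ^ 2 / (4 * ε) + 4 * M ^ 2 * L) *
        ‖japOp (11 / 8) (s1 • u1 - s2 • u0)‖ ^ 2
      + 4 * M ^ 2 * L * ‖japOp (13 / 8) u0 - (s1 / sb) • japOp (13 / 8) ub‖ ^ 2 := by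
  set W := s1 • u1 - s2 • u0 with hW
  set Wy := s1 • u2 - s3 • u0 with hWy
  set p := ‖japOp (5 / 4) W‖
  set n := ‖japOp (11 / 8) W‖
  set K := ‖japOp (13 / 8) Wy‖
  set x1 := ‖japOp (7 / 4) u1‖
  set A := ‖japOp (7 / 4) (sb⁻¹ • ub)‖ with hA
  set h := u0 - (s1 / sb) • ub with hh
  set H := ‖japOp (13 / 8) h‖ with hH
  have eA : sb⁻¹ ^ 2 * ‖japOp (7 / 4) ub‖ ^ 2 = A ^ 2 := by
    rw [hA, map_smul, norm_smul, mul_pow, Real.norm_eq_abs, sq_abs]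
  have eH : ‖japOp (13 / 8) u0 - (s1 / sb) • japOp (13 / 8) ub‖ = H := by
    rw [hH, hh, map_sub, map_smul]
  rw [eA, eH]
  have i1 : |inner ℝ (japOp (3 / 2) W) (japOp (3 / 2) u1)| ≤ p * x1 :=
    abs_inner_japOp_le (by norm_num) (by norm_num) (by norm_num) (by norm_num) (by norm_num) _ _
  have i2 : |inner ℝ (japOp (3 / 2) W) (japOp (3 / 2) Wy)| ≤ n * K :=
    abs_inner_japOp_le (by norm_num) (by norm_num) (by norm_num) (by norm_num) (by norm_num) _ _
  have i3 : |inner ℝ (japOp (3 / 2) W) (japOp (3 / 2) (sb⁻¹ • ub))| ≤ p * A :=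
    abs_inner_japOp_le (by norm_num) (by norm_num) (by norm_num) (by norm_num) (by norm_num) _ _
  have i4 : |inner ℝ (japOp (3 / 2) W) (japOp (3 / 2) h)| ≤ n * H :=
    abs_inner_japOp_le (by norm_num) (by norm_num) (by norm_num) (by norm_num) (by norm_num) _ _
  set z1 := inner ℝ (japOp (3 / 2) W) (japOp (3 / 2) u1)
  set z2 := inner ℝ (japOp (3 / 2) W) (japOp (3 / 2) Wy)
  set z3 := inner ℝ (japOp (3 / 2) W) (japOp (3 / 2) (sb⁻¹ • ub))
  set z4 := inner ℝ (japOp (3 / 2) W) (japOp (3 / 2) h)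
  -- Solving `Wy = s1 u2 - s3 u0` for `u2` and inserting `u0 = (s1 / sb) ub + h`: the factor `s1` of
  -- the first part cancels the singularity, which survives only in front of `Wy` and `h`.
  have hu2 : u2 = s1⁻¹ • Wy + s3 • (sb⁻¹ • ub) + (s1⁻¹ * s3) • h := by
    have e : u0 = s1 • (sb⁻¹ • ub) + h := by
      rw [hh, smul_smul, div_eq_mul_inv]; abel
    have e' : u2 = s1⁻¹ • (Wy + s3 • u0) := by
      rw [hWy, sub_add_cancel, smul_smul, inv_mul_cancel₀ h1, one_smul]
    rw [e']
    nth_rw 1 [e]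
    simp only [smul_add, smul_smul]
    rw [show s1⁻¹ * (s3 * (s1 * sb⁻¹)) = s3 * sb⁻¹ by field_simp]
    abel
  have e5 : inner ℝ (japOp (3 / 2) W) (japOp (3 / 2) ((2 * s3) • u1 - (2 * s2) • u2)) =
      2 * s3 * z1 - 2 * s2 * (s1⁻¹ * z2 + s3 * z3 + s1⁻¹ * s3 * z4) := by
    have e : inner ℝ (japOp (3 / 2) W) (japOp (3 / 2) u2) =
        s1⁻¹ * z2 + s3 * z3 + s1⁻¹ * s3 * z4 := by
      rw [hu2, map_add, map_add, map_smul, map_smul _ s3, map_smul _ (s1⁻¹ * s3), inner_add_right,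
        inner_add_right, inner_smul_right_eq_smul, inner_smul_right_eq_smul,
        inner_smul_right_eq_smul]
      rfl
    rw [map_sub _ ((2 * s3) • u1), map_smul _ (2 * s3), map_smul _ (2 * s2), inner_sub_right, inner_smul_right_eq_smul,
      inner_smul_right_eq_smul, e]
    rfl
  have hPs : |P * s1⁻¹| ≤ L := by
    rw [abs_mul, abs_of_nonneg hP, abs_inv, ← div_eq_mul_inv, div_le_iff₀ (abs_pos.2 h1)]
    exact hPL
  have he : errorTerm P P' α s1 s2 s3 u0 u1 u2 = 4 * (P * s3 * z1) + 4 * -(s2 * (P * s1⁻¹) * z2)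
      + 4 * -(P * (s2 * s3) * z3) + 4 * -(s2 * (P * s1⁻¹) * s3 * z4)
      + 2 * ((P * α - P') * z2) := by
    rw [errorTerm, ← hW, ← hWy, e5]; ring
  rw [he]
  exact (weighted_products_le hM hP hPM hPs hP' hα h2 h3 i1 i2 i3 i4).trans
    (weighted_products_le_sq hε hL hP hPM)

/-- The hypotheses of the spatial estimate on the interval `[lo, hi]`: `s1` vanishes precisely at
the interior point `a`, to first order, and the weight `P` vanishes there too. -/
structure IsSpatialSetup (M c η lo hi a : ℝ) (s1 s2 s3 P P' : ℝ → ℝ) (U0 U1 U2 : ℝ → L2x) :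
    Prop where
  lo_add_le : lo + η ≤ a
  add_le_hi : a + η ≤ hi
  deriv_s1 : ∀ y ∈ Icc lo hi, HasDerivAt s1 (s2 y) y
  cont_s2 : ContinuousOn s2 (Icc lo hi)
  cont_s3 : ContinuousOn s3 (Icc lo hi)
  abs_s2_le : ∀ y ∈ Icc lo hi, |s2 y| ≤ M
  abs_s3_le : ∀ y ∈ Icc lo hi, |s3 y| ≤ M
  le_abs_s1 : ∀ y ∈ Icc lo hi, c * |y - a| ≤ |s1 y|
  abs_s1_le : ∀ y ∈ Icc lo hi, |s1 y| ≤ M * |y - a|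
  cont_P : ContinuousOn P (Icc lo hi)
  P_nonneg : ∀ y ∈ Icc lo hi, 0 ≤ P y
  P_le : ∀ y ∈ Icc lo hi, P y ≤ M
  P_le_abs : ∀ y ∈ Icc lo hi, P y ≤ M * |y - a|
  meas_P' : Measurable P'
  abs_P'_le : ∀ y ∈ Icc lo hi, |P' y| ≤ M
  deriv_U0 : ∀ y ∈ Icc lo hi, HasDerivAt U0 (U1 y) y
  cont_U1 : ContinuousOn U1 (Icc lo hi)
  cont_U2 : ContinuousOn U2 (Icc lo hi)

section Setup

variable {M c η lo hi a : ℝ} {s1 s2 s3 P P' : ℝ → ℝ} {U0 U1 U2 : ℝ → L2x}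

lemma IsSpatialSetup.cont_s1 (h : IsSpatialSetup M c η lo hi a s1 s2 s3 P P' U0 U1 U2) :
    ContinuousOn s1 (Icc lo hi) := fun y hy => (h.deriv_s1 y hy).continuousAt.continuousWithinAt

lemma IsSpatialSetup.cont_U0 (h : IsSpatialSetup M c η lo hi a s1 s2 s3 P P' U0 U1 U2) :
    ContinuousOn U0 (Icc lo hi) := fun y hy => (h.deriv_U0 y hy).continuousAt.continuousWithinAt

lemma IsSpatialSetup.cont_W (h : IsSpatialSetup M c η lo hi a s1 s2 s3 P P' U0 U1 U2) :
    ContinuousOn (fun y => s1 y • U1 y - s2 y • U0 y) (Icc lo hi) :=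
  (h.cont_s1.smul h.cont_U1).sub (h.cont_s2.smul h.cont_U0)

lemma IsSpatialSetup.cont_Wy (h : IsSpatialSetup M c η lo hi a s1 s2 s3 P P' U0 U1 U2) :
    ContinuousOn (fun y => s1 y • U2 y - s3 y • U0 y) (Icc lo hi) :=
  (h.cont_s1.smul h.cont_U2).sub (h.cont_s3.smul h.cont_U0)

lemma IsSpatialSetup.lo_le (h : IsSpatialSetup M c η lo hi a s1 s2 s3 P P' U0 U1 U2)
    (hη : 0 < η) : lo ≤ hi := by linarith [h.lo_add_le, h.add_le_hi]

lemma japOp_comp_continuousOn {f : ℝ → L2x} {s : Set ℝ} (hf : ContinuousOn f s) (r : ℝ) :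
    ContinuousOn (fun y => japOp r (f y)) s := (japOp r).continuous.comp_continuousOn hf

lemma IsSpatialSetup.intervalIntegrable_errorTerm
    (h : IsSpatialSetup M c η lo hi a s1 s2 s3 P P' U0 U1 U2) (hη : 0 < η) (α : ℝ) :
    IntervalIntegrable (fun y => errorTerm (P y) (P' y) α (s1 y) (s2 y) (s3 y) (U0 y) (U1 y) (U2 y))
      volume lo hi := by
  have hu : uIcc lo hi = Icc lo hi := uIcc_of_le (h.lo_le hη)
  have hV := japOp_comp_continuousOn h.cont_W (3 / 2)
  have hVy := japOp_comp_continuousOn h.cont_Wy (3 / 2)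
  have hX := japOp_comp_continuousOn
    (((h.cont_s3.const_smul (2 : ℝ)).smul h.cont_U1).sub
      ((h.cont_s2.const_smul (2 : ℝ)).smul h.cont_U2)) (3 / 2)
  have hz1 := hV.inner (𝕜 := ℝ) hX
  have hz2 := hV.inner (𝕜 := ℝ) hVy
  have hP := h.cont_P
  refine IntervalIntegrable.sub (ContinuousOn.intervalIntegrable ?_) ?_
  · rw [hu]
    exact hP.mul ((continuousOn_const.mul hz1).add (continuousOn_const.mul hz2))
  · have h1 : IntervalIntegrable P' volume lo hi := by
      rw [intervalIntegrable_iff_integrableOn_Icc_of_le (h.lo_le hη)]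
      exact Measure.integrableOn_of_bounded (M := M) (by simp) h.meas_P'.aestronglyMeasurable
        ((ae_restrict_iff' measurableSet_Icc).2 (ae_of_all _ h.abs_P'_le))
    exact (h1.const_mul 2).mul_continuousOn (by rw [hu]; exact hz2)

/-- The part of the bound for `errorTerm` that does not involve the singular remainder. -/
def regularBound (M L ε B : ℝ) (P s1 s2 s3 : ℝ) (u0 u1 u2 : L2x) : ℝ :=
  P * ‖japOp (5 / 4) (s1 • u1 - s2 • u0)‖ ^ 2 + 8 * M ^ 3 * ‖japOp (7 / 4) u1‖ ^ 2
    + 8 * M ^ 5 * B + ε * ‖japOp (13 / 8) (s1 • u2 - s3 • u0)‖ ^ 2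
    + ((4 * M * L + 2 * M ^ 2 + 2 * M) ^ 2 / (4 * ε) + 4 * M ^ 2 * L) *
      ‖japOp (11 / 8) (s1 • u1 - s2 • u0)‖ ^ 2

lemma IsSpatialSetup.cont_regularBound
    (h : IsSpatialSetup M c η lo hi a s1 s2 s3 P P' U0 U1 U2) (L ε B : ℝ) :
    ContinuousOn (fun y => regularBound M L ε B (P y) (s1 y) (s2 y) (s3 y) (U0 y) (U1 y) (U2 y))
      (Icc lo hi) := by
  have h1 := japOp_comp_continuousOn h.cont_W (5 / 4)
  have h2 := japOp_comp_continuousOn h.cont_W (11 / 8)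
  have h3 := japOp_comp_continuousOn h.cont_Wy (13 / 8)
  have h4 := japOp_comp_continuousOn h.cont_U1 (7 / 4)
  have hP := h.cont_P
  unfold regularBound
  fun_prop

lemma IsSpatialSetup.errorTerm_le_regularBound
    (h : IsSpatialSetup M c η lo hi a s1 s2 s3 P P' U0 U1 U2) (hc : 0 < c) (hM : 0 ≤ M)
    {ε α B b y : ℝ} (hε : 0 < ε) (hα : |α| ≤ M)
    (hB : (s1 b)⁻¹ ^ 2 * ‖japOp (7 / 4) (U0 b)‖ ^ 2 ≤ B) (hy : y ∈ Icc lo hi) (hya : y ≠ a) :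
    errorTerm (P y) (P' y) α (s1 y) (s2 y) (s3 y) (U0 y) (U1 y) (U2 y) ≤
      regularBound M (M / c) ε B (P y) (s1 y) (s2 y) (s3 y) (U0 y) (U1 y) (U2 y) +
        4 * M ^ 2 * (M / c) *
          ‖japOp (13 / 8) (U0 y) - (s1 y / s1 b) • japOp (13 / 8) (U0 b)‖ ^ 2 := by
  have hs1 : s1 y ≠ 0 := by
    intro h0
    have := h.le_abs_s1 y hy
    rw [h0, abs_zero] at this
    exact absurd this (not_le.2 (mul_pos hc (abs_pos.2 (sub_ne_zero.2 hya))))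
  have hPL : P y ≤ M / c * |s1 y| := by
    calc P y ≤ M * |y - a| := h.P_le_abs y hy
      _ = M / c * (c * |y - a|) := by field_simp
      _ ≤ _ := by gcongr; exact h.le_abs_s1 y hy
  refine (errorTerm_le (sb := s1 b) (ub := U0 b) hε hM (by positivity) (h.P_nonneg y hy)
    (h.P_le y hy) hPL (h.abs_P'_le y hy) hα (h.abs_s2_le y hy) (h.abs_s3_le y hy) hs1).trans ?_
  unfold regularBound
  have : 8 * M ^ 5 * ((s1 b)⁻¹ ^ 2 * ‖japOp (7 / 4) (U0 b)‖ ^ 2) ≤ 8 * M ^ 5 * B := by gcongr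
  linarith

/-- The pointwise bound is integrated separately on the two sides of `a`, each with its own end
point as base point, because the Hardy argument cannot cross the zero of `s1`. -/
theorem IsSpatialSetup.integral_errorTerm_le
    (h : IsSpatialSetup M c η lo hi a s1 s2 s3 P P' U0 U1 U2) (hc : 0 < c) (hM : 0 ≤ M)
    (hη : 0 < η) {ε α : ℝ} (hε : 0 < ε) (hα : |α| ≤ M) :
    ∫ y in lo..hi, errorTerm (P y) (P' y) α (s1 y) (s2 y) (s3 y) (U0 y) (U1 y) (U2 y) ≤
      (∫ y in lo..hi, P y * ‖japOp (5 / 4) (s1 y • U1 y - s2 y • U0 y)‖ ^ 2)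
      + 8 * M ^ 3 * (∫ y in lo..hi, ‖japOp (7 / 4) (U1 y)‖ ^ 2)
      + 8 * M ^ 5 * (hi - lo) * ((c * η)⁻¹ ^ 2 * (((hi - lo)⁻¹ + 1) *
        ((∫ y in lo..hi, ‖japOp (7 / 4) (U0 y)‖ ^ 2)
          + ∫ y in lo..hi, ‖japOp (7 / 4) (U1 y)‖ ^ 2)))
      + ε * (∫ y in lo..hi, ‖japOp (13 / 8) (s1 y • U2 y - s3 y • U0 y)‖ ^ 2)
      + ((4 * M * (M / c) + 2 * M ^ 2 + 2 * M) ^ 2 / (4 * ε) + 4 * M ^ 2 * (M / c)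
          + 4 * M ^ 2 * (M / c) * (M ^ 2 / c ^ 4)) *
        (∫ y in lo..hi, ‖japOp (11 / 8) (s1 y • U1 y - s2 y • U0 y)‖ ^ 2) := by
  have hla : lo < a := by linarith [h.lo_add_le]
  have hah : a < hi := by linarith [h.add_le_hi]
  have hlh : lo < hi := hla.trans hah
  have hu : uIcc lo hi = Icc lo hi := uIcc_of_le hlh.le
  have hul : uIcc lo a ⊆ uIcc lo hi := by
    rw [hu, uIcc_of_le hla.le]; exact Icc_subset_Icc_right hah.le
  have hur : uIcc a hi ⊆ uIcc lo hi := by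
    rw [hu, uIcc_of_le hah.le]; exact Icc_subset_Icc_left hla.le
  have hsl : Icc lo a ⊆ Icc lo hi := Icc_subset_Icc_right hah.le
  have hsr : Icc a hi ⊆ Icc lo hi := Icc_subset_Icc_left hla.le
  set B := (c * η)⁻¹ ^ 2 * (((hi - lo)⁻¹ + 1) *
        ((∫ y in lo..hi, ‖japOp (7 / 4) (U0 y)‖ ^ 2)
          + ∫ y in lo..hi, ‖japOp (7 / 4) (U1 y)‖ ^ 2)) with hBdef
  have hUd : ∀ r, ∀ y ∈ Icc lo hi, HasDerivAt (fun y => japOp r (U0 y)) (japOp r (U1 y)) y :=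
    fun r y hy => (japOp r).hasFDerivAt.comp_hasDerivAt y (h.deriv_U0 y hy)
  -- At distance `η` from the zero, `|s1 b| ≥ c η`, and the trace inequality bounds `U0 b`.
  have hB : ∀ b ∈ Icc lo hi, η ≤ |b - a| → (s1 b)⁻¹ ^ 2 * ‖japOp (7 / 4) (U0 b)‖ ^ 2 ≤ B := by
    intro b hb hbη
    have h1 := norm_sq_le_integral hlh hb (hUd (7 / 4)) (japOp_comp_continuousOn h.cont_U1 _)
    have h2 : c * η ≤ |s1 b| := (by gcongr : c * η ≤ c * |b - a|).trans (h.le_abs_s1 b hb)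
    rw [← sq_abs, abs_inv]
    exact mul_le_mul (pow_le_pow_left₀ (by positivity) (inv_anti₀ (by positivity) h2) 2) h1
      (by positivity) (by positivity)
  have hBl := hB lo ⟨le_rfl, hlh.le⟩ (by
    rw [abs_sub_comm, abs_of_pos (by linarith)]; linarith [h.lo_add_le])
  have hBr := hB hi ⟨hlh.le, le_rfl⟩ (by
    rw [abs_of_pos (by linarith)]; linarith [h.add_le_hi])
  have hje := h.intervalIntegrable_errorTerm hη α
  have hreg : IntervalIntegrable (fun y => regularBound M (M / c) ε B (P y) (s1 y) (s2 y) (s3 y)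
      (U0 y) (U1 y) (U2 y)) volume lo hi :=
    ContinuousOn.intervalIntegrable (by rw [hu]; exact h.cont_regularBound _ _ _)
  have hrem : ∀ b, ContinuousOn (fun y =>
      ‖japOp (13 / 8) (U0 y) - (s1 y / s1 b) • japOp (13 / 8) (U0 b)‖ ^ 2) (Icc lo hi) := fun b =>
    ((japOp_comp_continuousOn h.cont_U0 _).sub
      ((h.cont_s1.div_const _).smul continuousOn_const)).norm.pow 2
  have hremi : ∀ b, IntervalIntegrable (fun y => 4 * M ^ 2 * (M / c) *
      ‖japOp (13 / 8) (U0 y) - (s1 y / s1 b) • japOp (13 / 8) (U0 b)‖ ^ 2) volume lo hi := fun b =>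
    (ContinuousOn.intervalIntegrable (by rw [hu]; exact hrem b)).const_mul _
  have hleft := intervalIntegral.integral_mono_on_of_le_Ioo hla.le (hje.mono_set hul)
    ((hreg.mono_set hul).add ((hremi lo).mono_set hul)) fun y hy =>
      h.errorTerm_le_regularBound hc hM hε hα hBl (hsl ⟨hy.1.le, hy.2.le⟩) hy.2.ne
  have hright := intervalIntegral.integral_mono_on_of_le_Ioo hah.le (hje.mono_set hur)
    ((hreg.mono_set hur).add ((hremi hi).mono_set hur)) fun y hy =>
      h.errorTerm_le_regularBound hc hM hε hα hBr (hsr ⟨hy.1.le, hy.2.le⟩) hy.1.ne'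
  rw [intervalIntegral.integral_add (hreg.mono_set hul) ((hremi lo).mono_set hul),
    intervalIntegral.integral_const_mul] at hleft
  rw [intervalIntegral.integral_add (hreg.mono_set hur) ((hremi hi).mono_set hur),
    intervalIntegral.integral_const_mul] at hright
  have hc11 := japOp_comp_continuousOn h.cont_W (11 / 8)
  have hc13 := japOp_comp_continuousOn h.cont_W (13 / 8)
  -- The Hardy remainder is measured in `H^{3/8}`; it is bounded by `w₂` in the same space, hence in
  -- the stronger `H^{5/8}`.
  have hanti : ∀ x y : ℝ, x ≤ y → Icc x y ⊆ Icc lo hi →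
      ∫ y in x..y, ‖japOp (13 / 8) (s1 y • U1 y - s2 y • U0 y)‖ ^ 2 ≤
      ∫ y in x..y, ‖japOp (11 / 8) (s1 y • U1 y - s2 y • U0 y)‖ ^ 2 := by
    intro x y hxy hsub
    refine intervalIntegral.integral_mono_on hxy
      (ContinuousOn.intervalIntegrable (by rw [uIcc_of_le hxy]; exact (hc13.mono hsub).norm.pow 2))
      (ContinuousOn.intervalIntegrable (by rw [uIcc_of_le hxy]; exact (hc11.mono hsub).norm.pow 2))
      fun z _ => ?_
    gcongr
    exact norm_japOp_anti (by norm_num) (by norm_num) _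
  have hHl := integral_remainder_left (M := M) hla hc (fun y hy => h.deriv_s1 y (hsl hy))
    (fun y hy => hUd (13 / 8) y (hsl hy)) (h.cont_s2.mono hsl)
    (japOp_comp_continuousOn (h.cont_U1.mono hsl) _) (fun y hy => h.le_abs_s1 y (hsl hy))
    (fun y hy => h.abs_s1_le y (hsl hy))
  have hHr := integral_remainder_right (M := M) hah hc (fun y hy => h.deriv_s1 y (hsr hy))
    (fun y hy => hUd (13 / 8) y (hsr hy)) (h.cont_s2.mono hsr)
    (japOp_comp_continuousOn (h.cont_U1.mono hsr) _) (fun y hy => h.le_abs_s1 y (hsr hy))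
    (fun y hy => h.abs_s1_le y (hsr hy))
  simp only [← map_smul, ← map_sub] at hHl hHr hleft hright
  replace hHl := hHl.trans (mul_le_mul_of_nonneg_left (hanti lo a hla.le hsl) (by positivity))
  replace hHr := hHr.trans (mul_le_mul_of_nonneg_left (hanti a hi hah.le hsr) (by positivity))
  have hn : IntervalIntegrable (fun y => ‖japOp (11 / 8) (s1 y • U1 y - s2 y • U0 y)‖ ^ 2)
      volume lo hi := ContinuousOn.intervalIntegrable (by rw [hu]; exact hc11.norm.pow 2)
  have hadd1 := intervalIntegral.integral_add_adjacent_intervals (hje.mono_set hul)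
    (hje.mono_set hur)
  have hadd2 := intervalIntegral.integral_add_adjacent_intervals (hreg.mono_set hul)
    (hreg.mono_set hur)
  have hadd3 := intervalIntegral.integral_add_adjacent_intervals (hn.mono_set hul)
    (hn.mono_set hur)
  have hi1 : IntervalIntegrable (fun y => P y * ‖japOp (5 / 4) (s1 y • U1 y - s2 y • U0 y)‖ ^ 2)
      volume lo hi := ContinuousOn.intervalIntegrable (by
        rw [hu]; exact h.cont_P.mul ((japOp_comp_continuousOn h.cont_W _).norm.pow 2))
  have hi2 : IntervalIntegrable (fun y => 8 * M ^ 3 * ‖japOp (7 / 4) (U1 y)‖ ^ 2) volume lo hi :=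
    (ContinuousOn.intervalIntegrable (by
      rw [hu]; exact (japOp_comp_continuousOn h.cont_U1 _).norm.pow 2)).const_mul _
  have hi3 : IntervalIntegrable (fun _ : ℝ => 8 * M ^ 5 * B) volume lo hi :=
    intervalIntegrable_const
  have hi4 : IntervalIntegrable (fun y => ε * ‖japOp (13 / 8) (s1 y • U2 y - s3 y • U0 y)‖ ^ 2)
      volume lo hi := (ContinuousOn.intervalIntegrable (by
        rw [hu]; exact (japOp_comp_continuousOn h.cont_Wy _).norm.pow 2)).const_mul _
  have hregeq : ∫ y in lo..hi, regularBound M (M / c) ε B (P y) (s1 y) (s2 y) (s3 y)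
      (U0 y) (U1 y) (U2 y) =
      (∫ y in lo..hi, P y * ‖japOp (5 / 4) (s1 y • U1 y - s2 y • U0 y)‖ ^ 2)
      + 8 * M ^ 3 * (∫ y in lo..hi, ‖japOp (7 / 4) (U1 y)‖ ^ 2) + (hi - lo) * (8 * M ^ 5 * B)
      + ε * (∫ y in lo..hi, ‖japOp (13 / 8) (s1 y • U2 y - s3 y • U0 y)‖ ^ 2)
      + ((4 * M * (M / c) + 2 * M ^ 2 + 2 * M) ^ 2 / (4 * ε) + 4 * M ^ 2 * (M / c)) *
        (∫ y in lo..hi, ‖japOp (11 / 8) (s1 y • U1 y - s2 y • U0 y)‖ ^ 2) := by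
    unfold regularBound
    rw [intervalIntegral.integral_add (((hi1.add hi2).add hi3).add hi4) (hn.const_mul _),
      intervalIntegral.integral_add ((hi1.add hi2).add hi3) hi4,
      intervalIntegral.integral_add (hi1.add hi2) hi3, intervalIntegral.integral_add hi1 hi2,
      intervalIntegral.integral_const, intervalIntegral.integral_const_mul,
      intervalIntegral.integral_const_mul, intervalIntegral.integral_const_mul, smul_eq_mul]
  have hk : 0 ≤ 4 * M ^ 2 * (M / c) := by positivity
  have m1 := mul_le_mul_of_nonneg_left hHl hk
  have m2 := mul_le_mul_of_nonneg_left hHr hk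
  rw [← hadd1]
  refine (add_le_add hleft hright).trans ?_
  rw [hregeq] at hadd2
  have hfinal : 4 * M ^ 2 * (M / c) * (M ^ 2 / c ^ 4) *
      ((∫ y in lo..a, ‖japOp (11 / 8) (s1 y • U1 y - s2 y • U0 y)‖ ^ 2)
        + ∫ y in a..hi, ‖japOp (11 / 8) (s1 y • U1 y - s2 y • U0 y)‖ ^ 2) =
      4 * M ^ 2 * (M / c) * (M ^ 2 / c ^ 4) *
        ∫ y in lo..hi, ‖japOp (11 / 8) (s1 y • U1 y - s2 y • U0 y)‖ ^ 2 := by rw [hadd3]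
  linarith

end Setup

end

section

/-! ### The energy identity -/

section Lifted

variable (S : ℕ → ℝ → ℝ → ℝ) (U : ℕ → ℝ → ℝ → L2x)

/-- The lift of `w₂`. -/
def liftW (t y : ℝ) : L2x := S 1 t y • U 1 t y - S 2 t y • U 0 t y

/-- The lift of `∂_y w₂`. -/
def liftWy (t y : ℝ) : L2x := S 1 t y • U 2 t y - S 3 t y • U 0 t y

/-- The lift of `∂_y² w₂`. -/
def liftWyy (t y : ℝ) : L2x :=
  (S 1 t y • U 3 t y + S 2 t y • U 2 t y) - (S 3 t y • U 1 t y + S 4 t y • U 0 t y)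

/-- The time derivative of `⟨D⟩^{1/2} (w₂)_Φ` on the Fourier side. -/
def liftD (θ lam t y : ℝ) : L2x :=
  -(lam • japOp (1 - 2 * θ) (liftW S U t y)) - S 0 t y • transportOp (liftW S U t y)
    + japOp (3 / 2) (liftWyy S U t y + ((2 * S 3 t y) • U 1 t y - (2 * S 2 t y) • U 2 t y))

/-- A family `U k`, continuous in `(t, y)`, with `∂_y U k = U (k + 1)`. -/
structure IsLiftedFamily (T : ℝ) : Prop where
  cont : ∀ k, k ≤ 2 → ContinuousOn (fun p : ℝ × ℝ => U k p.1 p.2) (Icc 0 T ×ˢ Ioi 0)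
  cont_three : ContinuousOn (fun p : ℝ × ℝ => U 3 p.1 p.2) (Ioo 0 T ×ˢ Ioi 0)
  deriv : ∀ k, k ≤ 1 → ∀ t ∈ Icc 0 T, ∀ y, 0 < y → HasDerivAt (U k t) (U (k + 1) t y) y
  deriv_two : ∀ t ∈ Ioo 0 T, ∀ y, 0 < y → HasDerivAt (U 2 t) (U 3 t y) y

/-- The Gevrey lifts of the `y`-derivatives of a solution. -/
structure IsLiftedSolution (δ θ lam T : ℝ) : Prop extends IsLiftedFamily U T where
  deriv_time : ∀ t ∈ Ioo 0 T, ∀ y, |y - 1| < 2 * δ →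
    HasDerivAt (fun τ => japOp (3 / 2) (liftW S U τ y)) (liftD S U θ lam t y) t

end Lifted

/-- Needed for `m = P` and `m = P'`; the latter is only bounded and measurable, so the time variable
must sit in `g` alone. -/
lemma continuousOn_integral_mul {T b₁ b₂ M : ℝ} (hb : b₁ ≤ b₂) {m : ℝ → ℝ} (hm : Measurable m)
    (hM : ∀ z, |m z| ≤ M) {g : ℝ → ℝ → ℝ}
    (hg : ContinuousOn (fun p : ℝ × ℝ => g p.1 p.2) (Icc 0 T ×ˢ Icc b₁ b₂)) :
    ContinuousOn (fun t => ∫ z in b₁..b₂, m z * g t z) (Icc 0 T) := by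
  obtain ⟨C, hC⟩ := (isCompact_Icc.prod isCompact_Icc).exists_bound_of_continuousOn hg
  have hM0 : 0 ≤ M := (abs_nonneg _).trans (hM 0)
  intro t ht
  have hgt : ∀ t ∈ Icc 0 T, ContinuousOn (g t) (Icc b₁ b₂) := fun t ht =>
    hg.comp (f := fun z => (t, z)) (by fun_prop) fun z hz => ⟨ht, hz⟩
  refine intervalIntegral.continuousWithinAt_of_dominated_interval (bound := fun _ => M * C)
    ?_ ?_ intervalIntegrable_const ?_
  · filter_upwards [self_mem_nhdsWithin] with τ hτ
    rw [uIoc_of_le hb]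
    exact hm.aestronglyMeasurable.mul
      (((hgt τ hτ).mono Ioc_subset_Icc_self).aestronglyMeasurable measurableSet_Ioc)
  · filter_upwards [self_mem_nhdsWithin] with τ hτ
    refine ae_of_all _ fun z hz => ?_
    rw [uIoc_of_le hb] at hz
    rw [norm_mul]
    exact mul_le_mul (hM z) (hC (τ, z) ⟨hτ, Ioc_subset_Icc_self hz⟩) (norm_nonneg _) hM0
  · refine ae_of_all _ fun z hz => ?_
    rw [uIoc_of_le hb] at hz
    refine continuousWithinAt_const.mul ?_
    exact (hg (t, z) ⟨ht, Ioc_subset_Icc_self hz⟩).comp (f := fun t => (t, z))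
      (by fun_prop) fun τ hτ => ⟨hτ, Ioc_subset_Icc_self hz⟩

lemma hasDerivWithinAt_Icc_of_Ioo {T : ℝ} (hT : 0 < T) {f f' : ℝ → ℝ}
    (hf : ContinuousOn f (Icc 0 T)) (hf' : ContinuousOn f' (Icc 0 T))
    (hd : ∀ t ∈ Ioo 0 T, HasDerivAt f (f' t) t) {t : ℝ} (ht : t ∈ Icc 0 T) :
    HasDerivWithinAt f (f' t) (Icc 0 T) t := by
  have hdiff : DifferentiableOn ℝ f (Ioo 0 T) := fun x hx =>
    (hd x hx).differentiableAt.differentiableWithinAt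
  rcases ht.1.eq_or_lt with rfl | h0
  · refine (hasDerivWithinAt_Ici_of_tendsto_deriv hdiff
      ((hf 0 ht).mono Ioo_subset_Icc_self) (Ioo_mem_nhdsGT hT) ?_).mono Icc_subset_Ici_self
    have h1 : Tendsto f' (𝓝[Ioo 0 T] 0) (𝓝 (f' 0)) :=
      (hf' 0 ht).mono_left (nhdsWithin_mono _ Ioo_subset_Icc_self)
    rw [nhdsWithin_Ioo_eq_nhdsGT hT] at h1
    refine h1.congr' ?_
    filter_upwards [Ioo_mem_nhdsGT hT] with x hx
    exact (hd x hx).deriv.symm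
  rcases ht.2.eq_or_lt with rfl | h1
  · refine (hasDerivWithinAt_Iic_of_tendsto_deriv hdiff
      ((hf t ht).mono Ioo_subset_Icc_self) (Ioo_mem_nhdsLT hT) ?_).mono Icc_subset_Iic_self
    have h1 : Tendsto f' (𝓝[Ioo 0 t] t) (𝓝 (f' t)) :=
      (hf' t ht).mono_left (nhdsWithin_mono _ Ioo_subset_Icc_self)
    rw [nhdsWithin_Ioo_eq_nhdsLT hT] at h1
    refine h1.congr' ?_
    filter_upwards [Ioo_mem_nhdsLT hT] with x hx
    exact (hd x hx).deriv.symm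
  · exact (hd t ⟨h0, h1⟩).hasDerivWithinAt

/-- Integration by parts against a Lipschitz weight that vanishes at the end points. -/
lemma integral_mul_deriv_of_lipschitz {K : ℝ≥0} {P : ℝ → ℝ} (hP : LipschitzWith K P) {b₁ b₂ : ℝ}
    (hb : b₁ ≤ b₂) (h1 : P b₁ = 0) (h2 : P b₂ = 0) {q q' : ℝ → ℝ}
    (hq : ∀ z ∈ Icc b₁ b₂, HasDerivAt q (q' z) z) (hq' : ContinuousOn q' (Icc b₁ b₂)) :
    ∫ z in b₁..b₂, P z * q' z = -∫ z in b₁..b₂, deriv P z * q z := by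
  have hu : uIcc b₁ b₂ = Icc b₁ b₂ := uIcc_of_le hb
  obtain ⟨C, hC⟩ := isCompact_Icc.exists_bound_of_continuousOn hq'
  have hqL : LipschitzOnWith C.toNNReal q (uIcc b₁ b₂) := by
    rw [hu]
    refine (convex_Icc b₁ b₂).lipschitzOnWith_of_nnnorm_hasDerivWithin_le
      (fun z hz => (hq z hz).hasDerivWithinAt) fun z hz => ?_
    rw [← NNReal.coe_le_coe, coe_nnnorm]
    exact (hC z hz).trans (Real.le_coe_toNNReal C)
  have key := AbsolutelyContinuousOnInterval.integral_mul_deriv_eq_deriv_mul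
    (hP.lipschitzOnWith.absolutelyContinuousOnInterval (a := b₁) (b := b₂))
    hqL.absolutelyContinuousOnInterval
  rw [h1, h2, zero_mul, zero_mul, sub_zero, zero_sub] at key
  rw [← key]
  refine intervalIntegral.integral_congr fun z hz => ?_
  rw [hu] at hz
  simp only [(hq z hz).deriv]

section Energy

variable {us0 : ℝ → ℝ} {c δ θ lam T : ℝ} {a P : ℝ → ℝ} {U : ℕ → ℝ → ℝ → L2x}

/-- The energy `‖(w₂)_Φ φ^{(1+θ₁)/2}‖²_{H^{1/2,0}}` in the frame of the critical point. -/
def energy (S : ℕ → ℝ → ℝ → ℝ) (U : ℕ → ℝ → ℝ → L2x) (a P : ℝ → ℝ) (t : ℝ) : ℝ :=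
  ∫ z in (-(1 / 2) : ℝ)..(1 / 2), P z * ‖japOp (3 / 2) (liftW S U t (z + a t))‖ ^ 2

/-- The integrand of the rate of change of the energy, at the point `y`. -/
def energyDensity (S : ℕ → ℝ → ℝ → ℝ) (U : ℕ → ℝ → ℝ → L2x) (θ lam α P P' t y : ℝ) : ℝ :=
  -(2 * lam) * (P * ‖japOp (5 / 4 - θ) (liftW S U t y)‖ ^ 2)
    - 2 * (P * ‖japOp (3 / 2) (liftWy S U t y)‖ ^ 2)
    + errorTerm P P' α (S 1 t y) (S 2 t y) (S 3 t y) (U 0 t y) (U 1 t y) (U 2 t y)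

/-- The rate of change of the energy. -/
def energyRate (us0 : ℝ → ℝ) (U : ℕ → ℝ → ℝ → L2x) (θ lam : ℝ) (a P : ℝ → ℝ) (t : ℝ) : ℝ :=
  ∫ z in (-(1 / 2) : ℝ)..(1 / 2),
    energyDensity (shearHeat us0) U θ lam (criticalSpeed us0 a t) (P z) (deriv P z) t (z + a t)

lemma IsLiftedFamily.continuousOn_liftW (hU : IsLiftedFamily U T)
    (h : IsShearData us0 c) :
    ContinuousOn (fun p : ℝ × ℝ => liftW (shearHeat us0) U p.1 p.2) (Icc 0 T ×ˢ Ioi 0) :=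
  ((h.continuous_shearHeat (by omega)).continuousOn.smul (hU.cont 1 (by omega))).sub
    ((h.continuous_shearHeat (by omega)).continuousOn.smul (hU.cont 0 (by omega)))

lemma IsLiftedFamily.continuousOn_liftWy (hU : IsLiftedFamily U T)
    (h : IsShearData us0 c) :
    ContinuousOn (fun p : ℝ × ℝ => liftWy (shearHeat us0) U p.1 p.2) (Icc 0 T ×ˢ Ioi 0) :=
  ((h.continuous_shearHeat (by omega)).continuousOn.smul (hU.cont 2 (by omega))).sub
    ((h.continuous_shearHeat (by omega)).continuousOn.smul (hU.cont 0 (by omega)))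

lemma IsLiftedFamily.continuousOn_liftWyy (hU : IsLiftedFamily U T)
    (h : IsShearData us0 c) :
    ContinuousOn (fun p : ℝ × ℝ => liftWyy (shearHeat us0) U p.1 p.2) (Ioo 0 T ×ˢ Ioi 0) := by
  have hsub : (Ioo 0 T ×ˢ Ioi 0 : Set (ℝ × ℝ)) ⊆ Icc 0 T ×ˢ Ioi 0 :=
    prod_mono Ioo_subset_Icc_self le_rfl
  have hS4 : ContinuousOn (fun p : ℝ × ℝ => shearHeat us0 4 p.1 p.2) (Ioo 0 T ×ˢ Ioi 0) :=
    h.isC3Tower.continuousOn_heat_four.mono (prod_mono (fun t ht => ht.1) (subset_univ _))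
  exact (((h.continuous_shearHeat (by omega)).continuousOn.smul hU.cont_three).add
    ((h.continuous_shearHeat (by omega)).continuousOn.smul
      ((hU.cont 2 (by omega)).mono hsub))).sub
    (((h.continuous_shearHeat (by omega)).continuousOn.smul ((hU.cont 1 (by omega)).mono hsub)).add
      (hS4.smul ((hU.cont 0 (by omega)).mono hsub)))

lemma IsLiftedFamily.continuousOn_liftD (hU : IsLiftedFamily U T)
    (h : IsShearData us0 c) :
    ContinuousOn (fun p : ℝ × ℝ => liftD (shearHeat us0) U θ lam p.1 p.2)
      (Ioo 0 T ×ˢ Ioi 0) := by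
  have hsub : (Ioo 0 T ×ˢ Ioi 0 : Set (ℝ × ℝ)) ⊆ Icc 0 T ×ˢ Ioi 0 :=
    prod_mono Ioo_subset_Icc_self le_rfl
  have hW := (hU.continuousOn_liftW h).mono hsub
  have hS : ∀ k, k ≤ 3 → ContinuousOn (fun p : ℝ × ℝ => shearHeat us0 k p.1 p.2)
    (Ioo 0 T ×ˢ Ioi 0) := fun k hk => (h.continuous_shearHeat hk).continuousOn
  refine ((((japOp (1 - 2 * θ)).continuous.comp_continuousOn hW).const_smul lam).neg.sub
    ((hS 0 (by omega)).smul (continuous_transportOp.comp_continuousOn hW))).add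
    ((japOp (3 / 2)).continuous.comp_continuousOn ((hU.continuousOn_liftWyy h).add
      (((continuousOn_const.mul (hS 3 (by omega))).smul ((hU.cont 1 (by omega)).mono hsub)).sub
      ((continuousOn_const.mul (hS 2 (by omega))).smul ((hU.cont 2 (by omega)).mono hsub)))))

lemma IsShearData.hasDerivAt_liftW (h : IsShearData us0 c) {t y : ℝ}
    (h0 : HasDerivAt (U 0 t) (U 1 t y) y) (h1 : HasDerivAt (U 1 t) (U 2 t y) y) :
    HasDerivAt (liftW (shearHeat us0) U t) (liftWy (shearHeat us0) U t y) y := by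
  refine (((h.hasDerivAt_shearHeat (k := 1) (by omega) t y).smul h1).sub
    ((h.hasDerivAt_shearHeat (k := 2) (by omega) t y).smul h0)).congr_deriv ?_
  simp only [liftWy, Nat.reduceAdd]
  module

lemma IsShearData.hasDerivAt_liftWy (h : IsShearData us0 c) {t y : ℝ} (ht : 0 < t)
    (h0 : HasDerivAt (U 0 t) (U 1 t y) y) (h2 : HasDerivAt (U 2 t) (U 3 t y) y) :
    HasDerivAt (liftWy (shearHeat us0) U t) (liftWyy (shearHeat us0) U t y) y :=
  ((h.hasDerivAt_shearHeat (k := 1) (by omega) t y).smul h2).sub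
    ((h.isC3Tower.hasDerivAt_heat_three ht y).smul h0)

lemma IsLiftedFamily.hasDerivAt_liftW (hU : IsLiftedFamily U T)
    (h : IsShearData us0 c) {t y : ℝ} (ht : t ∈ Icc 0 T) (hy : 0 < y) :
    HasDerivAt (liftW (shearHeat us0) U t) (liftWy (shearHeat us0) U t y) y :=
  h.hasDerivAt_liftW (hU.deriv 0 (by omega) t ht y hy) (hU.deriv 1 (by omega) t ht y hy)

lemma IsLiftedFamily.hasDerivAt_liftWy (hU : IsLiftedFamily U T)
    (h : IsShearData us0 c) {t y : ℝ} (ht : t ∈ Ioo 0 T) (hy : 0 < y) :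
    HasDerivAt (liftWy (shearHeat us0) U t) (liftWyy (shearHeat us0) U t y) y :=
  h.hasDerivAt_liftWy ht.1 (hU.deriv 0 (by omega) t (Ioo_subset_Icc_self ht) y hy)
    (hU.deriv_two t ht y hy)

/-- The hypotheses on the critical point and the weight used in the energy identity. -/
structure IsEnergySetup (us0 : ℝ → ℝ) (δ T : ℝ) (a P : ℝ → ℝ) (K : ℝ≥0) : Prop where
  δ_le : δ ≤ 1 / 8
  cont_a : ContinuousOn a (Icc 0 T)
  abs_a_lt : ∀ t ∈ Icc 0 T, |a t - 1| < δ
  cont_speed : ContinuousOn (criticalSpeed us0 a) (Icc 0 T)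
  deriv_a : ∀ t ∈ Ioo 0 T, HasDerivAt a (criticalSpeed us0 a t) t
  lipschitz : LipschitzWith K P
  support : ∀ z, P z ≠ 0 → ∀ t ∈ Icc 0 T, |z + a t - 1| < 2 * δ

variable {K : ℝ≥0}

lemma IsEnergySetup.add_pos (hs : IsEnergySetup us0 δ T a P K) {t z : ℝ} (ht : t ∈ Icc 0 T)
    (hz : z ∈ Icc (-(1 / 2) : ℝ) (1 / 2)) : 0 < z + a t := by
  have := abs_lt.1 (hs.abs_a_lt t ht)
  linarith [hz.1, hs.δ_le]

lemma IsEnergySetup.comp_continuousOn {E : Type*} [TopologicalSpace E] {f : ℝ × ℝ → E}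
    (hs : IsEnergySetup us0 δ T a P K) {J : Set ℝ} (hJ : J ⊆ Icc 0 T)
    (hf : ContinuousOn f (J ×ˢ Ioi 0)) :
    ContinuousOn (fun p : ℝ × ℝ => f (p.1, p.2 + a p.1)) (J ×ˢ Icc (-(1 / 2)) (1 / 2)) := by
  refine hf.comp (f := fun p : ℝ × ℝ => (p.1, p.2 + a p.1)) ?_ fun p hp =>
    ⟨hp.1, hs.add_pos (hJ hp.1) hp.2⟩
  have := (hs.cont_a.mono hJ).comp (continuousOn_fst (s := J ×ˢ Icc (-(1 / 2) : ℝ) (1 / 2)))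
    fun p hp => hp.1
  exact continuousOn_fst.prodMk (continuousOn_snd.add this)

/-- In the moving frame the support lies in `|z| < 3δ ≤ 3/8`, so one fixed interval `[-1/2, 1/2]`
serves all times and `P` vanishes at its ends. -/
lemma IsEnergySetup.weight_eq_zero (hs : IsEnergySetup us0 δ T a P K) (hT : 0 ≤ T) {z : ℝ}
    (hz : 1 / 2 ≤ |z|) : P z = 0 := by
  by_contra hP
  have h0 : (0 : ℝ) ∈ Icc 0 T := ⟨le_rfl, hT⟩
  have h1 := abs_lt.1 (hs.support z hP 0 h0)
  have h2 := abs_lt.1 (hs.abs_a_lt 0 h0)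
  have := hs.δ_le
  rcases le_abs.1 hz with h | h <;> linarith

lemma IsEnergySetup.abs_weight_le (hs : IsEnergySetup us0 δ T a P K) (hT : 0 ≤ T) (z : ℝ) :
    |P z| ≤ K := by
  rcases le_or_gt (1 / 2) |z| with hz | hz
  · rw [hs.weight_eq_zero hT hz, abs_zero]; exact K.2
  · have h1 := hs.lipschitz.dist_le_mul z (1 / 2)
    rw [Real.dist_eq, Real.dist_eq, hs.weight_eq_zero hT (z := 1 / 2) (by norm_num [abs_of_pos]),
      sub_zero] at h1
    have h2 : |z - 1 / 2| ≤ 1 := by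
      have := abs_lt.1 hz
      exact abs_le.2 ⟨by linarith, by linarith⟩
    calc |P z| ≤ K * |z - 1 / 2| := h1
      _ ≤ K * 1 := by gcongr
      _ = K := mul_one _

lemma abs_deriv_le_of_lipschitz (hP : LipschitzWith K P) (z : ℝ) : |deriv P z| ≤ K :=
  norm_deriv_le_of_lipschitz hP

lemma IsEnergySetup.continuousOn_energy (hs : IsEnergySetup us0 δ T a P K) (hT : 0 ≤ T)
    (hU : IsLiftedSolution (shearHeat us0) U δ θ lam T) (h : IsShearData us0 c) :
    ContinuousOn (energy (shearHeat us0) U a P) (Icc 0 T) :=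
  continuousOn_integral_mul (by norm_num) hs.lipschitz.continuous.measurable (hs.abs_weight_le hT)
    (g := fun t z => ‖japOp (3 / 2) (liftW (shearHeat us0) U t (z + a t))‖ ^ 2)
    ((hs.comp_continuousOn le_rfl ((japOp (3 / 2)).continuous.comp_continuousOn
      (hU.continuousOn_liftW h))).norm.pow 2)

end Energy

end

/-! ### Time derivative of the energy, up to the end points of `[0, T]` -/

section

section EnergyDerivative

variable {us0 : ℝ → ℝ} {c δ θ lam T : ℝ} {a P : ℝ → ℝ} {U : ℕ → ℝ → ℝ → L2x} {K : ℝ≥0}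

/-- The velocity of `⟨D⟩^{1/2} (w₂)_Φ` in the frame of the critical point. -/
def liftVelocity (us0 : ℝ → ℝ) (U : ℕ → ℝ → ℝ → L2x) (θ lam : ℝ) (a : ℝ → ℝ) (t z : ℝ) : L2x :=
  liftD (shearHeat us0) U θ lam t (z + a t)
    + criticalSpeed us0 a t • japOp (3 / 2) (liftWy (shearHeat us0) U t (z + a t))

/-- The chain rule along `τ ↦ (τ, z + a τ)` needs joint differentiability, supplied by continuity of
both partial derivatives near the point. -/
lemma IsEnergySetup.hasDerivAt_japOp_liftW (hs : IsEnergySetup us0 δ T a P K)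
    (hU : IsLiftedSolution (shearHeat us0) U δ θ lam T) (h : IsShearData us0 c) {t z : ℝ}
    (ht : t ∈ Ioo 0 T) (hz : |z + a t - 1| < 2 * δ) :
    HasDerivAt (fun τ => japOp (3 / 2) (liftW (shearHeat us0) U τ (z + a τ)))
      (liftVelocity us0 U θ lam a t z) t := by
  have hpos : 0 < z + a t := by linarith [(abs_lt.1 hz).1, hs.δ_le]
  have hsub : (Ioo 0 T ×ˢ Ioi 0 : Set (ℝ × ℝ)) ⊆ Icc 0 T ×ˢ Ioi 0 :=
    prod_mono Ioo_subset_Icc_self le_rfl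
  have hnhds : (Ioo 0 T ×ˢ Ioi 0 : Set (ℝ × ℝ)) ∈ 𝓝 (t, z + a t) :=
    prod_mem_nhds (Ioo_mem_nhds ht.1 ht.2) (Ioi_mem_nhds hpos)
  have hnear : ∀ᶠ p : ℝ × ℝ in 𝓝 (t, z + a t), |p.2 - 1| < 2 * δ :=
    (isOpen_lt (by fun_prop : Continuous fun p : ℝ × ℝ => |p.2 - 1|)
      continuous_const).mem_nhds hz
  have hF : HasStrictFDerivAt (fun p : ℝ × ℝ => japOp (3 / 2) (liftW (shearHeat us0) U p.1 p.2))
      _ (t, z + a t) :=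
    hasStrictFDerivAt_of_partials
      (f := fun t y => japOp (3 / 2) (liftW (shearHeat us0) U t y))
      (f₁ := liftD (shearHeat us0) U θ lam)
      (f₂ := fun t y => japOp (3 / 2) (liftWy (shearHeat us0) U t y))
      (by filter_upwards [hnhds, hnear] with p hp hp' using hU.deriv_time p.1 hp.1 p.2 hp')
      (by
        filter_upwards [hnhds] with p hp
        exact (japOp (3 / 2)).hasFDerivAt.comp_hasDerivAt p.2
          (hU.hasDerivAt_liftW h (Ioo_subset_Icc_self hp.1) hp.2))
      ((hU.continuousOn_liftD h).continuousAt hnhds)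
      (((japOp (3 / 2)).continuous.comp_continuousOn
        ((hU.continuousOn_liftWy h).mono hsub)).continuousAt hnhds)
  have hcurve : HasDerivAt (fun τ => (τ, z + a τ)) (1, criticalSpeed us0 a t) t :=
    (hasDerivAt_id t).prodMk ((hs.deriv_a t ht).const_add z)
  refine (hF.hasFDerivAt.comp_hasDerivAt t hcurve).congr_deriv ?_
  simp [liftVelocity]

lemma IsEnergySetup.continuousOn_liftVelocity (hs : IsEnergySetup us0 δ T a P K)
    (hU : IsLiftedSolution (shearHeat us0) U δ θ lam T) (h : IsShearData us0 c) :
    ContinuousOn (fun p : ℝ × ℝ => liftVelocity us0 U θ lam a p.1 p.2)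
      (Ioo 0 T ×ˢ Icc (-(1 / 2)) (1 / 2)) := by
  have hsp : ContinuousOn (fun p : ℝ × ℝ => criticalSpeed us0 a p.1)
      (Ioo 0 T ×ˢ Icc (-(1 / 2)) (1 / 2)) :=
    hs.cont_speed.comp continuousOn_fst fun p hp => Ioo_subset_Icc_self hp.1
  exact (hs.comp_continuousOn Ioo_subset_Icc_self (hU.continuousOn_liftD h)).add
    (hsp.smul ((japOp (3 / 2)).continuous.comp_continuousOn
      (hs.comp_continuousOn Ioo_subset_Icc_self ((hU.continuousOn_liftWy h).mono
        (prod_mono Ioo_subset_Icc_self le_rfl)))))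

/-- The integrand of the derivative of the energy, before integration by parts. -/
def energyIntegrand (us0 : ℝ → ℝ) (U : ℕ → ℝ → ℝ → L2x) (θ lam : ℝ) (a : ℝ → ℝ) (t z : ℝ) : ℝ :=
  2 * inner ℝ (japOp (3 / 2) (liftW (shearHeat us0) U t (z + a t)))
    (liftVelocity us0 U θ lam a t z)

lemma IsEnergySetup.continuousOn_energyIntegrand (hs : IsEnergySetup us0 δ T a P K)
    (hU : IsLiftedSolution (shearHeat us0) U δ θ lam T) (h : IsShearData us0 c) :
    ContinuousOn (fun p : ℝ × ℝ => energyIntegrand us0 U θ lam a p.1 p.2)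
      (Ioo 0 T ×ˢ Icc (-(1 / 2)) (1 / 2)) :=
  continuousOn_const.mul (((japOp (3 / 2)).continuous.comp_continuousOn
    (hs.comp_continuousOn Ioo_subset_Icc_self ((hU.continuousOn_liftW h).mono
      (prod_mono Ioo_subset_Icc_self le_rfl)))).inner (hs.continuousOn_liftVelocity hU h))

lemma IsEnergySetup.hasDerivAt_energy (hs : IsEnergySetup us0 δ T a P K)
    (hU : IsLiftedSolution (shearHeat us0) U δ θ lam T) (h : IsShearData us0 c) {t : ℝ}
    (ht : t ∈ Ioo 0 T) :
    HasDerivAt (energy (shearHeat us0) U a P)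
      (∫ z in (-(1 / 2) : ℝ)..(1 / 2), P z * energyIntegrand us0 U θ lam a t z) t := by
  have hT : 0 ≤ T := ht.1.le.trans ht.2.le
  have hb : (-(1 / 2) : ℝ) ≤ 1 / 2 := by norm_num
  obtain ⟨t₁, h1, h1'⟩ := exists_between ht.1
  obtain ⟨t₂, h2, h2'⟩ := exists_between ht.2
  have hsub : Icc t₁ t₂ ⊆ Ioo 0 T := fun τ hτ => ⟨h1.trans_le hτ.1, hτ.2.trans_lt h2'⟩
  obtain ⟨C, hC⟩ := (isCompact_Icc.prod isCompact_Icc).exists_bound_of_continuousOn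
    ((hs.continuousOn_energyIntegrand hU h).mono (prod_mono hsub le_rfl))
  have hPc : Continuous P := hs.lipschitz.continuous
  have hcont : ∀ τ ∈ Icc 0 T, ContinuousOn
      (fun z => P z * ‖japOp (3 / 2) (liftW (shearHeat us0) U τ (z + a τ))‖ ^ 2)
      (Icc (-(1 / 2)) (1 / 2)) := fun τ hτ =>
    hPc.continuousOn.mul (((hs.comp_continuousOn le_rfl
      ((japOp (3 / 2)).continuous.comp_continuousOn (hU.continuousOn_liftW h))).comp
      (f := fun z => (τ, z)) (by fun_prop) fun z hz => ⟨hτ, hz⟩).norm.pow 2)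
  have hcont' : ContinuousOn (fun z => P z * energyIntegrand us0 U θ lam a t z)
      (Icc (-(1 / 2)) (1 / 2)) :=
    hPc.continuousOn.mul ((hs.continuousOn_energyIntegrand hU h).comp
      (f := fun z => (t, z)) (by fun_prop) fun z hz => ⟨ht, hz⟩)
  refine (intervalIntegral.hasDerivAt_integral_of_dominated_loc_of_deriv_le
    (F := fun τ z => P z * ‖japOp (3 / 2) (liftW (shearHeat us0) U τ (z + a τ))‖ ^ 2)
    (F' := fun τ z => P z * energyIntegrand us0 U θ lam a τ z)
    (s := Icc t₁ t₂) (bound := fun _ => K * C) (Icc_mem_nhds h1' h2) ?_ ?_ ?_ ?_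
    intervalIntegrable_const ?_).2
  · filter_upwards [Icc_mem_nhds h1' h2] with τ hτ
    rw [uIoc_of_le hb]
    exact ((hcont τ (Ioo_subset_Icc_self (hsub hτ))).mono
      Ioc_subset_Icc_self).aestronglyMeasurable measurableSet_Ioc
  · exact (hcont t (Ioo_subset_Icc_self ht)).intervalIntegrable_of_Icc hb
  · rw [uIoc_of_le hb]
    exact (hcont'.mono Ioc_subset_Icc_self).aestronglyMeasurable measurableSet_Ioc
  · refine ae_of_all _ fun z hz τ hτ => ?_
    rw [uIoc_of_le hb] at hz
    rw [norm_mul]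
    exact mul_le_mul (hs.abs_weight_le hT z) (hC (τ, z) ⟨hτ, Ioc_subset_Icc_self hz⟩)
      (norm_nonneg _) K.2
  · refine ae_of_all _ fun z _ τ hτ => ?_
    -- The time derivative of the lift is available only for `|y - 1| < 2δ`, where the cut-off
    -- equals one; elsewhere the weight kills the integrand for all times.
    by_cases hP : P z = 0
    · simp only [hP, zero_mul]
      exact hasDerivAt_const _ _
    · exact ((hs.hasDerivAt_japOp_liftW hU h (hsub hτ)
        (hs.support z hP τ (Ioo_subset_Icc_self (hsub hτ)))).norm_sq).const_mul (P z)

/-- The order `5/4 - θ` is half of `3/2 + (1 - 2θ)` and corresponds to `H^{3/4+θ}`: this is the gain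
from the shrinking Gevrey radius. -/
lemma two_mul_inner_liftVelocity (hθ : θ ≤ 1 / 2) (t z : ℝ) :
    energyIntegrand us0 U θ lam a t z =
      -(2 * lam) * ‖japOp (5 / 4 - θ) (liftW (shearHeat us0) U t (z + a t))‖ ^ 2
      + 2 * inner ℝ (japOp (3 / 2) (liftW (shearHeat us0) U t (z + a t)))
          (japOp (3 / 2) (liftWyy (shearHeat us0) U t (z + a t)))
      + (2 * inner ℝ (japOp (3 / 2) (liftW (shearHeat us0) U t (z + a t)))
          (japOp (3 / 2) ((2 * shearHeat us0 3 t (z + a t)) • U 1 t (z + a t)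
            - (2 * shearHeat us0 2 t (z + a t)) • U 2 t (z + a t)))
        + 2 * criticalSpeed us0 a t *
          inner ℝ (japOp (3 / 2) (liftW (shearHeat us0) U t (z + a t)))
          (japOp (3 / 2) (liftWy (shearHeat us0) U t (z + a t)))) := by
  have e : inner ℝ (japOp (3 / 2) (liftW (shearHeat us0) U t (z + a t)))
      (japOp (1 - 2 * θ) (liftW (shearHeat us0) U t (z + a t))) =
      ‖japOp (5 / 4 - θ) (liftW (shearHeat us0) U t (z + a t))‖ ^ 2 := by
    rw [inner_japOp (a' := 5 / 4 - θ) (b' := 5 / 4 - θ) (by norm_num) (by linarith)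
      (by linarith) (by linarith) (by ring), real_inner_self_eq_norm_sq]
  rw [energyIntegrand, liftVelocity, liftD, map_add (japOp (3 / 2))]
  simp only [inner_add_right, inner_sub_right, inner_neg_right, inner_smul_right,
    inner_japOp_transportOp, e, mul_zero]
  ring

/-- The energy identity. -/
lemma IsEnergySetup.integral_energyIntegrand (hs : IsEnergySetup us0 δ T a P K) (hθ : θ ≤ 1 / 2)
    (hU : IsLiftedSolution (shearHeat us0) U δ θ lam T) (h : IsShearData us0 c) {t : ℝ}
    (ht : t ∈ Ioo 0 T) :
    ∫ z in (-(1 / 2) : ℝ)..(1 / 2), P z * energyIntegrand us0 U θ lam a t z =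
      energyRate us0 U θ lam a P t := by
  have hT : 0 ≤ T := ht.1.le.trans ht.2.le
  have hb : (-(1 / 2) : ℝ) ≤ 1 / 2 := by norm_num
  have ht' := Ioo_subset_Icc_self ht
  set V : ℝ → L2x := fun z => japOp (3 / 2) (liftW (shearHeat us0) U t (z + a t)) with hV
  set Vy : ℝ → L2x := fun z => japOp (3 / 2) (liftWy (shearHeat us0) U t (z + a t)) with hVy
  set Vyy : ℝ → L2x := fun z => japOp (3 / 2) (liftWyy (shearHeat us0) U t (z + a t)) with hVyy
  have dV : ∀ z ∈ Icc (-(1 / 2) : ℝ) (1 / 2), HasDerivAt V (Vy z) z := fun z hz =>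
    (japOp (3 / 2)).hasFDerivAt.comp_hasDerivAt z
      ((hU.hasDerivAt_liftW h ht' (hs.add_pos ht' hz)).comp_add_const z (a t))
  have dVy : ∀ z ∈ Icc (-(1 / 2) : ℝ) (1 / 2), HasDerivAt Vy (Vyy z) z := fun z hz =>
    (japOp (3 / 2)).hasFDerivAt.comp_hasDerivAt z
      ((hU.hasDerivAt_liftWy h ht (hs.add_pos ht' hz)).comp_add_const z (a t))
  have cV : ContinuousOn V (Icc (-(1 / 2)) (1 / 2)) := fun z hz =>
    (dV z hz).continuousAt.continuousWithinAt
  have cVy : ContinuousOn Vy (Icc (-(1 / 2)) (1 / 2)) := fun z hz =>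
    (dVy z hz).continuousAt.continuousWithinAt
  have cVyy : ContinuousOn Vyy (Icc (-(1 / 2)) (1 / 2)) :=
    (hs.comp_continuousOn Ioo_subset_Icc_self ((japOp (3 / 2)).continuous.comp_continuousOn
      (hU.continuousOn_liftWyy h))).comp (f := fun z => (t, z)) (by fun_prop)
      fun z hz => ⟨ht, hz⟩
  have cI : ContinuousOn (fun z => energyIntegrand us0 U θ lam a t z) (Icc (-(1 / 2)) (1 / 2)) :=
    (hs.continuousOn_energyIntegrand hU h).comp (f := fun z => (t, z)) (by fun_prop)
      fun z hz => ⟨ht, hz⟩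
  set q : ℝ → ℝ := fun z => inner ℝ (V z) (Vy z) with hq
  set q' : ℝ → ℝ := fun z => inner ℝ (V z) (Vyy z) + inner ℝ (Vy z) (Vy z) with hq'
  have cq' : ContinuousOn q' (Icc (-(1 / 2)) (1 / 2)) :=
    (cV.inner cVyy).add (cVy.inner cVy)
  have cq : ContinuousOn q (Icc (-(1 / 2)) (1 / 2)) := cV.inner cVy
  have hPc : Continuous P := hs.lipschitz.continuous
  have key := integral_mul_deriv_of_lipschitz hs.lipschitz hb
    (hs.weight_eq_zero hT (by norm_num [abs_of_pos])) (hs.weight_eq_zero hT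
      (by norm_num [abs_of_pos])) (fun z hz => (dV z hz).inner ℝ (dVy z hz)) cq'
  have i1 : IntervalIntegrable (fun z => P z * energyIntegrand us0 U θ lam a t z) volume
      (-(1 / 2)) (1 / 2) := (hPc.continuousOn.mul cI).intervalIntegrable_of_Icc hb
  have i2 : IntervalIntegrable (fun z => P z * q' z) volume (-(1 / 2)) (1 / 2) :=
    (hPc.continuousOn.mul cq').intervalIntegrable_of_Icc hb
  have i3 : IntervalIntegrable (fun z => deriv P z * q z) volume (-(1 / 2)) (1 / 2) := by
    obtain ⟨C, hC⟩ := isCompact_Icc.exists_bound_of_continuousOn cq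
    rw [intervalIntegrable_iff_integrableOn_Ioc_of_le hb]
    refine Integrable.of_bound (C := K * C) ((measurable_deriv P).aestronglyMeasurable.mul
      ((cq.mono Ioc_subset_Icc_self).aestronglyMeasurable measurableSet_Ioc)) ?_
    refine (ae_restrict_iff' measurableSet_Ioc).2 (ae_of_all _ fun z hz => ?_)
    rw [norm_mul]
    exact mul_le_mul (abs_deriv_le_of_lipschitz hs.lipschitz z)
      (hC z (Ioc_subset_Icc_self hz)) (norm_nonneg _) K.2
  have e : ∀ z, energyDensity (shearHeat us0) U θ lam (criticalSpeed us0 a t) (P z) (deriv P z) t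
      (z + a t) = P z * energyIntegrand us0 U θ lam a t z - 2 * (P z * q' z)
        - 2 * (deriv P z * q z) := fun z => by
    rw [two_mul_inner_liftVelocity hθ, energyDensity, errorTerm, hq, hq']
    simp only [hV, hVy, hVyy, real_inner_self_eq_norm_sq]
    rw [← liftW, ← liftWy]
    ring
  rw [energyRate]
  simp only [e]
  rw [intervalIntegral.integral_sub (i1.sub (i2.const_mul 2)) (i3.const_mul 2),
    intervalIntegral.integral_sub i1 (i2.const_mul 2), intervalIntegral.integral_const_mul,
    intervalIntegral.integral_const_mul, key]
  ring

/-- After integration by parts neither `U 3` nor the fourth derivative of `us` occurs. These are the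
quantities known only for interior or positive times, so the rate extends continuously to the closed
interval. -/
lemma IsEnergySetup.continuousOn_energyRate (hs : IsEnergySetup us0 δ T a P K) (hT : 0 ≤ T)
    (hU : IsLiftedSolution (shearHeat us0) U δ θ lam T) (h : IsShearData us0 c) :
    ContinuousOn (energyRate us0 U θ lam a P) (Icc 0 T) := by
  have hb : (-(1 / 2) : ℝ) ≤ 1 / 2 := by norm_num
  have hS : ∀ k, k ≤ 3 → ContinuousOn (fun p : ℝ × ℝ => shearHeat us0 k p.1 (p.2 + a p.1))
      (Icc 0 T ×ˢ Icc (-(1 / 2)) (1 / 2)) := fun k hk =>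
    hs.comp_continuousOn le_rfl (h.continuous_shearHeat hk).continuousOn
  have hUc : ∀ k, k ≤ 2 → ContinuousOn (fun p : ℝ × ℝ => U k p.1 (p.2 + a p.1))
      (Icc 0 T ×ˢ Icc (-(1 / 2)) (1 / 2)) := fun k hk =>
    hs.comp_continuousOn le_rfl (hU.cont k hk)
  have hJ : ∀ (r : ℝ) {F : ℝ × ℝ → L2x}, ContinuousOn F (Icc 0 T ×ˢ Icc (-(1 / 2)) (1 / 2)) →
      ContinuousOn (fun p => japOp r (F p)) (Icc 0 T ×ˢ Icc (-(1 / 2)) (1 / 2)) :=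
    fun r F hF => (japOp r).continuous.comp_continuousOn hF
  have hW := hs.comp_continuousOn le_rfl (hU.continuousOn_liftW h)
  have hWy := hs.comp_continuousOn le_rfl (hU.continuousOn_liftWy h)
  have hsp : ContinuousOn (fun p : ℝ × ℝ => criticalSpeed us0 a p.1)
      (Icc 0 T ×ˢ Icc (-(1 / 2)) (1 / 2)) :=
    hs.cont_speed.comp continuousOn_fst fun p hp => hp.1
  set g₂ : ℝ → ℝ → ℝ := fun t z =>
    inner ℝ (japOp (3 / 2) (liftW (shearHeat us0) U t (z + a t)))
      (japOp (3 / 2) (liftWy (shearHeat us0) U t (z + a t))) with hg₂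
  set g₁ : ℝ → ℝ → ℝ := fun t z =>
    -(2 * lam) * ‖japOp (5 / 4 - θ) (liftW (shearHeat us0) U t (z + a t))‖ ^ 2
      - 2 * ‖japOp (3 / 2) (liftWy (shearHeat us0) U t (z + a t))‖ ^ 2
      + (2 * inner ℝ (japOp (3 / 2) (liftW (shearHeat us0) U t (z + a t)))
          (japOp (3 / 2) ((2 * shearHeat us0 3 t (z + a t)) • U 1 t (z + a t)
            - (2 * shearHeat us0 2 t (z + a t)) • U 2 t (z + a t)))
        + 2 * criticalSpeed us0 a t * g₂ t z) with hg₁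
  have c₂ : ContinuousOn (fun p : ℝ × ℝ => g₂ p.1 p.2) (Icc 0 T ×ˢ Icc (-(1 / 2)) (1 / 2)) :=
    (hJ _ hW).inner (hJ _ hWy)
  have c₁ : ContinuousOn (fun p : ℝ × ℝ => g₁ p.1 p.2) (Icc 0 T ×ˢ Icc (-(1 / 2)) (1 / 2)) := by
    refine ((continuousOn_const.mul ((hJ _ hW).norm.pow 2)).sub
      (continuousOn_const.mul ((hJ _ hWy).norm.pow 2))).add
      ((continuousOn_const.mul ((hJ _ hW).inner (hJ _ ?_))).add
      ((continuousOn_const.mul hsp).mul c₂))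
    exact ((continuousOn_const.mul (hS 3 (by omega))).smul (hUc 1 (by omega))).sub
      ((continuousOn_const.mul (hS 2 (by omega))).smul (hUc 2 (by omega)))
  have i₁ := continuousOn_integral_mul hb hs.lipschitz.continuous.measurable
    (hs.abs_weight_le hT) c₁
  have i₂ := continuousOn_integral_mul hb (measurable_deriv P)
    (abs_deriv_le_of_lipschitz hs.lipschitz) c₂
  refine (i₁.sub (continuousOn_const (c := (2 : ℝ)).mul i₂)).congr fun t ht => ?_
  have s₁ : ContinuousOn (g₁ t) (Icc (-(1 / 2)) (1 / 2)) :=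
    c₁.comp (f := fun z => (t, z)) (by fun_prop) fun z hz => ⟨ht, hz⟩
  have s₂ : ContinuousOn (g₂ t) (Icc (-(1 / 2)) (1 / 2)) :=
    c₂.comp (f := fun z => (t, z)) (by fun_prop) fun z hz => ⟨ht, hz⟩
  have j₁ : IntervalIntegrable (fun z => P z * g₁ t z) volume (-(1 / 2)) (1 / 2) :=
    (hs.lipschitz.continuous.continuousOn.mul s₁).intervalIntegrable_of_Icc hb
  have j₂ : IntervalIntegrable (fun z => deriv P z * g₂ t z) volume (-(1 / 2)) (1 / 2) := by
    obtain ⟨C, hC⟩ := isCompact_Icc.exists_bound_of_continuousOn s₂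
    rw [intervalIntegrable_iff_integrableOn_Ioc_of_le hb]
    refine Integrable.of_bound (C := K * C) ((measurable_deriv P).aestronglyMeasurable.mul
      ((s₂.mono Ioc_subset_Icc_self).aestronglyMeasurable measurableSet_Ioc)) ?_
    refine (ae_restrict_iff' measurableSet_Ioc).2 (ae_of_all _ fun z hz => ?_)
    rw [norm_mul]
    exact mul_le_mul (abs_deriv_le_of_lipschitz hs.lipschitz z)
      (hC z (Ioc_subset_Icc_self hz)) (norm_nonneg _) K.2
  change _ = (∫ z in (-(1 / 2) : ℝ)..(1 / 2), P z * g₁ t z)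
    - 2 * ∫ z in (-(1 / 2) : ℝ)..(1 / 2), deriv P z * g₂ t z
  rw [← intervalIntegral.integral_const_mul, ← intervalIntegral.integral_sub j₁ (j₂.const_mul 2),
    energyRate]
  refine intervalIntegral.integral_congr fun z _ => ?_
  simp only [energyDensity, errorTerm, hg₁, hg₂]
  rw [← liftW, ← liftWy]
  ring

lemma IsEnergySetup.hasDerivWithinAt_energy (hs : IsEnergySetup us0 δ T a P K) (hθ : θ ≤ 1 / 2)
    (hT : 0 < T) (hU : IsLiftedSolution (shearHeat us0) U δ θ lam T) (h : IsShearData us0 c)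
    {t : ℝ} (ht : t ∈ Icc 0 T) :
    HasDerivWithinAt (energy (shearHeat us0) U a P) (energyRate us0 U θ lam a P t) (Icc 0 T) t :=
  hasDerivWithinAt_Icc_of_Ioo hT (hs.continuousOn_energy hT.le hU h)
    (hs.continuousOn_energyRate hT.le hU h)
    (fun _ ht => (hs.integral_energyIntegrand hθ hU h ht) ▸ hs.hasDerivAt_energy hU h ht) ht

end EnergyDerivative

end

section

/-! ### Lifting a solution -/

section Solution

variable {E : Type*} [NormedAddCommGroup E] [NormedSpace ℝ E]

lemma hasDerivAt_dy_iterate {k n : ℕ} (hk : k < n) {u : ℝ → ℝ → E} {t : ℝ}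
    (hu : ContDiffOn ℝ n (u t) (Ioi 0)) {y : ℝ} (hy : 0 < y) :
    HasDerivAt (dy^[k] u t) (dy^[k + 1] u t y) y := by
  induction k generalizing n u with
  | zero =>
    exact ((hu.differentiableOn (by exact_mod_cast Nat.one_le_iff_ne_zero.1 hk)).differentiableAt
      (Ioi_mem_nhds hy)).hasDerivAt
  | succ k ih =>
    obtain ⟨m, rfl⟩ := Nat.exists_eq_succ_of_ne_zero (by omega : n ≠ 0)
    rw [Function.iterate_succ_apply, Function.iterate_succ_apply]
    refine ih (n := m) (by omega) ?_
    exact ((contDiffOn_succ_iff_deriv_of_isOpen isOpen_Ioi).1 (by exact_mod_cast hu)).2.2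

lemma commDyy_eq {f f₁ : ℝ → ℝ → ℝ} {g g₁ : ℝ → ℝ → E} {t y f₂ : ℝ} {g₂ : E}
    (hf : ∀ᶠ z in 𝓝 y, HasDerivAt (f t) (f₁ t z) z) (hg : ∀ᶠ z in 𝓝 y, HasDerivAt (g t) (g₁ t z) z)
    (hf₁ : HasDerivAt (f₁ t) f₂ y) (hg₁ : HasDerivAt (g₁ t) g₂ y) :
    commDyy f g t y = -((2 * f₁ t y) • g₁ t y) - f₂ • g t y := by
  have e1 : dy (dy g) t y = g₂ := (hg₁.congr_of_eventuallyEq (hg.mono fun z hz => hz.deriv)).deriv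
  have e2 : dy (prodF f g) t =ᶠ[𝓝 y] fun z => f t z • g₁ t z + f₁ t z • g t z := by
    filter_upwards [hf, hg] with z h1 h2
    exact (h1.smul h2).deriv
  have e3 : dy (dy (prodF f g)) t y = (f t y • g₂ + f₁ t y • g₁ t y) +
      (f₁ t y • g₁ t y + f₂ • g t y) :=
    (((hf.self_of_nhds.smul hg₁).add (hf₁.smul hg.self_of_nhds)).congr_of_eventuallyEq e2).deriv
  rw [commDyy, e3, prodF, e1]
  module

variable {us0 ψ₂ : ℝ → ℝ} {c δ θ lam T : ℝ} {u : ℝ → ℝ → L2x} {t y : ℝ}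

lemma IsSolution.hasDerivAt_dy {us : ℝ → ℝ → ℝ} (hu : IsSolution us ψ₂ θ lam T u) {k : ℕ}
    (hk : k ≤ 1) (ht : t ∈ Icc 0 T) (hy : 0 < y) :
    HasDerivAt (dy^[k] u t) (dy^[k + 1] u t y) y :=
  hasDerivAt_dy_iterate (n := 2) (by omega) (by exact_mod_cast hu.contDiff_two t ht) hy

lemma IsSolution.hasDerivAt_dy_two {us : ℝ → ℝ → ℝ} (hu : IsSolution us ψ₂ θ lam T u)
    (ht : t ∈ Ioo 0 T) (hy : 0 < y) : HasDerivAt (dy^[2] u t) (dy^[3] u t y) y :=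
  hasDerivAt_dy_iterate (n := 3) (by omega) (by exact_mod_cast hu.contDiff_three t ht) hy

lemma IsShearData.w2_eq (h : IsShearData us0 c) (ht : 0 ≤ t) (hy : 0 < y) :
    w2 (shearFlow us0) u t y = liftW (shearHeat us0) (fun k => dy^[k] u) t y := by
  rw [w2, prodF, prodF, h.dy_shearFlow ht hy, h.dy_dy_shearFlow ht hy]
  rfl

lemma IsSolution.dy_w2_eq (h : IsShearData us0 c)
    (hu : IsSolution (shearFlow us0) ψ₂ θ lam T u) (ht : t ∈ Icc 0 T) (hy : 0 < y) :
    dy (w2 (shearFlow us0) u) t y = liftWy (shearHeat us0) (fun k => dy^[k] u) t y := by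
  refine ((h.hasDerivAt_liftW (U := fun k => dy^[k] u) (hu.hasDerivAt_dy (by omega) ht hy)
    (hu.hasDerivAt_dy le_rfl ht hy)).congr_of_eventuallyEq ?_).deriv
  filter_upwards [Ioi_mem_nhds hy] with z hz
  exact h.w2_eq ht.1 hz

lemma IsSolution.dy_dy_w2_eq (h : IsShearData us0 c)
    (hu : IsSolution (shearFlow us0) ψ₂ θ lam T u) (ht : t ∈ Ioo 0 T) (hy : 0 < y) :
    dy (dy (w2 (shearFlow us0) u)) t y = liftWyy (shearHeat us0) (fun k => dy^[k] u) t y := by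
  refine ((h.hasDerivAt_liftWy (U := fun k => dy^[k] u) ht.1
    (hu.hasDerivAt_dy (by omega) (Ioo_subset_Icc_self ht) hy)
    (hu.hasDerivAt_dy_two ht hy)).congr_of_eventuallyEq ?_).deriv
  filter_upwards [Ioi_mem_nhds hy] with z hz
  exact hu.dy_w2_eq h (Ioo_subset_Icc_self ht) hz

/-- The heat equation turns `∂_t ∂_y us` and `∂_t ∂_y² us` into the third and fourth
`y`-derivatives, which cancel against the second-order parts of the two commutators. Only the
first-order cross terms remain. -/
lemma IsSolution.F2_eq (h : IsShearData us0 c)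
    (hu : IsSolution (shearFlow us0) ψ₂ θ lam T u) (ht : t ∈ Ioo 0 T) (hy : 0 < y) :
    F2 (shearFlow us0) u t y = (2 * shearHeat us0 3 t y) • dy u t y
      - (2 * shearHeat us0 2 t y) • dy (dy u) t y := by
  have ht' := Ioo_subset_Icc_self ht
  have s : ∀ z ∈ Ioi (0 : ℝ), HasDerivAt (dy (shearFlow us0) t) (shearHeat us0 2 t z) z :=
    fun z hz => (h.hasDerivAt_shearHeat (k := 1) (by omega) t z).congr_of_eventuallyEq
      (by filter_upwards [Ioi_mem_nhds hz] with x hx using h.dy_shearFlow ht'.1 hx)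
  have s' : ∀ z ∈ Ioi (0 : ℝ), HasDerivAt (dy (dy (shearFlow us0)) t) (shearHeat us0 3 t z) z :=
    fun z hz => (h.hasDerivAt_shearHeat (k := 2) (by omega) t z).congr_of_eventuallyEq
      (by filter_upwards [Ioi_mem_nhds hz] with x hx using h.dy_dy_shearFlow ht'.1 hx)
  have c1 : commDyy (dy (shearFlow us0)) (dy u) t y =
      -((2 * shearHeat us0 2 t y) • dy (dy u) t y) - shearHeat us0 3 t y • dy u t y :=
    commDyy_eq (f₁ := shearHeat us0 2) (g₁ := dy (dy u))
      (by filter_upwards [Ioi_mem_nhds hy] with z hz using s z hz)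
      (by filter_upwards [Ioi_mem_nhds hy] with z hz using hu.hasDerivAt_dy le_rfl ht' hz)
      (h.hasDerivAt_shearHeat (k := 2) (by omega) t y) (hu.hasDerivAt_dy_two ht hy)
  have c2 : commDyy (dy (dy (shearFlow us0))) u t y =
      -((2 * shearHeat us0 3 t y) • dy u t y) - shearHeat us0 4 t y • u t y :=
    commDyy_eq (f₁ := shearHeat us0 3) (g₁ := dy u)
      (by filter_upwards [Ioi_mem_nhds hy] with z hz using s' z hz)
      (by filter_upwards [Ioi_mem_nhds hy] with z hz using hu.hasDerivAt_dy zero_le_one ht' hz)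
      (h.isC3Tower.hasDerivAt_heat_three ht.1 y) (hu.hasDerivAt_dy le_rfl ht' hy)
  rw [F2, c1, c2, prodF, prodF, h.dt_dy_shearFlow ht.1 hy, h.dt_dy_dy_shearFlow ht.1 hy]
  module

/-- The Fourier transforms of `⟨D_x⟩² (∂_y^k u)_Φ`. -/
def solutionLift (θ lam : ℝ) (u : ℝ → ℝ → L2x) (k : ℕ) (t y : ℝ) : L2x :=
  𝓕 (gev θ lam 2 t (dy^[k] u t y))

lemma IsSolution.isLift {us : ℝ → ℝ → ℝ} (hu : IsSolution us ψ₂ θ lam T u) {k : ℕ} (hk : k ≤ 2)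
    (ht : t ∈ Icc 0 T) (hy : 0 < y) :
    IsLift θ lam t (dy^[k] u t y) (solutionLift θ lam u k t y) :=
  isLift_fourier_gev (hu.inGev_two k hk t ht y hy)

lemma IsSolution.isLift_three {us : ℝ → ℝ → ℝ} (hu : IsSolution us ψ₂ θ lam T u)
    (ht : t ∈ Ioo 0 T) (hy : 0 < y) :
    IsLift θ lam t (dy^[3] u t y) (solutionLift θ lam u 3 t y) :=
  isLift_fourier_gev (hu.inGev_three t ht y hy)

lemma IsSolution.isLift_w2 (h : IsShearData us0 c)
    (hu : IsSolution (shearFlow us0) ψ₂ θ lam T u) (ht : t ∈ Icc 0 T) (hy : 0 < y) :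
    IsLift θ lam t (w2 (shearFlow us0) u t y)
      (liftW (shearHeat us0) (solutionLift θ lam u) t y) := by
  rw [h.w2_eq ht.1 hy]
  exact ((hu.isLift (by omega) ht hy).smul _).sub ((hu.isLift (by omega) ht hy).smul _)

lemma IsSolution.isLift_dy_w2 (h : IsShearData us0 c)
    (hu : IsSolution (shearFlow us0) ψ₂ θ lam T u) (ht : t ∈ Icc 0 T) (hy : 0 < y) :
    IsLift θ lam t (dy (w2 (shearFlow us0) u) t y)
      (liftWy (shearHeat us0) (solutionLift θ lam u) t y) := by
  rw [hu.dy_w2_eq h ht hy]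
  exact ((hu.isLift (by omega) ht hy).smul _).sub ((hu.isLift (by omega) ht hy).smul _)

lemma IsSolution.isLift_dy_dy_w2 (h : IsShearData us0 c)
    (hu : IsSolution (shearFlow us0) ψ₂ θ lam T u) (ht : t ∈ Ioo 0 T) (hy : 0 < y) :
    IsLift θ lam t (dy (dy (w2 (shearFlow us0) u)) t y)
      (liftWyy (shearHeat us0) (solutionLift θ lam u) t y) := by
  have ht' := Ioo_subset_Icc_self ht
  rw [hu.dy_dy_w2_eq h ht hy]
  exact (((hu.isLift_three ht hy).smul _).add ((hu.isLift (by omega) ht' hy).smul _)).sub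
    (((hu.isLift (by omega) ht' hy).smul _).add ((hu.isLift (by omega) ht' hy).smul _))

/-- The derivatives `∂_y^k u` are known in `L²`, and their Gevrey lifts are only assumed continuous;
damping upgrades this to differentiability of the lifts. -/
lemma IsSolution.isLiftedFamily {us : ℝ → ℝ → ℝ} (hu : IsSolution us ψ₂ θ lam T u) (hθ : 0 ≤ θ)
    (hlam : 0 ≤ lam) : IsLiftedFamily (solutionLift θ lam u) T := by
  have hc : ∀ k, k ≤ 2 → ContinuousOn (fun p : ℝ × ℝ => solutionLift θ lam u k p.1 p.2)
      (Icc 0 T ×ˢ Ioi 0) := fun k hk =>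
    fourierOp.continuous.comp_continuousOn (hu.continuous_two k hk)
  have hc3 : ContinuousOn (fun p : ℝ × ℝ => solutionLift θ lam u 3 p.1 p.2)
      (Ioo 0 T ×ˢ Ioi 0) := fourierOp.continuous.comp_continuousOn hu.continuous_three
  refine ⟨hc, hc3, fun k hk t ht y hy => ?_, fun t ht y hy => ?_⟩
  · refine hasDerivAt_lift (α := 0) (β := y + 1) hθ (mul_nonneg hlam ht.1)
      (fun z hz => hu.hasDerivAt_dy hk ht hz.1) (fun z hz => hu.isLift (by omega) ht hz.1)
      (fun z hz => hu.isLift (by omega) ht hz.1)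
      ((hc (k + 1) (by omega)).comp (f := fun z => (t, z)) (by fun_prop)
        fun z hz => ⟨ht, hz.1⟩) ⟨hy, by linarith⟩
  · refine hasDerivAt_lift (α := 0) (β := y + 1) hθ (mul_nonneg hlam ht.1.le)
      (fun z hz => hu.hasDerivAt_dy_two ht hz.1)
      (fun z hz => hu.isLift le_rfl (Ioo_subset_Icc_self ht) hz.1)
      (fun z hz => hu.isLift_three ht hz.1)
      (hc3.comp (f := fun z => (t, z)) (by fun_prop) fun z hz => ⟨ht, hz.1⟩) ⟨hy, by linarith⟩

/-! ### Localisation to the region where the inner cut-off equals one -/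

section Cutoff

variable {us : ℝ → ℝ → ℝ}

lemma IsInnerCutoff.eq_one_of_abs_lt (hψ : IsInnerCutoff δ ψ₂) (hy : |y - 1| < 2 * δ) :
    ψ₂ y = 1 := by
  have := abs_lt.1 hy
  exact hψ.eq_one y ⟨by linarith, by linarith⟩

lemma eventually_abs_sub_one_lt (hy : |y - 1| < 2 * δ) : ∀ᶠ z in 𝓝 y, |z - 1| < 2 * δ :=
  (isOpen_lt (by fun_prop : Continuous fun z : ℝ => |z - 1|) continuous_const).mem_nhds hy

lemma IsInnerCutoff.w2bar_eq (hψ : IsInnerCutoff δ ψ₂) (hy : |y - 1| < 2 * δ) :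
    w2bar us ψ₂ u t y = w2 us u t y := by
  rw [w2bar, prodF, hψ.eq_one_of_abs_lt hy, one_smul]

lemma IsInnerCutoff.dy_w2bar_eq (hψ : IsInnerCutoff δ ψ₂) (hy : |y - 1| < 2 * δ) :
    dy (w2bar us ψ₂ u) t y = dy (w2 us u) t y :=
  EventuallyEq.deriv_eq ((eventually_abs_sub_one_lt hy).mono fun _ hz => hψ.w2bar_eq hz)

lemma IsInnerCutoff.dy_dy_w2bar_eq (hψ : IsInnerCutoff δ ψ₂) (hy : |y - 1| < 2 * δ) :
    dy (dy (w2bar us ψ₂ u)) t y = dy (dy (w2 us u)) t y :=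
  EventuallyEq.deriv_eq ((eventually_abs_sub_one_lt hy).mono fun _ hz => hψ.dy_w2bar_eq hz)

lemma IsInnerCutoff.commDyy_eq_zero (hψ : IsInnerCutoff δ ψ₂) (hy : |y - 1| < 2 * δ) :
    commDyy (fun _ y => ψ₂ y) (w2 us u) t y = 0 := by
  have := hψ.dy_dy_w2bar_eq (us := us) (u := u) (t := t) hy
  rw [w2bar] at this
  rw [commDyy, this, prodF, hψ.eq_one_of_abs_lt hy, one_smul, sub_self]

end Cutoff

lemma coeFn_transportOp (f : L2x) : transportOp f =ᵐ[volume] fun ξ =>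
    Complex.I * ((2 * Real.pi * ξ * jap ξ ^ (-(3 / 2 : ℝ)) : ℝ) * f ξ) := by
  rw [transportOp]
  filter_upwards [Lp.coeFn_smul Complex.I (mulOp (fun ξ => 2 * Real.pi * ξ *
    jap ξ ^ (-(3 / 2 : ℝ))) f), coeFn_mulOp isSymbol_transport f] with ξ h1 h2
  rw [h1, Pi.smul_apply, h2, smul_eq_mul]

/-- The Fourier side of `d/dt` of `⟨D⟩^{1/2} w_Φ` if `∂_t w = - s ∂_x w + g`. -/
lemma coeFn_time_derivative (hθ : θ ≤ 1 / 2) {w q g W G : L2x} (s : ℝ) (hW : IsLift θ lam t w W)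
    (hG : IsLift θ lam t g G) (hq : HasXDeriv w q) :
    ∀ᵐ ξ, (-(lam • japOp (1 - 2 * θ) W) - s • transportOp W + japOp (3 / 2) G : L2x) ξ =
      (gevSymbol θ lam (1 / 2) t ξ : ℂ) * (𝓕 (-(s • q) + g) : L2x) ξ -
      (lam * jap ξ ^ (-(1 - 2 * θ)) : ℝ) * W ξ := by
  have hj := hG.coeFn_japOp (s := 1 / 2) (by norm_num)
  rw [show (2 : ℝ) - 1 / 2 = 3 / 2 by norm_num] at hj
  have h1 : (𝓕 (-(s • q) + g) : L2x) = -(s • 𝓕 q) + 𝓕 g := by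
    have := map_add fourierOp (-(s • q)) g
    rwa [map_neg, map_smul] at this
  rw [h1]
  filter_upwards [hj, hW, hq, coeFn_transportOp W,
    coeFn_mulOp (isSymbol_jap (r := 1 - 2 * θ) (by linarith)) W,
    Lp.coeFn_add (-(lam • japOp (1 - 2 * θ) W) - s • transportOp W) (japOp (3 / 2) G),
    Lp.coeFn_sub (-(lam • japOp (1 - 2 * θ) W)) (s • transportOp W),
    Lp.coeFn_neg (lam • japOp (1 - 2 * θ) W), Lp.coeFn_smul lam (japOp (1 - 2 * θ) W),
    Lp.coeFn_smul s (transportOp W), Lp.coeFn_add (-(s • (𝓕 q : L2x))) (𝓕 g),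
    Lp.coeFn_neg (s • (𝓕 q : L2x)), Lp.coeFn_smul s (𝓕 q : L2x)]
    with ξ a1 a2 a3 a4 a5 a6 a7 a8 a9 a10 a11 a12 a13
  rw [a6, Pi.add_apply, a7, Pi.sub_apply, a8, Pi.neg_apply, a9, Pi.smul_apply, a10,
    Pi.smul_apply, a11, Pi.add_apply, a12, Pi.neg_apply, a13, Pi.smul_apply, a1, a4, a3, japOp,
    a5, a2, gevHat, gevHat, gevSymbol_eq_rpow_mul (1 / 2)]
  rw [show (2 : ℝ) - 1 / 2 = 3 / 2 by norm_num]
  simp only [Complex.real_smul]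
  push_cast
  ring

lemma IsSolution.isLiftedSolution (h : IsShearData us0 c)
    (hu : IsSolution (shearFlow us0) ψ₂ θ lam T u) (hψ : IsInnerCutoff δ ψ₂) (hδ : δ ≤ 1 / 8)
    (hθ : 0 ≤ θ) (hθ' : θ ≤ 1 / 2) (hlam : 0 ≤ lam) :
    IsLiftedSolution (shearHeat us0) (solutionLift θ lam u) δ θ lam T where
  toIsLiftedFamily := hu.isLiftedFamily hθ hlam
  deriv_time := by
    intro t ht y hy
    have hpos : 0 < y := by linarith [(abs_lt.1 hy).1]
    choose! q hq hd using fun t ht => hu.equation t ht y hpos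
    refine hasDerivAt_lift_time hθ hθ' hlam hd (F := fun τ => liftW (shearHeat us0)
      (solutionLift θ lam u) τ y) (D := fun τ => liftD (shearHeat us0) (solutionLift θ lam u)
      θ lam τ y) (fun τ hτ => ?_) (fun τ hτ => ?_) ?_ ht
    · rw [hψ.w2bar_eq hy]
      exact hu.isLift_w2 h (Ioo_subset_Icc_self hτ) hpos
    · have hτ' := Ioo_subset_Icc_self hτ
      rw [hψ.dy_dy_w2bar_eq hy, hψ.commDyy_eq_zero hy, hψ.eq_one_of_abs_lt hy, one_smul, add_zero,
        hu.F2_eq h hτ hpos, h.shearFlow_eq hτ.1.le hpos.le, add_assoc]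
      refine coeFn_time_derivative hθ' _ (hu.isLift_w2 h hτ' hpos)
        ((hu.isLift_dy_dy_w2 h hτ hpos).add (((hu.isLift (k := 1) (by omega) hτ' hpos).smul _).sub
          ((hu.isLift (k := 2) le_rfl hτ' hpos).smul _))) ?_
      have := hq τ hτ
      rwa [hψ.w2bar_eq hy] at this
    · exact ((hu.isLiftedFamily hθ hlam).continuousOn_liftD h).comp (f := fun τ => (τ, y))
        (by fun_prop) fun τ hτ => ⟨hτ, hpos⟩

end Solution

end

section

/-! ### The weight -/

section Weight

variable {δ T : ℝ} {a ϕ : ℝ → ℝ}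

/-- The support condition gives only `≤ 2δ`. The set where `ϕ ≠ 0` is open and hence lies in the
interior of the closed ball. Strictness ensures that `ψ₂ = 1` in a neighbourhood, so its derivatives
do not intervene. -/
lemma IsWeight.abs_sub_one_lt (hw : IsWeight δ T a ϕ) (hδ : 0 < δ) {t z : ℝ} (ht : t ∈ Icc 0 T)
    (hz : ϕ z ≠ 0) : |z + a t - 1| < 2 * δ := by
  obtain ⟨K, hK⟩ := hw.lipschitz
  have hopen : IsOpen {z | ϕ z ≠ 0} := isOpen_ne.preimage hK.continuous
  have hsub : {z | ϕ z ≠ 0} ⊆ Metric.closedBall (1 - a t) (2 * δ) := fun z hz => by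
    by_contra hn
    rw [Metric.mem_closedBall, not_le, Real.dist_eq] at hn
    refine hz ?_
    have := hw.support t ht (z + a t) (by rwa [show z + a t - 1 = z - (1 - a t) by ring])
    rwa [add_sub_cancel_right] at this
  have hint := hopen.subset_interior_iff.2 hsub hz
  rw [interior_closedBall _ (by positivity), Metric.mem_ball, Real.dist_eq] at hint
  rwa [show z + a t - 1 = z - (1 - a t) by ring]

lemma lipschitzOnWith_rpow {p R : ℝ} (hp : 1 ≤ p) :
    LipschitzOnWith (p * R ^ (p - 1)).toNNReal (fun x : ℝ => x ^ p) (Icc 0 R) := by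
  refine (convex_Icc 0 R).lipschitzOnWith_of_nnnorm_hasDerivWithin_le
    (fun x _ => (Real.hasDerivAt_rpow_const (Or.inr hp)).hasDerivWithinAt) fun x hx => ?_
  rw [← NNReal.coe_le_coe, coe_nnnorm, Real.norm_eq_abs,
    abs_of_nonneg (mul_nonneg (by linarith) (Real.rpow_nonneg hx.1 _))]
  refine le_trans ?_ (Real.le_coe_toNNReal _)
  exact mul_le_mul_of_nonneg_left (Real.rpow_le_rpow hx.1 hx.2 (by linarith)) (by linarith)

/-- A Lipschitz function with bounded support is bounded, and `x ^ p` with `p ≥ 1` is Lipschitz on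
bounded intervals. Hence the squared weight vanishes to first order at the critical point. -/
lemma IsWeight.exists_lipschitzWith_rpow (hw : IsWeight δ T a ϕ) (hδ : 0 < δ) (hT : 0 ≤ T) {p : ℝ}
    (hp : 1 ≤ p) : ∃ K : ℝ≥0, LipschitzWith K fun z => ϕ z ^ p := by
  obtain ⟨K, hK⟩ := hw.lipschitz
  have hle : ∀ z, ϕ z ≤ K * (2 * δ + |1 - a 0|) := fun z => by
    by_cases hz : ϕ z = 0
    · rw [hz]; positivity
    · have h1 := hw.abs_sub_one_lt hδ ⟨le_rfl, hT⟩ hz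
      have h2 := hK.dist_le_mul z 0
      rw [Real.dist_eq, Real.dist_eq, hw.zero, sub_zero, sub_zero] at h2
      refine (le_abs_self _).trans (h2.trans ?_)
      gcongr
      calc |z| = |(z + a 0 - 1) + (1 - a 0)| := by ring_nf
        _ ≤ _ := (abs_add_le _ _).trans (by linarith)
  refine ⟨_, lipschitzOnWith_univ.1 ((lipschitzOnWith_rpow hp).comp hK.lipschitzOnWith
    fun z _ => ⟨hw.nonneg z, hle z⟩)⟩

lemma IsWeight.weight_sq (hw : IsWeight δ T a ϕ) (θ₁ t y : ℝ) :
    weight θ₁ a ϕ t y ^ 2 = ϕ (y - a t) ^ (1 + θ₁) := by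
  rw [weight, ← Real.rpow_natCast, ← Real.rpow_mul (hw.nonneg _)]
  congr 1; push_cast; ring

lemma IsWeight.isEnergySetup (hw : IsWeight δ T a ϕ) {us0 : ℝ → ℝ} {c : ℝ}
    (h : IsShearData us0 c) (hc : 0 < c) (hδ : 0 < δ) (hδ1 : δ ≤ 1 / 8)
    (ha : Admissible (shearFlow us0) c δ T a) {p : ℝ} (hp : 1 ≤ p) {K : ℝ≥0}
    (hK : LipschitzWith K fun z => ϕ z ^ p) :
    IsEnergySetup us0 δ T a (fun z => ϕ z ^ p) K where
  δ_le := hδ1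
  cont_a := h.continuousOn_critical hc hδ hδ1 ha
  abs_a_lt _ ht := ha.abs_sub_one_lt hc hδ hδ1 ht
  cont_speed := h.continuousOn_criticalSpeed hc hδ hδ1 ha
  deriv_a _ ht := h.hasDerivAt_critical hc hδ hδ1 ha ht
  lipschitz := hK
  support z hz t ht := hw.abs_sub_one_lt hδ ht fun h0 => hz (by
    simp only [h0]
    exact Real.zero_rpow (by linarith))

end Weight

/-! ### The norms on the half line -/

section Norms

variable {θ lam s t lo hi : ℝ} {g G : ℝ → L2x}

lemma ofReal_integral_le_normSq (hs : s ≤ 2) (hlo : 0 < lo) (hle : lo ≤ hi)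
    (hG : ∀ y ∈ Ioo lo hi, IsLift θ lam t (g y) (G y)) (hGc : ContinuousOn G (Icc lo hi)) :
    ENNReal.ofReal (∫ y in lo..hi, ‖japOp (2 - s) (G y)‖ ^ 2) ≤ normSq θ lam s t g := by
  have hc : ContinuousOn (fun y => ‖japOp (2 - s) (G y)‖ ^ 2) (Icc lo hi) :=
    (japOp_comp_continuousOn hGc _).norm.pow 2
  rw [intervalIntegral.integral_of_le hle, integral_Ioc_eq_integral_Ioo,
    ofReal_integral_eq_lintegral_ofReal (hc.integrableOn_Icc.mono_set Ioo_subset_Icc_self)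
      (ae_of_all _ fun y => by positivity), normSq]
  refine (setLIntegral_mono' measurableSet_Ioo fun y hy => ?_).trans
    (lintegral_mono_set (Ioo_subset_Ioi_self.trans (Ioi_subset_Ioi hlo.le)))
  rw [(hG y hy).gevENorm_eq hs, ← ofReal_norm, ENNReal.ofReal_pow (norm_nonneg _)]

lemma normSq_smul_eq (hs : s ≤ 2) (hlo : 0 < lo) (hle : lo ≤ hi) {r : ℝ → ℝ}
    (hr : ∀ y, y ∉ Ioo lo hi → r y = 0) (hrc : ContinuousOn (fun y => r y ^ 2) (Icc lo hi))
    (hG : ∀ y, 0 < y → IsLift θ lam t (g y) (G y)) (hGc : ContinuousOn G (Icc lo hi)) :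
    normSq θ lam s t (fun y => r y • g y) =
      ENNReal.ofReal (∫ y in lo..hi, r y ^ 2 * ‖japOp (2 - s) (G y)‖ ^ 2) := by
  have hc : ContinuousOn (fun y => r y ^ 2 * ‖japOp (2 - s) (G y)‖ ^ 2) (Icc lo hi) :=
    hrc.mul ((japOp_comp_continuousOn hGc _).norm.pow 2)
  have hsub : Ioo lo hi ⊆ Ioi 0 := Ioo_subset_Ioi_self.trans (Ioi_subset_Ioi hlo.le)
  have e : ∀ y ∈ Ioi (0 : ℝ), gevENorm θ lam s t (r y • g y) ^ 2 =
      (Ioo lo hi).indicator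
        (fun y => ENNReal.ofReal (r y ^ 2 * ‖japOp (2 - s) (G y)‖ ^ 2)) y := fun y hy => by
    have e1 : gevENorm θ lam s t (r y • g y) ^ 2 =
        ENNReal.ofReal (r y ^ 2 * ‖japOp (2 - s) (G y)‖ ^ 2) := by
      rw [((hG y hy).smul (r y)).gevENorm_eq hs, map_smul, ← ofReal_norm, norm_smul,
        ← ENNReal.ofReal_pow (by positivity), mul_pow, Real.norm_eq_abs, sq_abs]
    by_cases hy' : y ∈ Ioo lo hi
    · rw [indicator_of_mem hy', e1]
    · rw [indicator_of_notMem hy', e1, hr y hy']; simp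
  rw [normSq, setLIntegral_congr_fun measurableSet_Ioi e, lintegral_indicator measurableSet_Ioo,
    Measure.restrict_restrict measurableSet_Ioo, inter_eq_left.2 hsub,
    intervalIntegral.integral_of_le hle, integral_Ioc_eq_integral_Ioo,
    ofReal_integral_eq_lintegral_ofReal (hc.integrableOn_Icc.mono_set Ioo_subset_Icc_self)
      (ae_of_all _ fun y => by positivity)]

end Norms

/-! ### The rate of change of the energy in the original frame -/

section Rate

variable {us0 : ℝ → ℝ} {c δ θ lam T : ℝ} {a P : ℝ → ℝ} {U : ℕ → ℝ → ℝ → L2x} {K : ℝ≥0} {t : ℝ}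

lemma IsEnergySetup.integral_shift (hs : IsEnergySetup us0 δ T a P K) (ht : t ∈ Icc 0 T)
    {f : ℝ → ℝ} (hf : ∀ y, P (y - a t) = 0 → f y = 0) :
    ∫ z in (-(1 / 2) : ℝ)..(1 / 2), f (z + a t) = ∫ y in (1 - 2 * δ)..(1 + 2 * δ), f y := by
  have h1 := abs_lt.1 (hs.abs_a_lt t ht)
  have h2 := hs.δ_le
  have hsupp : ∀ y, f y ≠ 0 → |y - 1| < 2 * δ := fun y hy => by
    have := hs.support (y - a t) (fun h0 => hy (hf y h0)) t ht
    rwa [sub_add_cancel] at this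
  rw [intervalIntegral.integral_comp_add_right (fun y => f y),
    intervalIntegral.integral_eq_integral_of_support_subset,
    intervalIntegral.integral_eq_integral_of_support_subset]
  · intro y hy
    have := abs_lt.1 (hsupp y hy)
    exact ⟨by linarith, by linarith⟩
  · intro y hy
    have := abs_lt.1 (hsupp y hy)
    exact ⟨by linarith, by linarith⟩

lemma IsEnergySetup.energy_eq (hs : IsEnergySetup us0 δ T a P K) (ht : t ∈ Icc 0 T) :
    energy (shearHeat us0) U a P t = ∫ y in (1 - 2 * δ)..(1 + 2 * δ),
      P (y - a t) * ‖japOp (3 / 2) (liftW (shearHeat us0) U t y)‖ ^ 2 := by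
  rw [← hs.integral_shift ht (f := fun y => P (y - a t) *
    ‖japOp (3 / 2) (liftW (shearHeat us0) U t y)‖ ^ 2) (fun y hy => by rw [hy, zero_mul]), energy]
  simp only [add_sub_cancel_right]

lemma IsEnergySetup.energyRate_eq (hs : IsEnergySetup us0 δ T a P K) (hP : ∀ z, 0 ≤ P z)
    (ht : t ∈ Icc 0 T) :
    energyRate us0 U θ lam a P t = ∫ y in (1 - 2 * δ)..(1 + 2 * δ),
      energyDensity (shearHeat us0) U θ lam (criticalSpeed us0 a t) (P (y - a t))
        (deriv P (y - a t)) t y := by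
  rw [← hs.integral_shift ht (f := fun y => energyDensity (shearHeat us0) U θ lam
    (criticalSpeed us0 a t) (P (y - a t)) (deriv P (y - a t)) t y), energyRate]
  · simp only [add_sub_cancel_right]
  · intro y hy
    -- A zero of the nonnegative `P` is a minimum, so the term with `P'` vanishes there as well.
    have hd : deriv P (y - a t) = 0 :=
      IsLocalMin.deriv_eq_zero (Eventually.of_forall fun z => by rw [hy]; exact hP z)
    simp only [energyDensity, errorTerm, hy, hd]
    ring

end Rate

end

/-! ### The energy estimate -/

section Estimate

variable {us0 : ℝ → ℝ} {c δ θ lam T : ℝ} {a P : ℝ → ℝ} {U : ℕ → ℝ → ℝ → L2x} {K : ℝ≥0}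

/-- Compactness of `[0, T] × [1/2, 2]` gives one bound `M` for all times. It is chosen before `U`,
so the final constant is independent of the solution and of `lam`. -/
lemma IsEnergySetup.exists_spatialSetup (hs : IsEnergySetup us0 δ T a P K)
    (h : IsShearData us0 c) (hc : 0 < c) (hδ : 0 < δ) (hT : 0 ≤ T)
    (ha : Admissible (shearFlow us0) c δ T a) (hP : ∀ z, 0 ≤ P z) (hP0 : P 0 = 0) :
    ∃ M, 0 ≤ M ∧ ∀ t ∈ Icc 0 T, |criticalSpeed us0 a t| ≤ M ∧
      ∀ U : ℕ → ℝ → ℝ → L2x, IsLiftedFamily U T →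
        IsSpatialSetup M (c / 2) δ (1 - 2 * δ) (1 + 2 * δ) (a t) (shearHeat us0 1 t)
          (shearHeat us0 2 t) (shearHeat us0 3 t) (fun y => P (y - a t))
          (fun y => deriv P (y - a t)) (U 0 t) (U 1 t) (U 2 t) := by
  have hδ1 := hs.δ_le
  obtain ⟨B₂, hB₂⟩ := ((isCompact_Icc (a := (0 : ℝ)) (b := T)).prod
    (isCompact_Icc (a := (1 / 2 : ℝ)) (b := 2))).exists_bound_of_continuousOn
    (h.continuous_shearHeat (k := 2) (by omega)).continuousOn
  obtain ⟨B₃, hB₃⟩ := ((isCompact_Icc (a := (0 : ℝ)) (b := T)).prod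
    (isCompact_Icc (a := (1 / 2 : ℝ)) (b := 2))).exists_bound_of_continuousOn
    (h.continuous_shearHeat (k := 3) (by omega)).continuousOn
  obtain ⟨B, hB⟩ := isCompact_Icc.exists_bound_of_continuousOn hs.cont_speed
  have l₂ := le_abs_self B₂
  have l₃ := le_abs_self B₃
  have l := le_abs_self B
  have n₂ := abs_nonneg B₂
  have n₃ := abs_nonneg B₃
  have n := abs_nonneg B
  have nK := K.2
  set M := |B₂| + |B₃| + |B| + K with hM
  have hKM : (K : ℝ) ≤ M := by linarith
  refine ⟨M, by positivity, fun t ht => ⟨(hB t ht).trans (by linarith), fun U hU => ?_⟩⟩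
  have hat := abs_lt.1 (hs.abs_a_lt t ht)
  have hsub : Icc (1 - 2 * δ) (1 + 2 * δ) ⊆ Icc (1 / 2) 2 :=
    Icc_subset_Icc (by linarith) (by linarith)
  have hpos : ∀ y ∈ Icc (1 - 2 * δ) (1 + 2 * δ), 0 < y := fun y hy => by linarith [hy.1]
  have hcrit : a t ∈ Icc (1 / 2 : ℝ) 2 := ⟨by linarith, by linarith⟩
  have h0 := h.shearHeat_one_critical hc hδ hδ1 ha ht
  have habs₂ : ∀ y ∈ Icc (1 / 2 : ℝ) 2, |shearHeat us0 2 t y| ≤ M := fun y hy =>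
    (hB₂ (t, y) ⟨ht, hy⟩).trans (by linarith)
  have hPc : Continuous P := hs.lipschitz.continuous
  have hUc : ∀ k, k ≤ 2 → ContinuousOn (U k t) (Icc (1 - 2 * δ) (1 + 2 * δ)) := fun k hk =>
    (hU.cont k hk).comp (f := fun y => (t, y)) (by fun_prop) fun y hy => ⟨ht, hpos y hy⟩
  exact
    { lo_add_le := by linarith
      add_le_hi := by linarith
      deriv_s1 := fun y _ => h.hasDerivAt_shearHeat (k := 1) (by omega) t y
      cont_s2 := ((h.continuous_shearHeat (k := 2) (by omega)).comp
        (f := fun y : ℝ => (t, y)) (by fun_prop)).continuousOn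
      cont_s3 := ((h.continuous_shearHeat (k := 3) (by omega)).comp
        (f := fun y : ℝ => (t, y)) (by fun_prop)).continuousOn
      abs_s2_le := fun y hy => habs₂ y (hsub hy)
      abs_s3_le := fun y hy => (hB₃ (t, y) ⟨ht, hsub hy⟩).trans (by linarith)
      le_abs_s1 := fun y hy => by
        simpa [h0] using h.mul_abs_sub_le ha ht hcrit (hsub hy)
      abs_s1_le := fun y hy => by
        have := (convex_Icc (1 / 2 : ℝ) 2).norm_image_sub_le_of_norm_hasDerivWithin_le
          (fun z _ => (h.hasDerivAt_shearHeat (k := 1) (by omega) t z).hasDerivWithinAt)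
          habs₂ hcrit (hsub hy)
        simpa [h0] using this
      cont_P := (hPc.comp (continuous_id.sub continuous_const)).continuousOn
      P_nonneg := fun y _ => hP _
      P_le := fun y _ => (le_abs_self _).trans ((hs.abs_weight_le hT _).trans hKM)
      P_le_abs := fun y _ => by
        have h1 := hs.lipschitz.dist_le_mul (y - a t) 0
        rw [Real.dist_eq, Real.dist_eq, hP0, sub_zero, sub_zero] at h1
        exact (le_abs_self _).trans (h1.trans (by gcongr))
      meas_P' := (measurable_deriv P).comp (measurable_id.sub measurable_const)
      abs_P'_le := fun y _ => (abs_deriv_le_of_lipschitz hs.lipschitz _).trans hKM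
      deriv_U0 := fun y hy => hU.deriv 0 (by omega) t ht y (hpos y hy)
      cont_U1 := hUc 1 (by omega)
      cont_U2 := hUc 2 le_rfl }

/-- The energy estimate, with all the norms written out on the Fourier side. -/
lemma IsEnergySetup.exists_energyRate_le (hs : IsEnergySetup us0 δ T a P K)
    (h : IsShearData us0 c) (hc : 0 < c) (hδ : 0 < δ) (hT : 0 ≤ T) (hθ : 0 ≤ θ) (hθ' : θ ≤ 1 / 2)
    (ha : Admissible (shearFlow us0) c δ T a) (hP : ∀ z, 0 ≤ P z) (hP0 : P 0 = 0) {ε : ℝ}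
    (hε : 0 < ε) :
    ∃ C, 0 < C ∧ ∀ (lam : ℝ) (U : ℕ → ℝ → ℝ → L2x), 0 ≤ lam → IsLiftedFamily U T →
      ∀ t ∈ Icc 0 T,
        energyRate us0 U θ lam a P t
          + (lam - C) * (∫ y in (1 - 2 * δ)..(1 + 2 * δ),
              P (y - a t) * ‖japOp (5 / 4 - θ) (liftW (shearHeat us0) U t y)‖ ^ 2)
          + (∫ y in (1 - 2 * δ)..(1 + 2 * δ),
              P (y - a t) * ‖japOp (3 / 2) (liftWy (shearHeat us0) U t y)‖ ^ 2) ≤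
        C * ((∫ y in (1 - 2 * δ)..(1 + 2 * δ), ‖japOp (7 / 4) (U 0 t y)‖ ^ 2)
            + (∫ y in (1 - 2 * δ)..(1 + 2 * δ), ‖japOp (7 / 4) (U 1 t y)‖ ^ 2)
            + ∫ y in (1 - 2 * δ)..(1 + 2 * δ),
                ‖japOp (11 / 8) (liftW (shearHeat us0) U t y)‖ ^ 2)
          + ε * ∫ y in (1 - 2 * δ)..(1 + 2 * δ),
              ‖japOp (13 / 8) (liftWy (shearHeat us0) U t y)‖ ^ 2 := by
  obtain ⟨M, hM, hset⟩ := hs.exists_spatialSetup h hc hδ hT ha hP hP0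
  set A := 8 * M ^ 3 with hA
  set L := (1 + 2 * δ) - (1 - 2 * δ) with hL
  have hL0 : 0 < L := by rw [hL]; linarith
  set B := 8 * M ^ 5 * L * ((c / 2 * δ)⁻¹ ^ 2 * (L⁻¹ + 1)) with hB
  set D := (4 * M * (M / (c / 2)) + 2 * M ^ 2 + 2 * M) ^ 2 / (4 * ε) + 4 * M ^ 2 * (M / (c / 2))
    + 4 * M ^ 2 * (M / (c / 2)) * (M ^ 2 / (c / 2) ^ 4) with hD
  have hA0 : 0 ≤ A := by positivity
  have hB0 : 0 ≤ B := by positivity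
  have hD0 : 0 ≤ D := by positivity
  -- The `1` absorbs the weighted `H^{3/4}` term, dominated by the `H^{3/4+θ}` one; `A`, `B`, `D`
  -- multiply `∂_y u`, the trace of `u`, and the unweighted `w₂`.
  refine ⟨1 + A + B + D, by positivity, fun lam U hlam hU t ht => ?_⟩
  obtain ⟨hα, hset⟩ := hset t ht
  have hsp := hset U hU
  have hle : 1 - 2 * δ ≤ 1 + 2 * δ := by linarith
  have key := hsp.integral_errorTerm_le (by positivity) hM hδ hε hα
  have hint := hsp.intervalIntegrable_errorTerm hδ (criticalSpeed us0 a t)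
  have cW : ContinuousOn (liftW (shearHeat us0) U t) (Icc (1 - 2 * δ) (1 + 2 * δ)) := hsp.cont_W
  have cWy : ContinuousOn (liftWy (shearHeat us0) U t) (Icc (1 - 2 * δ) (1 + 2 * δ)) :=
    (hsp.cont_s1.smul hsp.cont_U2).sub (hsp.cont_s3.smul hsp.cont_U0)
  have iW : ∀ r, IntervalIntegrable (fun y => P (y - a t) *
      ‖japOp r (liftW (shearHeat us0) U t y)‖ ^ 2) volume (1 - 2 * δ) (1 + 2 * δ) := fun r =>
    (hsp.cont_P.mul ((japOp_comp_continuousOn cW r).norm.pow 2)).intervalIntegrable_of_Icc hle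
  have iWy : ∀ r, IntervalIntegrable (fun y => P (y - a t) *
      ‖japOp r (liftWy (shearHeat us0) U t y)‖ ^ 2) volume (1 - 2 * δ) (1 + 2 * δ) := fun r =>
    (hsp.cont_P.mul ((japOp_comp_continuousOn cWy r).norm.pow 2)).intervalIntegrable_of_Icc hle
  have hmono : (∫ y in (1 - 2 * δ)..(1 + 2 * δ),
      P (y - a t) * ‖japOp (5 / 4) (liftW (shearHeat us0) U t y)‖ ^ 2) ≤
      ∫ y in (1 - 2 * δ)..(1 + 2 * δ),
        P (y - a t) * ‖japOp (5 / 4 - θ) (liftW (shearHeat us0) U t y)‖ ^ 2 := by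
    refine intervalIntegral.integral_mono_on hle (iW _) (iW _) fun y _ => ?_
    have := norm_japOp_anti (r := 5 / 4 - θ) (s := 5 / 4) (by linarith) (by linarith)
      (liftW (shearHeat us0) U t y)
    have := hP (y - a t)
    gcongr
  have hrate : energyRate us0 U θ lam a P t = -(2 * lam) * (∫ y in (1 - 2 * δ)..(1 + 2 * δ),
        P (y - a t) * ‖japOp (5 / 4 - θ) (liftW (shearHeat us0) U t y)‖ ^ 2)
      - 2 * (∫ y in (1 - 2 * δ)..(1 + 2 * δ),
        P (y - a t) * ‖japOp (3 / 2) (liftWy (shearHeat us0) U t y)‖ ^ 2)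
      + ∫ y in (1 - 2 * δ)..(1 + 2 * δ), errorTerm (P (y - a t)) (deriv P (y - a t))
        (criticalSpeed us0 a t) (shearHeat us0 1 t y) (shearHeat us0 2 t y) (shearHeat us0 3 t y)
        (U 0 t y) (U 1 t y) (U 2 t y) := by
    rw [hs.energyRate_eq hP ht, ← intervalIntegral.integral_const_mul,
      ← intervalIntegral.integral_const_mul, ← intervalIntegral.integral_sub ((iW _).const_mul _)
      ((iWy _).const_mul _), ← intervalIntegral.integral_add (((iW _).const_mul _).sub
      ((iWy _).const_mul _)) hint]
    rfl
  have n1 : 0 ≤ ∫ y in (1 - 2 * δ)..(1 + 2 * δ),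
      P (y - a t) * ‖japOp (5 / 4 - θ) (liftW (shearHeat us0) U t y)‖ ^ 2 :=
    intervalIntegral.integral_nonneg hle fun y _ => mul_nonneg (hP _) (sq_nonneg _)
  have n2 : 0 ≤ ∫ y in (1 - 2 * δ)..(1 + 2 * δ),
      P (y - a t) * ‖japOp (3 / 2) (liftWy (shearHeat us0) U t y)‖ ^ 2 :=
    intervalIntegral.integral_nonneg hle fun y _ => mul_nonneg (hP _) (sq_nonneg _)
  have n3 : 0 ≤ ∫ y in (1 - 2 * δ)..(1 + 2 * δ), ‖japOp (7 / 4) (U 0 t y)‖ ^ 2 :=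
    intervalIntegral.integral_nonneg hle fun y _ => sq_nonneg _
  have n4 : 0 ≤ ∫ y in (1 - 2 * δ)..(1 + 2 * δ), ‖japOp (7 / 4) (U 1 t y)‖ ^ 2 :=
    intervalIntegral.integral_nonneg hle fun y _ => sq_nonneg _
  have n5 : 0 ≤ ∫ y in (1 - 2 * δ)..(1 + 2 * δ),
      ‖japOp (11 / 8) (liftW (shearHeat us0) U t y)‖ ^ 2 :=
    intervalIntegral.integral_nonneg hle fun y _ => sq_nonneg _
  rw [hrate]
  unfold liftW liftWy at *
  set I₁ := ∫ y in (1 - 2 * δ)..(1 + 2 * δ), P (y - a t) * ‖japOp (5 / 4 - θ)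
    (shearHeat us0 1 t y • U 1 t y - shearHeat us0 2 t y • U 0 t y)‖ ^ 2
  set I₂ := ∫ y in (1 - 2 * δ)..(1 + 2 * δ), P (y - a t) * ‖japOp (3 / 2)
    (shearHeat us0 1 t y • U 2 t y - shearHeat us0 3 t y • U 0 t y)‖ ^ 2
  set I₃ := ∫ y in (1 - 2 * δ)..(1 + 2 * δ), ‖japOp (7 / 4) (U 0 t y)‖ ^ 2
  set I₄ := ∫ y in (1 - 2 * δ)..(1 + 2 * δ), ‖japOp (7 / 4) (U 1 t y)‖ ^ 2
  set I₅ := ∫ y in (1 - 2 * δ)..(1 + 2 * δ),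
      ‖japOp (11 / 8) (shearHeat us0 1 t y • U 1 t y - shearHeat us0 2 t y • U 0 t y)‖ ^ 2
  set I₆ := ∫ y in (1 - 2 * δ)..(1 + 2 * δ),
      ‖japOp (13 / 8) (shearHeat us0 1 t y • U 2 t y - shearHeat us0 3 t y • U 0 t y)‖ ^ 2
  have e : 8 * M ^ 5 * L * ((c / 2 * δ)⁻¹ ^ 2 * ((L⁻¹ + 1) * (I₃ + I₄))) = B * (I₃ + I₄) := by
    rw [hB]; ring
  rw [e, ← hA, ← hD] at key
  have p1 := mul_nonneg hlam n1
  have p2 := mul_nonneg hA0 n1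
  have p3 := mul_nonneg hB0 n1
  have p4 := mul_nonneg hD0 n1
  have p5 := mul_nonneg hA0 n3
  have p6 := mul_nonneg hD0 n3
  have p7 := mul_nonneg hD0 n4
  have p8 := mul_nonneg hA0 n5
  have p9 := mul_nonneg hB0 n5
  linarith

end Estimate

end LinPrandtl

/-! ### The proposition: translation of the lifted estimate into the stated norms -/

open LinPrandtl in
theorem proposition5p2 (us0 : ℝ → ℝ) (c : ℝ) (hc : 0 < c) (hus0 : IsShearData us0 c)
    (θ : ℝ) (hθ : θ ∈ Set.Ioc (0 : ℝ) (1 / 2)) (θ₁ : ℝ) (hθ₁ : 0 < θ₁) :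
    ∃ δ₀ : ℝ, 0 < δ₀ ∧ ∀ δ ∈ Set.Ioc 0 δ₀, MonotoneAway us0 c δ →
      (∃ T : ℝ, 0 < T ∧ ∃ a : ℝ → ℝ, Admissible (shearFlow us0) c δ T a) ∧
      ∀ (T : ℝ) (a φ₁ ψ₂ ϕ : ℝ → ℝ), 0 < T → Admissible (shearFlow us0) c δ T a →
        IsOuterCutoff δ φ₁ → IsInnerCutoff δ ψ₂ → IsWeight δ T a ϕ →
        ∀ δ₂ : ℝ, 0 < δ₂ → ∃ C : ℝ, 0 < C ∧
          ∀ (lam : ℝ) (u : ℝ → ℝ → L2x), 0 < lam →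
            IsSolution (shearFlow us0) ψ₂ θ lam T u →
            -- the squared `H^{s,0}` norms of `(w₂)_Φ φ^{(1+θ₁)/2}` and `∂_y (w₂)_Φ φ^{(1+θ₁)/2}`
            let W : ℝ → ℝ → ENNReal := fun s t =>
              normSq θ lam s t (prodF (weight θ₁ a ϕ) (w2 (shearFlow us0) u) t)
            let Wy : ℝ → ℝ → ENNReal := fun s t =>
              normSq θ lam s t (prodF (weight θ₁ a ϕ) (dy (w2 (shearFlow us0) u)) t)
            ∀ t ∈ Set.Icc 0 T,
              W (1 / 2) t ≠ ⊤ ∧ W (3 / 4 + θ) t ≠ ⊤ ∧ Wy (1 / 2) t ≠ ⊤ ∧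
              ∃ E' : ℝ,
                HasDerivWithinAt (fun τ => (W (1 / 2) τ).toReal) E' (Set.Icc 0 T) t ∧
                ENNReal.ofReal
                    (E' + (lam - C) * (W (3 / 4 + θ) t).toReal + (Wy (1 / 2) t).toReal) ≤
                  ENNReal.ofReal C *
                      ((normSq θ lam (1 / 4) t (u t) + normSq θ lam (1 / 4) t (dy u t))
                        + normSq θ lam (1 / 2) t (w1bar (shearFlow us0) φ₁ u t)
                        + normSq θ lam (5 / 8) t (w2bar (shearFlow us0) ψ₂ u t)
                        + W (1 / 2) t)
                    + ENNReal.ofReal δ₂ *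
                        normSq θ lam (3 / 8) t (dy (w2bar (shearFlow us0) ψ₂ u) t) := by
  -- With `δ ≤ 1/8` the interval `[1-2δ, 1+2δ]` lies in the convexity region `[1/2, 2]`, and `3δ <
  -- 1/2` as the moving frame requires.
  refine ⟨1 / 8, by norm_num, fun δ hδ hm => ⟨hus0.exists_admissible hc hδ.1
    (hδ.2.trans (by norm_num)) hm, fun T a φ₁ ψ₂ ϕ hT ha _ hψ hw δ₂ hδ₂ => ?_⟩⟩
  have hp : 1 ≤ 1 + θ₁ := by linarith
  obtain ⟨K, hK⟩ := hw.exists_lipschitzWith_rpow hδ.1 hT.le hp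
  have hs := hw.isEnergySetup hus0 hc hδ.1 hδ.2 ha hp hK
  have hP : ∀ z, 0 ≤ ϕ z ^ (1 + θ₁) := fun z => Real.rpow_nonneg (hw.nonneg z) _
  have hP0 : ϕ 0 ^ (1 + θ₁) = 0 := by rw [hw.zero, Real.zero_rpow (by linarith)]
  obtain ⟨C, hC, hest⟩ := hs.exists_energyRate_le hus0 hc hδ.1 hT.le hθ.1.le hθ.2 ha hP hP0 hδ₂
  refine ⟨C, hC, fun lam u hlam hu => ?_⟩
  intro W Wy t ht
  have hU := hu.isLiftedSolution hus0 hψ hδ.2 hθ.1.le hθ.2 hlam.le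
  set U := solutionLift θ lam u with hUdef
  have hlo : 0 < 1 - 2 * δ := by linarith [hδ.2]
  have hle : 1 - 2 * δ ≤ 1 + 2 * δ := by linarith [hδ.1]
  have hpos : Set.Icc (1 - 2 * δ) (1 + 2 * δ) ⊆ Set.Ioi 0 := fun y hy => hlo.trans_le hy.1
  have habs : ∀ y ∈ Set.Ioo (1 - 2 * δ) (1 + 2 * δ), |y - 1| < 2 * δ := fun y hy =>
    abs_lt.2 ⟨by linarith [hy.1], by linarith [hy.2]⟩
  have hcont : ∀ {F : ℝ × ℝ → L2x}, ContinuousOn F (Set.Icc 0 T ×ˢ Set.Ioi 0) →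
      ∀ τ ∈ Set.Icc 0 T, ContinuousOn (fun y => F (τ, y)) (Set.Icc (1 - 2 * δ) (1 + 2 * δ)) :=
    fun hF τ hτ => hF.comp (f := fun y => (τ, y)) (by fun_prop) fun y hy => ⟨hτ, hpos hy⟩
  have cW := hcont (hU.continuousOn_liftW hus0)
  have cWy := hcont (hU.continuousOn_liftWy hus0)
  have hr : ∀ τ ∈ Set.Icc 0 T, ∀ y, y ∉ Set.Ioo (1 - 2 * δ) (1 + 2 * δ) →
      weight θ₁ a ϕ τ y = 0 := fun τ hτ y hy => by
    have h0 : ϕ (y - a τ) = 0 := by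
      by_contra hne
      have := abs_lt.1 (hw.abs_sub_one_lt hδ.1 hτ hne)
      exact hy ⟨by linarith, by linarith⟩
    rw [weight, h0, Real.zero_rpow (by linarith)]
  have hrc : ∀ τ, ContinuousOn (fun y => weight θ₁ a ϕ τ y ^ 2)
      (Set.Icc (1 - 2 * δ) (1 + 2 * δ)) := fun τ => by
    simp only [hw.weight_sq]
    exact (hK.continuous.comp (continuous_id.sub continuous_const)).continuousOn
  have eW : ∀ s ≤ 2, ∀ τ ∈ Set.Icc 0 T, W s τ = ENNReal.ofReal
      (∫ y in (1 - 2 * δ)..(1 + 2 * δ), ϕ (y - a τ) ^ (1 + θ₁) *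
        ‖japOp (2 - s) (liftW (shearHeat us0) U τ y)‖ ^ 2) := fun s hs2 τ hτ => by
    have := normSq_smul_eq hs2 hlo hle (hr τ hτ) (hrc τ)
      (fun y hy => hu.isLift_w2 hus0 hτ hy) (cW τ hτ)
    simp only [hw.weight_sq] at this
    exact this
  have eWy : Wy (1 / 2) t = ENNReal.ofReal
      (∫ y in (1 - 2 * δ)..(1 + 2 * δ), ϕ (y - a t) ^ (1 + θ₁) *
        ‖japOp (3 / 2) (liftWy (shearHeat us0) U t y)‖ ^ 2) := by
    have := normSq_smul_eq (s := 1 / 2) (by norm_num) hlo hle (hr t ht) (hrc t)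
      (fun y hy => hu.isLift_dy_w2 hus0 ht hy) (cWy t ht)
    rw [show (2 : ℝ) - 1 / 2 = 3 / 2 by norm_num] at this
    simp only [hw.weight_sq] at this
    exact this
  have hint0 : ∀ {f : ℝ → ℝ}, (∀ y, 0 ≤ f y) → 0 ≤ ∫ y in (1 - 2 * δ)..(1 + 2 * δ), f y :=
    fun hf => intervalIntegral.integral_nonneg hle fun y _ => hf y
  have eE : ∀ τ ∈ Set.Icc 0 T, (W (1 / 2) τ).toReal =
      energy (shearHeat us0) U a (fun z => ϕ z ^ (1 + θ₁)) τ := fun τ hτ => by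
    rw [eW (1 / 2) (by norm_num) τ hτ, ENNReal.toReal_ofReal
      (hint0 fun y => mul_nonneg (hP _) (sq_nonneg _)), hs.energy_eq hτ,
      show (2 : ℝ) - 1 / 2 = 3 / 2 by norm_num]
  refine ⟨by rw [eW _ (by norm_num) t ht]; exact ENNReal.ofReal_ne_top,
    by rw [eW _ (by linarith [hθ.2]) t ht]; exact ENNReal.ofReal_ne_top,
    by rw [eWy]; exact ENNReal.ofReal_ne_top, energyRate us0 U θ lam a (fun z => ϕ z ^ (1 + θ₁)) t,
    (hs.hasDerivWithinAt_energy hθ.2 hT hU hus0 ht).congr eE (eE t ht), ?_⟩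
  have key := hest lam U hlam.le hU.toIsLiftedFamily t ht
  rw [eW (3 / 4 + θ) (by linarith [hθ.2]) t ht, eWy,
    ENNReal.toReal_ofReal (hint0 fun y => mul_nonneg (hP _) (sq_nonneg _)),
    ENNReal.toReal_ofReal (hint0 fun y => mul_nonneg (hP _) (sq_nonneg _)),
    show 2 - (3 / 4 + θ) = 5 / 4 - θ by ring]
  refine (ENNReal.ofReal_le_ofReal key).trans ?_
  have b0 := ofReal_integral_le_normSq (s := 1 / 4) (by norm_num) hlo hle
    (fun y hy => hu.isLift (k := 0) (by omega) ht (hpos (Set.Ioo_subset_Icc_self hy)))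
    (hcont (hU.cont 0 (by omega)) t ht)
  have b1 := ofReal_integral_le_normSq (s := 1 / 4) (by norm_num) hlo hle
    (fun y hy => hu.isLift (k := 1) (by omega) ht (hpos (Set.Ioo_subset_Icc_self hy)))
    (hcont (hU.cont 1 (by omega)) t ht)
  have b2 := ofReal_integral_le_normSq (s := 5 / 8) (g := w2bar (shearFlow us0) ψ₂ u t)
    (by norm_num) hlo hle (fun y hy => by
      rw [hψ.w2bar_eq (habs y hy)]
      exact hu.isLift_w2 hus0 ht (hpos (Set.Ioo_subset_Icc_self hy))) (cW t ht)
  have b3 := ofReal_integral_le_normSq (s := 3 / 8) (g := dy (w2bar (shearFlow us0) ψ₂ u) t)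
    (by norm_num) hlo hle (fun y hy => by
      rw [hψ.dy_w2bar_eq (habs y hy)]
      exact hu.isLift_dy_w2 hus0 ht (hpos (Set.Ioo_subset_Icc_self hy))) (cWy t ht)
  rw [show (2 : ℝ) - 1 / 4 = 7 / 4 by norm_num] at b0 b1
  rw [show (2 : ℝ) - 5 / 8 = 11 / 8 by norm_num] at b2
  rw [show (2 : ℝ) - 3 / 8 = 13 / 8 by norm_num] at b3
  have n0 : 0 ≤ ∫ y in (1 - 2 * δ)..(1 + 2 * δ), ‖japOp (7 / 4) (U 0 t y)‖ ^ 2 :=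
    hint0 fun y => sq_nonneg _
  have n1 : 0 ≤ ∫ y in (1 - 2 * δ)..(1 + 2 * δ), ‖japOp (7 / 4) (U 1 t y)‖ ^ 2 :=
    hint0 fun y => sq_nonneg _
  have n2 : 0 ≤ ∫ y in (1 - 2 * δ)..(1 + 2 * δ),
      ‖japOp (11 / 8) (liftW (shearHeat us0) U t y)‖ ^ 2 := hint0 fun y => sq_nonneg _
  have n3 : 0 ≤ ∫ y in (1 - 2 * δ)..(1 + 2 * δ),
      ‖japOp (13 / 8) (liftWy (shearHeat us0) U t y)‖ ^ 2 := hint0 fun y => sq_nonneg _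
  rw [ENNReal.ofReal_add (by positivity) (by positivity), ENNReal.ofReal_mul hC.le,
    ENNReal.ofReal_mul hδ₂.le, ENNReal.ofReal_add (by positivity) n2, ENNReal.ofReal_add n0 n1]
  refine add_le_add (mul_le_mul_right ?_ _) (mul_le_mul_right b3 _)
  refine (add_le_add (add_le_add b0 b1) b2).trans ?_
  -- The norms of `w̄₁` and of the weighted `w₂` are nonnegative and are simply added: `u` in
  -- `H^{1/4,1}` and `w̄₂` in `H^{5/8,0}` already suffice.
  refine le_trans ?_ (le_add_right le_rfl)
  exact add_le_add (le_add_right le_rfl) le_rfl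

end
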